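/- Let $K$ be a number field with set of places $\Omega_K$, and let $S\subset\Omega_K$ be a finite set containing all archimedean places. Let $n\ge 0$ and $m\ge 2$ be integers, and let $Q\subset\mathbb{P}^{n+1}_K$ be a reduced quadric hypersurface, i.e. the zero locus of a square-free quadratic form $f\in K[X_0,\dots,X_{n+1}]$. Let $\mathcal{Q}$ be the Zariski closure of $Q$ in $\mathbb{P}^{n+1}_{\mathcal{O}_S}$, and put $Q_m=(1-\frac1m)Q$, $\mathcal{Q}_m=(1-\frac1m)\mathcal{Q}$. For a place $v\notin S$ and $P\in\mathbb{P}^{n+1}(K_v)$, let $\mathcal{P}_v\colon \operatorname{Spec}\mathcal{O}_v\to\mathbb{P}^{n+1}_{\mathcal{O}_v}$ be the extension of $P$, and define $n_v(\mathcal{Q},P)\in\mathbb{Z}_{\ge0}\cup\{\infty\}$ by $\mathcal{P}_v\cap\mathcal{Q}\cong\operatorname{Spec}\mathcal{O}_v/(\pi_v^{\,n_v(\mathcal{Q},P)})$, with $n_v(\mathcal{Q},P)=\infty$ if and only if $P\in Q$. The point $P$ is a local Campana point if $n_v(\mathcal{Q},P)\in\mathbb{Z}_{\ge m}\cup\{0,\infty\}$,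 and a local Darmon point if $m\mid n_v(\mathcal{Q},P)$ (where $m\mid\infty$). For $*\in\{\mathrm{C},\mathrm{D}\}$ (Campana, Darmon), write $(\mathbb{P}^{n+1}_{\mathcal{O}_S},\mathcal{Q}_m)^{*}(\mathcal{O}_v)$ for the set of local $*$-points, and $(\mathbb{P}^{n+1}_{\mathcal{O}_S},\mathcal{Q}_m)^{*}(\mathcal{O}_S)$ for the set of $P\in\mathbb{P}^{n+1}(K)$ that are local $*$-points at every $v\notin S$. For a finite set $T\subset\Omega_K$, the set $(\mathbb{P}^{n+1}_{\mathcal{O}_S},\mathcal{Q}_m)^{*}(\mathbb{A}_K^T)$ consists of the families $(P_v)_{v\notin T}$, $P_v\in\mathbb{P}^{n+1}(K_v)$, with $P_v$ a local $*$-point for all $v\notin S\cup T$, such that either $P_v\in Q$ for all $v\notin T$, or $P_v\notin Q$ for all $v\notin T$ and $n_v(\mathcal{Q},P_v)=0$ for all but finitely many $v\notin S\cup T$. Weak approximation for $*$-points off $T$ means that $(\mathbb{P}^{n+1}_{\mathcal{O}_S},\mathcal{Q}_m)^{*}(\mathcal{O}_S)$, embedded diagonally, is dense in $(\mathbb{P}^{n+1}_{\mathcal{O}_S},\mathcal{Q}_m)^{*}(\mathbb{A}_K^T)$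 for the topology induced by the product topology of $\prod_{v\notin T}\mathbb{P}^{n+1}(K_v)$. Weak approximation for $*$-points is the case $T=\emptyset$; weak weak approximation for $*$-points means weak approximation for $*$-points off some finite set $T$ of places. (If $Q$ is a union of two distinct hyperplanes $D_1,D_2$ over $K$, then $Q_m$ may be read either as above, with $Q$ as a single component of weight $m$, or as $(1-\frac1m)D_1+(1-\frac1m)D_2$. In the second reading the local conditions are imposed on each closure $\mathcal{D}_i$ separately, $P_v\notin Q$ and $n_v(\mathcal{Q},P_v)=0$ are required for both components, and "$P_v\in Q$ for all $v\notin T$" becomes "$P_v\in D_i$ for all $v\notin T$, for some $i$". The theorem holds in both readings.) **Theorem.** (i) The orbifold $(\mathbb{P}^{n+1}_{\mathcal{O}_S},\mathcal{Q}_m)$ satisfies weak approximation for Campana points, and $(\mathbb{P}^{n+1}_{\mathcal{O}_S},\mathcal{Q}_m)^{\mathrm{C}}(\mathcal{O}_S)\ne\emptyset$. (ii) If $m$ is even, then $(\mathbb{P}^{n+1}_{\mathcal{O}_S},\mathcal{Q}_m)$ fails weak weak approximation for Darmon points, and the set of Darmon points $(\mathbb{P}^{n+1}_{\mathcal{O}_S},\mathcal{Q}_m)^{\mathrm{D}}(\mathcal{O}_S)$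 is thin in $\mathbb{P}^{n+1}(K)$: it is contained in a finite union of sets $Z(K)$, with $Z\subsetneq\mathbb{P}^{n+1}_K$ closed, and $\pi(Y(K))$, with $\pi\colon Y\to\mathbb{P}^{n+1}_K$ a dominant generically finite morphism of degree at least $2$ from an integral $K$-variety $Y$. -/

import Mathlib

open NumberField IsDedekindDomain
open scoped LinearAlgebra.Projectivization

universe u

namespace SemiIntegral

noncomputable section

/-! ### Places and completions -/

/-- The set `Ω_K` of places of a number field: the finite places are the maximal ideals of `𝓞 K`,
the archimedean ones are Mathlib's infinite places. -/
abbrev Place (K : Type u) [Field K] [NumberField K] : Type u :=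
  HeightOneSpectrum (𝓞 K) ⊕ InfinitePlace K

/-- The completion `K_v`. -/
abbrev Place.Completion {K : Type u} [Field K] [NumberField K] (v : Place K) : Type u :=
  match v with
  | .inl v => v.adicCompletion K
  | .inr w => w.Completion

instance {K : Type u} [Field K] [NumberField K] (v : Place K) : Field v.Completion :=
  match v with
  | .inl v => inferInstanceAs (Field (v.adicCompletion K))
  | .inr w => inferInstanceAs (Field w.Completion)

instance {K : Type u} [Field K] [NumberField K] (v : Place K) : TopologicalSpace v.Completion :=
  match v with
  | .inl v => inferInstanceAs (TopologicalSpace (v.adicCompletion K))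
  | .inr w => inferInstanceAs (TopologicalSpace w.Completion)

instance {K : Type u} [Field K] [NumberField K] (v : Place K) : Algebra K v.Completion :=
  match v with
  | .inl v => inferInstanceAs (Algebra K (v.adicCompletion K))
  | .inr w => inferInstanceAs (Algebra K w.Completion)

/-- The finite places belonging to a set of places `S`. -/
def finitePart {K : Type u} [Field K] [NumberField K] (S : Finset (Place K)) :
    Set (HeightOneSpectrum (𝓞 K)) :=
  {v | (Sum.inl v : Place K) ∈ S}

/-- The ring `𝓞_S` of `S`-integers. -/
abbrev SInteger {K : Type u} [Field K] [NumberField K] (S : Finset (Place K)) :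
    Subalgebra (𝓞 K) K :=
  (finitePart S).integer K

/-! ### Projective space and its points -/

/-- `L`-points of the projective space with `N` homogeneous coordinates, i.e. `ℙ^{N-1}(L)`. -/
abbrev ProjPoint (L : Type u) [Field L] (N : ℕ) : Type u := ℙ L (Fin N → L)

/-- The topology of `ℙ^{N-1}(L)` for a topological field `L`: the quotient topology of
`L^N ∖ {0}`. -/
instance projTopology (L : Type u) [Field L] [TopologicalSpace L] (N : ℕ) :
    TopologicalSpace (ProjPoint L N) :=
  TopologicalSpace.coinduced (Projectivization.mk' L (V := Fin N → L)) inferInstance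

/-- The inclusion `ℙ^{N-1}(K) → ℙ^{N-1}(L)` for a field extension `L / K`. -/
def baseChange (K L : Type u) [Field K] [Field L] [Algebra K L] {N : ℕ} :
    ProjPoint K N → ProjPoint L N :=
  Projectivization.map (σ := algebraMap K L)
    { toFun := fun x i => algebraMap K L (x i)
      map_add' := fun x y => by ext i; simp
      map_smul' := fun c x => by ext i; simp }
    (fun x y h => by
      ext i
      exact (algebraMap K L).injective (congrFun h i))

/-- The `L`-point `P` lies on the hypersurface `Z(F)`, for a form `F` over `K`. -/
def OnHypersurface {K L : Type u} [Field K] [Field L] [Algebra K L] {N : ℕ}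
    (F : MvPolynomial (Fin N) K) (P : ProjPoint L N) : Prop :=
  MvPolynomial.aeval P.rep F = 0

/-! ### Models and intersection multiplicities -/

/-- The homogeneous ideal `(F) ∩ 𝓞_S[x]` of `𝓞_S[x]` which cuts out the closure in
`ℙ^{N-1}_{𝓞_S}` of the hypersurface `Z(F)` of the generic fibre `ℙ^{N-1}_K`. -/
def closureIdeal {K : Type u} [Field K] [NumberField K] (S : Finset (Place K)) {N : ℕ}
    (F : MvPolynomial (Fin N) K) : Ideal (MvPolynomial (Fin N) (SInteger S)) :=
  (Ideal.span {F}).comap (MvPolynomial.map (algebraMap (SInteger S) K))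

/-- The ideal `I` of `𝓞_v` with `𝒫_v ∩ 𝒵 = Spec 𝓞_v / I`, where `𝒵` is the closure of `Z(F)` in
`ℙ^{N-1}_{𝓞_S}` and `𝒫_v : Spec 𝓞_v → ℙ^{N-1}` extends the `K_v`-point `P`. The extension is given
by homogeneous coordinates `a_i ∈ 𝓞_v` of `P` of which at least one is a unit, and the ideal is
generated by the values at `a` of the elements of the ideal of `𝒵`. (Two such coordinate vectors
differ by a unit of `𝓞_v`, so that they give the same ideal; all of them are used here.) -/
def intersectionIdeal {K : Type u} [Field K] [NumberField K] (S : Finset (Place K)) {N : ℕ}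
    (F : MvPolynomial (Fin N) K) (v : HeightOneSpectrum (𝓞 K))
    (P : ProjPoint (v.adicCompletion K) N) : Ideal (v.adicCompletionIntegers K) :=
  Ideal.span {x | ∃ (a : Fin N → v.adicCompletionIntegers K)
    (ha : (fun i => (a i : v.adicCompletion K)) ≠ 0),
    (∃ i, IsUnit (a i)) ∧
    P = Projectivization.mk (v.adicCompletion K) (fun i => (a i : v.adicCompletion K)) ha ∧
    ∃ g ∈ closureIdeal S F,
      (x : v.adicCompletion K) = MvPolynomial.aeval (fun i => (a i : v.adicCompletion K))
        (MvPolynomial.map (algebraMap (SInteger S) K) g)}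

/-- The intersection multiplicity `n_v(𝒵, P)`: it is `∞` if the ideal above is `0`, and `n` if that
ideal is the `n`-th power of the maximal ideal of `𝓞_v`. -/
def intersectionMultiplicity {K : Type u} [Field K] [NumberField K] (S : Finset (Place K))
    {N : ℕ} (F : MvPolynomial (Fin N) K) (v : HeightOneSpectrum (𝓞 K))
    (P : ProjPoint (v.adicCompletion K) N) : ℕ∞ :=
  emultiplicity (IsLocalRing.maximalIdeal (v.adicCompletionIntegers K))
    (intersectionIdeal S F v P)

/-! ### Orbifold divisors on projective space -/

/-- A `ℚ`-divisor `∑ (1 - 1/m_α) D_α` on `ℙ^{N-1}_K` with finite weights `m_α ≥ 2`. Its components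
`D_α = Z(F_α)` are reduced hypersurfaces without common components. They are not required to be
irreducible, so that a reducible reduced hypersurface can be taken either as one component or as the
sum of several ones; an irreducible hypersurface can be decomposed in one way only. -/
structure OrbifoldDivisor (K : Type u) [Field K] (N : ℕ) where
  /-- the number of components -/
  r : ℕ
  /-- the form `F_α` defining the component `D_α` -/
  form : Fin r → MvPolynomial (Fin N) K
  /-- the degree of the component `D_α` -/
  degree : Fin r → ℕ
  /-- the weight `m_α` -/
  weight : Fin r → ℕ
  isHomogeneous : ∀ α, (form α).IsHomogeneous (degree α)
  degree_pos : ∀ α, 0 < degree α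
  squarefree : ∀ α, Squarefree (form α)
  isRelPrime : Pairwise fun α β => IsRelPrime (form α) (form β)
  two_le_weight : ∀ α, 2 ≤ weight α

/-- `D` is the `ℚ`-divisor `(1 - 1/m) Z(f)`. -/
def OrbifoldDivisor.IsHypersurface {K : Type u} [Field K] {N : ℕ} (D : OrbifoldDivisor K N)
    (m : ℕ) (f : MvPolynomial (Fin N) K) : Prop :=
  ∏ α, D.form α = f ∧ ∀ α, D.weight α = m

/-- The two kinds of semi-integral points. -/
inductive Kind
  | campana
  | darmon

/-- The condition on an intersection multiplicity with a component of weight `m`: for Campana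
points it belongs to `ℤ_{≥ m} ∪ {0, ∞}`, for Darmon points it is divisible by `m` (where every `m`
divides `∞`). -/
def Kind.Admissible : Kind → ℕ → ℕ∞ → Prop
  | .campana, m, k => k = 0 ∨ k = ⊤ ∨ (m : ℕ∞) ≤ k
  | .darmon, m, k => k = ⊤ ∨ ∃ j : ℕ, k = ((m * j : ℕ) : ℕ∞)

section Points

variable {K : Type u} [Field K] [NumberField K] {N : ℕ}

/-- The `v`-adic semi-integral points `(ℙ_{𝓞_S}, 𝒟)^*(𝓞_v)`, for a finite place `v`. -/
def localPoints (S : Finset (Place K)) (D : OrbifoldDivisor K N) (k : Kind)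
    (v : HeightOneSpectrum (𝓞 K)) : Set (ProjPoint (v.adicCompletion K) N) :=
  {P | ∀ α, k.Admissible (D.weight α) (intersectionMultiplicity S (D.form α) v P)}

/-- The semi-integral points `(ℙ_{𝓞_S}, 𝒟)^*(𝓞_S)`. -/
def globalPoints (S : Finset (Place K)) (D : OrbifoldDivisor K N) (k : Kind) :
    Set (ProjPoint K N) :=
  {P | ∀ v : HeightOneSpectrum (𝓞 K), (Sum.inl v : Place K) ∉ S →
    baseChange K (v.adicCompletion K) P ∈ localPoints S D k v}

/-- The integral points `𝒰(𝓞_v)` of `𝒰 = ℙ_{𝓞_S} ∖ 𝒟_red`: those `P` for which the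
`𝓞_v`-point `𝒫_v` does not meet `𝒟_red`. -/
def localIntegralPoints (S : Finset (Place K)) (D : OrbifoldDivisor K N)
    (v : HeightOneSpectrum (𝓞 K)) : Set (ProjPoint (v.adicCompletion K) N) :=
  {P | ∀ α, intersectionMultiplicity S (D.form α) v P = 0}

/-- The product `∏_{v ∉ T} ℙ(K_v)`, with the product topology. -/
abbrev LocalProduct (K : Type u) [Field K] [NumberField K] (N : ℕ) (T : Finset (Place K)) :
    Type u :=
  (v : {v : Place K // v ∉ T}) → ProjPoint v.1.Completion N

/-- Families of points outside `T` which are semi-integral at all places outside `S ∪ T`. -/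
def locallySemiIntegral (S T : Finset (Place K)) (D : OrbifoldDivisor K N) (k : Kind) :
    Set (LocalProduct K N T) :=
  {x | ∀ (v : HeightOneSpectrum (𝓞 K)) (hT : (Sum.inl v : Place K) ∉ T),
    (Sum.inl v : Place K) ∉ S → x ⟨Sum.inl v, hT⟩ ∈ localPoints S D k v}

/-- The strict `T`-adelic semi-integral points: all the points lie in `U = ℙ ∖ D_red`, those at the
places outside `S ∪ T` are semi-integral, and all but finitely many of them lie in `𝒰(𝓞_v)`. -/
def strictAdelicPoints (S T : Finset (Place K)) (D : OrbifoldDivisor K N) (k : Kind) :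
    Set (LocalProduct K N T) :=
  {x | x ∈ locallySemiIntegral S T D k ∧
    (∀ v α, ¬ OnHypersurface (D.form α) (x v)) ∧
    {v : HeightOneSpectrum (𝓞 K) | (Sum.inl v : Place K) ∉ S ∧
      ∃ hT : (Sum.inl v : Place K) ∉ T,
        x ⟨Sum.inl v, hT⟩ ∉ localIntegralPoints S D v}.Finite}

/-- The non-strict `T`-adelic semi-integral points: for some `α` all the points lie on `D_α`, and
those at the places outside `S ∪ T` are semi-integral. -/
def nonstrictAdelicPoints (S T : Finset (Place K)) (D : OrbifoldDivisor K N) (k : Kind) :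
    Set (LocalProduct K N T) :=
  {x | x ∈ locallySemiIntegral S T D k ∧ ∃ α, ∀ v, OnHypersurface (D.form α) (x v)}

/-- The `T`-adelic semi-integral points `(ℙ_{𝓞_S}, 𝒟)^*(𝔸_K^T)`. -/
def adelicPoints (S T : Finset (Place K)) (D : OrbifoldDivisor K N) (k : Kind) :
    Set (LocalProduct K N T) :=
  strictAdelicPoints S T D k ∪ nonstrictAdelicPoints S T D k

/-- The diagonal embedding of the `K`-points. -/
def diagonal (T : Finset (Place K)) (P : ProjPoint K N) : LocalProduct K N T :=
  fun v => baseChange K v.1.Completion P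

/-- Weak approximation for `*`-points off `T`: the semi-integral points are dense in the `T`-adelic
semi-integral points with respect to the product topology. -/
def WeakApproximationOff (S T : Finset (Place K)) (D : OrbifoldDivisor K N) (k : Kind) : Prop :=
  adelicPoints S T D k ⊆ closure (diagonal T '' globalPoints S D k)

/-- Weak approximation for `*`-points. -/
def WeakApproximation (S : Finset (Place K)) (D : OrbifoldDivisor K N) (k : Kind) : Prop :=
  WeakApproximationOff S ∅ D k

/-- Weak weak approximation for `*`-points: weak approximation off some finite set of places. -/
def WeakWeakApproximation (S : Finset (Place K)) (D : OrbifoldDivisor K N) (k : Kind) : Prop :=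
  ∃ T : Finset (Place K), WeakApproximationOff S T D k

end Points

/-! ### Thin sets -/

section Thin

variable {K : Type u} [Field K] {N : ℕ}

/-- Type I: sets of `K`-points contained in a proper closed subset of projective space. -/
def IsThinOfTypeI (A : Set (ProjPoint K N)) : Prop :=
  ∃ (d : ℕ) (G : MvPolynomial (Fin N) K), G.IsHomogeneous d ∧ G ≠ 0 ∧
    ∀ P ∈ A, OnHypersurface G P

/-- Type II: sets of `K`-points contained in `π(Y(K))` for an integral affine `K`-scheme of finite
type `Y = Spec B` and a dominant, generically finite morphism `π : Y → ℙ^{N-1}_K` of degree at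
least `2`. Here `π = [h_0 : ⋯ : h_{N-1}]` for `h_i ∈ B` generating the unit ideal, and the degree is
that of the function field of `Y` over the function field `K(h_i / h_j)` of projective space
(`finrank` is `0` for an infinite extension). An arbitrary variety over projective space is a finite
union of such affine open subsets, so nothing is lost for finite unions by taking `Y` affine. -/
def IsThinOfTypeII (A : Set (ProjPoint K N)) : Prop :=
  ∃ (B : Type u) (_ : CommRing B) (_ : IsDomain B) (_ : Algebra K B) (h : Fin N → B),
    Algebra.FiniteType K B ∧
    Ideal.span (Set.range h) = ⊤ ∧
    (∀ (d : ℕ) (G : MvPolynomial (Fin N) K), G.IsHomogeneous d →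
      MvPolynomial.aeval h G = 0 → G = 0) ∧
    2 ≤ Module.finrank
      (IntermediateField.adjoin K
        {z : FractionRing B | ∃ i j, z = algebraMap B (FractionRing B) (h i) /
          algebraMap B (FractionRing B) (h j)})
      (FractionRing B) ∧
    ∀ P ∈ A, ∃ (p : B →ₐ[K] K) (hp : (fun i => p (h i)) ≠ 0),
      P = Projectivization.mk K (fun i => p (h i)) hp

/-- A set of `K`-points of projective space is thin if it is contained in a finite union of sets of
type I and type II. -/
def IsThin (A : Set (ProjPoint K N)) : Prop :=
  ∃ C : Set (Set (ProjPoint K N)), C.Finite ∧ A ⊆ ⋃₀ C ∧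
    ∀ B ∈ C, IsThinOfTypeI B ∨ IsThinOfTypeII B

end Thin

end

end SemiIntegral

open Filter Topology WithZero

namespace SemiIntegral

/-! ### Weak approximation for the field -/

section Approximation

variable {K : Type u} [Field K] [NumberField K]

/-! Everything is read off homogeneous coordinates. By Gauss's lemma, at v ∉ S the closure of Z(F)
is cut out by a multiple of F of content one, so n_v measures how far |F(z)|_v lies below its a
priori bound content(F)·|z|_v^deg F (`natCast_le_intersectionMultiplicity_iff`).

Campana points. The local condition is open, also at points of the quadric. Take x over K close to
the prescribed points at the prescribed places, with f(x) ≠ 0. It may violate the condition at a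
finite set B of other places; take y satisfying it at the places of B. On the line through x and y
write sx + ty as s + tω in the quadratic algebra K[ω] for which f(sx + ty) = f(x)·N(s + tω), so that
x is 1 and y is ω. At a place where this line has good reduction, every product u^k z^l with u a
unit and l ≥ m is Campana: each component of the quadric restricts to a multiplicative function
(`exists_monoidHom_eval_linePoint`), and the sup-norm respects powers because the discriminant is a
unit (`quadVal_pow`), so all multiplicities are l times those of z (`campana_linePoint`). The point
used is θ_c^m · ω_d^(m+1), where θ = ω⁻¹ and e_c = 1 + c(e − 1). For c, d near 0 it is near 1, that
is x; for c, d near 1 it is near ω^(−m)·ω^(m+1) = ω, that is y. First c is chosen, then d, with d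
also close to 0 at the remaining places where θ_c is not a unit. Then at every remaining place one
factor is a unit and the other is a power with exponent at least m (`exists_campana_approximation`).

Darmon points. For even m the values of f at Darmon points off the quadric have even valuation
outside a fixed finite set of places. Finiteness of the class group and finite generation of the
units leave finitely many classes ε modulo squares (`exists_finset_even_valuation`). So these points
lift to the double covers f = εt², which are irreducible because a square-free form is not a
constant times a square; hence thinness. To defeat approximation off T, give each ε its own place
outside T and a point of multiplicity zero there at which f/ε is a nonsquare unit. No rational
Darmon point is close to all of these. -/

instance (v : Place K) : IsTopologicalRing v.Completion :=
  match v with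
  | .inl v => inferInstanceAs (IsTopologicalRing (v.adicCompletion K))
  | .inr w => inferInstanceAs (IsTopologicalRing w.Completion)

instance (v : Place K) : T1Space v.Completion :=
  match v with
  | .inl v => inferInstanceAs (T1Space (v.adicCompletion K))
  | .inr w => inferInstanceAs (T1Space w.Completion)

/-- The normalized absolute value on `K` attached to a place. -/
noncomputable def Place.abv (v : Place K) : AbsoluteValue K ℝ :=
  match v with
  | .inl v => NumberField.HeightOneSpectrum.adicAbv K v
  | .inr w => w.1

theorem Place.abv_isNontrivial (v : Place K) : v.abv.IsNontrivial := by
  match v with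
  | .inl v =>
    obtain ⟨π, hπ⟩ := v.valuation_exists_uniformizer K
    have h0 : π ≠ 0 := by
      rintro rfl
      rw [map_zero] at hπ
      exact WithZero.coe_ne_zero hπ.symm
    refine ⟨π, h0, ?_⟩
    change NumberField.HeightOneSpectrum.adicAbv K v π ≠ 1
    rw [HeightOneSpectrum.adicAbv_def]
    intro h
    have h1 : WithZeroMulInt.toNNReal (HeightOneSpectrum.absNorm_ne_zero v)
      (v.valuation K π) = 1 := by exact_mod_cast h
    rw [WithZeroMulInt.toNNReal_eq_one_iff _ (HeightOneSpectrum.absNorm_ne_zero v)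
      (HeightOneSpectrum.one_lt_absNorm_nnreal v).ne', hπ] at h1
    rw [← exp_zero, exp_inj] at h1
    omega
  | .inr w => exact w.isNontrivial

/-- The element 2 separates the two kinds of places: its absolute value is at most 1 at a finite
place and equals 2 at an archimedean one. A finite place is recovered as the prime of integers of
absolute value below 1. -/
theorem Place.eq_of_abv_isEquiv {v w : Place K} (h : v.abv.IsEquiv w.abv) : v = w := by
  have key : ∀ (v : HeightOneSpectrum (𝓞 K)) (w : InfinitePlace K),
      ¬ (NumberField.HeightOneSpectrum.adicAbv K v).IsEquiv w.1 := by
    intro v w h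
    have h1 := (h 2 1).1 (by
      simpa using NumberField.HeightOneSpectrum.adicAbv_natCast_le_one K v 2)
    have h2 : w (2 : K) = 2 := by
      have := map_ofNat w.embedding 2
      rw [← w.norm_embedding_eq, this]
      simp
    have h3 : w.1 (2 : K) = 2 := h2
    rw [h3] at h1
    simp at h1
  match v, w, h with
  | .inl v, .inl w, h =>
    congr 1
    apply HeightOneSpectrum.ext
    ext x
    rw [← HeightOneSpectrum.adicAbv_coe_lt_one_iff (K := K) v
        (HeightOneSpectrum.one_lt_absNorm_nnreal v),
      ← HeightOneSpectrum.adicAbv_coe_lt_one_iff (K := K) w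
        (HeightOneSpectrum.one_lt_absNorm_nnreal w)]
    exact h.lt_one_iff
  | .inl v, .inr w, h => exact absurd h (key v w)
  | .inr w, .inl v, h => exact absurd h.symm (key v w)
  | .inr v, .inr w, h => rw [InfinitePlace.eq_iff_isEquiv.2 h]

/-- Neighbourhoods of an element of `K` for the `v`-adic topology. -/
noncomputable def Place.nhds (v : Place K) (x : K) : Filter K :=
  comap (algebraMap K v.Completion) (𝓝 (algebraMap K v.Completion x))

theorem Place.exists_ball_subset (v : Place K) (x : K) {A : Set K} (hA : A ∈ v.nhds x) :
    ∃ ε > 0, ∀ y, v.abv (y - x) < ε → y ∈ A := by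
  obtain ⟨U, hU, hUA⟩ := hA
  match v with
  | .inl v =>
    obtain ⟨ε, hε, hb⟩ := Metric.mem_nhds_iff.1 hU
    refine ⟨ε, hε, fun y hy => hUA (hb ?_)⟩
    rw [mem_ball_iff_norm]
    change ‖FinitePlace.embedding v y - FinitePlace.embedding v x‖ < ε
    rw [← map_sub, FinitePlace.norm_embedding]
    exact hy
  | .inr w =>
    obtain ⟨ε, hε, hb⟩ := Metric.mem_nhds_iff.1 hU
    refine ⟨ε, hε, fun y hy => hUA (hb ?_)⟩
    rw [mem_ball_iff_norm]
    change ‖algebraMap K w.Completion y - algebraMap K w.Completion x‖ < ε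
    rw [← map_sub]
    have := InfinitePlace.Completion.norm_coe w (WithAbs.toAbs w.1 (y - x))
    exact this.trans_lt hy

/-- Weak approximation: finitely many local conditions on an element of `K` can be satisfied
simultaneously. -/
theorem exists_mem_of_mem_nhds (T : Finset (Place K)) (x : Place K → K) (A : Place K → Set K)
    (hA : ∀ v ∈ T, A v ∈ v.nhds (x v)) : ∃ y, ∀ v ∈ T, y ∈ A v := by
  have h : ∀ v : T, ∃ ε > 0, ∀ y, v.1.abv (y - x v) < ε → y ∈ A v := fun v =>
    v.1.exists_ball_subset _ (hA v v.2)
  choose ε hε hb using h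
  have hd := AbsoluteValue.denseRange_algebraMap_pi (F := K) (v := fun v : T => v.1.abv)
    (fun v => v.1.abv_isNontrivial)
    (fun v w hvw h => hvw (Subtype.ext (Place.eq_of_abv_isEquiv h)))
  have ho : IsOpen (Set.univ.pi fun v : T =>
      Metric.ball (WithAbs.toAbs v.1.abv (x v)) (ε v)) :=
    isOpen_set_pi Set.finite_univ fun _ _ => Metric.isOpen_ball
  obtain ⟨y, hy⟩ := hd.exists_mem_open ho
    ⟨fun v => WithAbs.toAbs v.1.abv (x v), fun v _ => Metric.mem_ball_self (hε v)⟩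
  refine ⟨y, fun v hv => hb ⟨v, hv⟩ y ?_⟩
  have := hy ⟨v, hv⟩ trivial
  rw [mem_ball_iff_norm] at this
  exact this

/-- Neighbourhoods of a vector over `K` for the `v`-adic topology. -/
noncomputable def Place.nhdsVec (v : Place K) {N : ℕ} (x : Fin N → K) : Filter (Fin N → K) :=
  comap (fun z i => algebraMap K v.Completion (z i)) (𝓝 fun i => algebraMap K v.Completion (x i))

theorem Place.nhdsVec_eq_pi (v : Place K) {N : ℕ} (x : Fin N → K) :
    v.nhdsVec x = Filter.pi fun i => v.nhds (x i) := by
  simp only [nhdsVec, nhds, nhds_pi, Filter.pi, comap_iInf, comap_comap]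
  rfl

theorem exists_mem_of_mem_nhdsVec {N : ℕ} (T : Finset (Place K)) (x : Place K → Fin N → K)
    (A : Place K → Set (Fin N → K)) (hA : ∀ v ∈ T, A v ∈ v.nhdsVec (x v)) :
    ∃ y, ∀ v ∈ T, y ∈ A v := by
  have h : ∀ v : Place K, ∃ B : Fin N → Set K,
      v ∈ T → (∀ i, B i ∈ v.nhds (x v i)) ∧ Set.univ.pi B ⊆ A v := by
    intro v
    by_cases hv : v ∈ T
    · have := hA v hv
      rw [Place.nhdsVec_eq_pi, Filter.mem_pi] at this
      obtain ⟨I, hI, B, hB, hs⟩ := this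
      refine ⟨B, fun _ => ⟨hB, fun z hz => hs fun i _ => hz i trivial⟩⟩
    · exact ⟨fun _ => ∅, fun h => absurd h hv⟩
  choose B hB using h
  have h2 : ∀ i, ∃ y, ∀ v ∈ T, y ∈ B v i := fun i =>
    exists_mem_of_mem_nhds T (fun v => x v i) (fun v => B v i) fun v hv => (hB v hv).1 i
  choose y hy using h2
  exact ⟨y, fun v hv => (hB v hv).2 fun i _ => hy i v hv⟩

theorem Place.denseRange_algebraMap (v : Place K) : DenseRange (algebraMap K v.Completion) := by
  match v with
  | .inl v => exact v.denseRange_algebraMap K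
  | .inr w =>
    have h := (InfinitePlace.Completion.denseRange_coe w).comp
      (WithAbs.equiv w.1).symm.surjective.denseRange
      (InfinitePlace.Completion.continuous_coe w)
    exact h

theorem Place.denseRange_vec (v : Place K) (N : ℕ) :
    DenseRange fun (z : Fin N → K) i => algebraMap K v.Completion (z i) :=
  DenseRange.piMap fun _ => v.denseRange_algebraMap

end Approximation

/-! ### Contents of vectors and polynomials with respect to a valuation -/

section Content

variable {K : Type*} [Field K] (w : Valuation K ℤᵐ⁰) {ι : Type*} [Fintype ι] {σ : Type*}

/-- The maximal value of the coordinates of a vector. -/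
def supVal (z : ι → K) : ℤᵐ⁰ := Finset.univ.sup fun i => w (z i)

/-- The maximal value of the coefficients of a polynomial. -/
def content (F : MvPolynomial σ K) : ℤᵐ⁰ := F.support.sup fun d => w (F.coeff d)

theorem le_supVal (z : ι → K) (i : ι) : w (z i) ≤ supVal w z :=
  Finset.le_sup (f := fun i => w (z i)) (Finset.mem_univ i)

theorem supVal_le_iff {z : ι → K} {c : ℤᵐ⁰} : supVal w z ≤ c ↔ ∀ i, w (z i) ≤ c := by
  simp [supVal]

theorem exists_eq_supVal [Nonempty ι] (z : ι → K) : ∃ i, w (z i) = supVal w z := by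
  obtain ⟨i, -, hi⟩ := Finset.exists_mem_eq_sup Finset.univ Finset.univ_nonempty fun i => w (z i)
  exact ⟨i, hi.symm⟩

theorem supVal_eq_zero_iff {z : ι → K} : supVal w z = 0 ↔ z = 0 := by
  rw [← le_zero_iff, supVal_le_iff]
  simp [funext_iff]

theorem supVal_smul (c : K) (z : ι → K) : supVal w (c • z) = w c * supVal w z := by
  rcases isEmpty_or_nonempty ι with h | h
  · simp only [supVal, Finset.univ_eq_empty, Finset.sup_empty]
    simp
  · apply le_antisymm
    · rw [supVal_le_iff]
      intro i
      simpa using mul_le_mul_right (le_supVal w z i) (w c)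
    · obtain ⟨i, hi⟩ := exists_eq_supVal w z
      rw [← hi, ← map_mul]
      exact le_supVal w (c • z) i

theorem supVal_add_le (y z : ι → K) : supVal w (y + z) ≤ max (supVal w y) (supVal w z) := by
  rw [supVal_le_iff]
  exact fun i => (w.map_add _ _).trans (max_le_max (le_supVal w y i) (le_supVal w z i))

theorem le_content (F : MvPolynomial σ K) (d : σ →₀ ℕ) : w (F.coeff d) ≤ content w F := by
  by_cases hd : d ∈ F.support
  · exact Finset.le_sup (f := fun d => w (F.coeff d)) hd
  · rw [MvPolynomial.notMem_support_iff.1 hd, map_zero]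
    simp

theorem content_le_iff {F : MvPolynomial σ K} {c : ℤᵐ⁰} :
    content w F ≤ c ↔ ∀ d, w (F.coeff d) ≤ c := by
  refine ⟨fun h d => (le_content w F d).trans h, fun h => Finset.sup_le fun d _ => h d⟩

theorem exists_eq_content {F : MvPolynomial σ K} (hF : F ≠ 0) :
    ∃ d, F.coeff d ≠ 0 ∧ w (F.coeff d) = content w F := by
  obtain ⟨d, hd, h⟩ := Finset.exists_mem_eq_sup F.support
    (MvPolynomial.support_nonempty.2 hF) fun d => w (F.coeff d)
  exact ⟨d, MvPolynomial.mem_support_iff.1 hd, h.symm⟩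

theorem content_ne_zero {F : MvPolynomial σ K} (hF : F ≠ 0) : content w F ≠ 0 := by
  obtain ⟨d, hd, h⟩ := exists_eq_content w hF
  rw [← h]
  exact (w.ne_zero_iff).2 hd

theorem content_C_mul (c : K) (F : MvPolynomial σ K) :
    content w (MvPolynomial.C c * F) = w c * content w F := by
  by_cases hF : F = 0
  · subst hF
    simp [content]
  · apply le_antisymm
    · rw [content_le_iff]
      intro d
      rw [MvPolynomial.coeff_C_mul, map_mul]
      exact mul_le_mul_right (le_content w F d) _
    · obtain ⟨d, hd, h⟩ := exists_eq_content w hF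
      rw [← h, ← map_mul, ← MvPolynomial.coeff_C_mul]
      exact le_content w _ d

theorem exists_map_of_content_le_one {F : MvPolynomial σ K} (hF : content w F ≤ 1) :
    ∃ G : MvPolynomial σ w.valuationSubring,
      MvPolynomial.map (algebraMap w.valuationSubring K) G = F := by
  rw [← Set.mem_range, ← RingHom.coe_range, SetLike.mem_coe]
  refine MvPolynomial.mem_range_map_iff_coeffs_subset.2 ?_
  intro c hc
  obtain ⟨d, -, rfl⟩ := MvPolynomial.mem_coeffs_iff.1 hc
  exact ⟨⟨F.coeff d, (content_le_iff w).1 hF d⟩, rfl⟩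

/-- Reduces Gauss's lemma to the absence of zero divisors in a polynomial ring over the residue
field. -/
theorem content_eq_one_of_map {G : MvPolynomial σ w.valuationSubring} :
    content w (MvPolynomial.map (algebraMap w.valuationSubring K) G) = 1 ↔
      MvPolynomial.map (IsLocalRing.residue w.valuationSubring) G ≠ 0 := by
  have hle : content w (MvPolynomial.map (algebraMap w.valuationSubring K) G) ≤ 1 := by
    rw [content_le_iff]
    intro d
    rw [MvPolynomial.coeff_map]
    exact (G.coeff d).2
  have hlt : ∀ x : w.valuationSubring, IsLocalRing.residue w.valuationSubring x = 0 ↔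
      w (x : K) < 1 := by
    intro x
    rw [IsLocalRing.residue_eq_zero_iff, Valuation.mem_maximalIdeal_iff]
  constructor
  · intro h h0
    have hG : MvPolynomial.map (algebraMap w.valuationSubring K) G ≠ 0 := by
      intro h1
      rw [h1] at h
      simp [content] at h
    obtain ⟨d, -, hd⟩ := exists_eq_content w hG
    rw [h, MvPolynomial.coeff_map] at hd
    have := congrArg (MvPolynomial.coeff d) h0
    rw [MvPolynomial.coeff_map, MvPolynomial.coeff_zero, hlt] at this
    exact this.ne hd
  · intro h
    refine le_antisymm hle ?_
    by_contra hc
    apply h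
    ext d
    rw [MvPolynomial.coeff_map, MvPolynomial.coeff_zero, hlt]
    refine lt_of_le_of_lt ?_ (not_le.1 hc)
    have := le_content w (MvPolynomial.map (algebraMap w.valuationSubring K) G) d
    rwa [MvPolynomial.coeff_map] at this

/-- Gauss's lemma. -/
theorem content_mul (F G : MvPolynomial σ K) : content w (F * G) = content w F * content w G := by
  by_cases hF : F = 0
  · subst hF
    simp [content]
  by_cases hG : G = 0
  · subst hG
    simp [content]
  have key : ∀ F G : MvPolynomial σ K, content w F = 1 → content w G = 1 →
      content w (F * G) = 1 := by
    intro F G hF hG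
    obtain ⟨F, rfl⟩ := exists_map_of_content_le_one w hF.le
    obtain ⟨G, rfl⟩ := exists_map_of_content_le_one w hG.le
    rw [content_eq_one_of_map] at hF hG
    rw [← map_mul, content_eq_one_of_map, map_mul]
    exact mul_ne_zero hF hG
  have norm : ∀ F : MvPolynomial σ K, F ≠ 0 → ∃ c : K, c ≠ 0 ∧ w c = content w F ∧
      content w (MvPolynomial.C c⁻¹ * F) = 1 := by
    intro F hF
    obtain ⟨d, hd, h⟩ := exists_eq_content w hF
    refine ⟨_, hd, h, ?_⟩
    rw [content_C_mul, ← h, ← map_mul, inv_mul_cancel₀ hd, map_one]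
  obtain ⟨a, ha, haF, h1⟩ := norm F hF
  obtain ⟨b, hb, hbG, h2⟩ := norm G hG
  have h3 : F * G = MvPolynomial.C (a * b) *
      ((MvPolynomial.C a⁻¹ * F) * (MvPolynomial.C b⁻¹ * G)) := by
    have : F * G = MvPolynomial.C ((a * b) * (a⁻¹ * b⁻¹)) * (F * G) := by
      rw [show a * b * (a⁻¹ * b⁻¹) = 1 by field_simp, map_one, one_mul]
    rw [this]
    simp only [map_mul]
    ring
  rw [h3, content_C_mul, key _ _ h1 h2, mul_one, map_mul, haF, hbG]

theorem content_prod {κ : Type*} (s : Finset κ) (F : κ → MvPolynomial σ K) :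
    content w (∏ k ∈ s, F k) = ∏ k ∈ s, content w (F k) := by
  classical
  induction s using Finset.induction_on with
  | empty =>
    simp only [Finset.prod_empty]
    apply le_antisymm
    · rw [content_le_iff]
      intro d
      rw [MvPolynomial.coeff_one]
      split_ifs <;> simp
    · have := le_content w (1 : MvPolynomial σ K) 0
      simpa using this
  | insert a s ha ih => rw [Finset.prod_insert ha, Finset.prod_insert ha, content_mul, ih]

variable {L : Type*} [Field L] [Algebra K L] (wL : Valuation L ℤᵐ⁰)

theorem supVal_algebraMap (h : ∀ x, wL (algebraMap K L x) = w x) (z : ι → K) :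
    supVal wL (fun i => algebraMap K L (z i)) = supVal w z := by
  simp [supVal, h]

theorem map_aeval_le_of_supVal_le_one (h : ∀ x, wL (algebraMap K L x) = w x) (z : ι → L)
    (hz : supVal wL z ≤ 1) (F : MvPolynomial ι K) :
    wL (MvPolynomial.aeval z F) ≤ content w F := by
  rw [MvPolynomial.aeval_def, MvPolynomial.eval₂_eq]
  refine wL.map_sum_le fun d _ => ?_
  rw [map_mul, h, map_prod]
  refine (mul_le_mul_right (Finset.prod_le_one' fun i _ => ?_) _).trans
    ((mul_one _).le.trans (le_content w F d))
  rw [map_pow]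
  exact pow_le_one' ((le_supVal wL z i).trans hz) _

theorem map_aeval_le (h : ∀ x, wL (algebraMap K L x) = w x) (z : ι → L)
    {F : MvPolynomial ι K} {d : ℕ} (hF : F.IsHomogeneous d) :
    wL (MvPolynomial.aeval z F) ≤ content w F * supVal wL z ^ d := by
  rw [MvPolynomial.aeval_def, MvPolynomial.eval₂_eq]
  refine wL.map_sum_le fun e he => ?_
  rw [map_mul, h, map_prod]
  have hd : ∑ i ∈ e.support, e i = d := by
    have := hF (MvPolynomial.mem_support_iff.1 he)
    rw [← this, Finsupp.weight_apply, Finsupp.sum]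
    simp
  refine mul_le_mul' (le_content w F e) ?_
  rw [← hd, ← Finset.prod_pow_eq_pow_sum]
  refine Finset.prod_le_prod' fun i _ => ?_
  rw [map_pow]
  exact pow_le_pow_left' (le_supVal wL z i) _

end Content

/-! ### Intersection multiplicities in terms of valuations -/

section Multiplicity

variable {K : Type u} [Field K] [NumberField K]

theorem valued_algebraMap (v : HeightOneSpectrum (𝓞 K)) (x : K) :
    Valued.v (algebraMap K (v.adicCompletion K) x) = v.valuation K x :=
  HeightOneSpectrum.valuedAdicCompletion_eq_valuation' v x

theorem mem_maximalIdeal_pow_iff (v : HeightOneSpectrum (𝓞 K)) (k : ℕ)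
    (x : v.adicCompletionIntegers K) :
    x ∈ IsLocalRing.maximalIdeal (v.adicCompletionIntegers K) ^ k ↔
      Valued.v (x : v.adicCompletion K) ≤ exp (-(k : ℤ)) := by
  obtain ⟨π, hπ⟩ := v.valuation_exists_uniformizer K
  set p : v.adicCompletion K := algebraMap K _ π with hp
  have hpv : Valued.v p = exp (-1 : ℤ) := by rw [hp, valued_algebraMap, hπ]
  have hp0 : p ≠ 0 := by
    intro h
    rw [h, map_zero] at hpv
    exact exp_ne_zero hpv.symm
  have hpi : p ∈ v.adicCompletionIntegers K := by
    rw [HeightOneSpectrum.mem_adicCompletionIntegers, hpv, ← exp_zero, exp_le_exp]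
    omega
  have hdvd : ∀ (x : v.adicCompletionIntegers K) (k : ℕ),
      (⟨p, hpi⟩ : v.adicCompletionIntegers K) ^ k ∣ x ↔
        Valued.v (x : v.adicCompletion K) ≤ exp (-(k : ℤ)) := by
    intro x k
    have hk : Valued.v (p ^ k) = exp (-(k : ℤ)) := by
      rw [map_pow, hpv, ← exp_nsmul]
      simp
    constructor
    · rintro ⟨y, rfl⟩
      have : ((⟨p, hpi⟩ ^ k * y : v.adicCompletionIntegers K) : v.adicCompletion K) =
        p ^ k * (y : v.adicCompletion K) := rfl
      rw [this, map_mul, hk]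
      exact mul_le_of_le_one_right' y.2
    · intro hx
      have hy : (x : v.adicCompletion K) / p ^ k ∈ v.adicCompletionIntegers K := by
        rw [HeightOneSpectrum.mem_adicCompletionIntegers, map_div₀, hk]
        exact div_le_one_of_le₀ hx zero_le
      refine ⟨⟨_, hy⟩, Subtype.ext ?_⟩
      change (x : v.adicCompletion K) = p ^ k * (x / p ^ k)
      field_simp
  have hm : IsLocalRing.maximalIdeal (v.adicCompletionIntegers K) =
      Ideal.span {⟨p, hpi⟩} := by
    ext y
    rw [Ideal.mem_span_singleton, IsLocalRing.mem_maximalIdeal, mem_nonunits_iff,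
      HeightOneSpectrum.adicCompletionIntegers.isUnit_iff_valued_eq_one,
      ← pow_one (⟨p, hpi⟩ : v.adicCompletionIntegers K), hdvd]
    have hy : Valued.v (y : v.adicCompletion K) ≤ 1 := y.2
    constructor
    · intro h
      have h1 : Valued.v (y : v.adicCompletion K) < 1 := lt_of_le_of_ne hy h
      by_cases h0 : Valued.v (y : v.adicCompletion K) = 0
      · rw [h0]; exact zero_le
      · rw [← exp_log h0, ← exp_zero, exp_lt_exp] at h1
        rw [← exp_log h0, exp_le_exp]
        push_cast
        omega
    · intro h h1
      rw [h1, ← exp_zero, exp_le_exp] at h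
      simp at h
  rw [hm, Ideal.span_singleton_pow, Ideal.mem_span_singleton, hdvd]

/-- At a place `v` a form can be scaled to have content one at `v` and `𝓞`-integral
coefficients. -/
theorem exists_scaling (v : HeightOneSpectrum (𝓞 K)) {σ : Type*} {F : MvPolynomial σ K}
    (hF : F ≠ 0) : ∃ c : K, v.valuation K c * content (v.valuation K) F = 1 ∧
      ∃ G : MvPolynomial σ (𝓞 K),
        MvPolynomial.map (algebraMap (𝓞 K) K) G = MvPolynomial.C c * F := by
  obtain ⟨d₀, hd₀, h₀⟩ := exists_eq_content (v.valuation K) hF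
  set c₀ := (F.coeff d₀)⁻¹ with hc₀
  have h1 : ∀ d, v.valuation K (c₀ * F.coeff d) ≤ 1 := by
    intro d
    rw [map_mul, hc₀, map_inv₀, h₀, mul_comm]
    exact mul_inv_le_one_of_le₀ (le_content _ F d) zero_le
  -- Dividing by a largest coefficient makes the form integral at v only. The product of the
  -- remaining denominators, all prime to v, clears the other places without changing the content at
  -- v.
  choose n e he using fun d => v.exists_primeCompl_mul_eq_of_integer _ (h1 d)
  set t : v.asIdeal.primeCompl := ∏ d ∈ F.support, e d with ht
  have htv : v.valuation K (algebraMap (𝓞 K) K t) = 1 :=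
    (HeightOneSpectrum.valuation_eq_one_iff_notMem v).2 t.2
  refine ⟨c₀ * algebraMap (𝓞 K) K t, ?_, ?_⟩
  · rw [map_mul, htv, mul_one, hc₀, map_inv₀, h₀, inv_mul_cancel₀ (content_ne_zero _ hF)]
  · rw [← RingHom.mem_range]
    refine MvPolynomial.mem_range_map_iff_coeffs_subset.2 ?_
    intro a ha
    obtain ⟨d, hd, rfl⟩ := MvPolynomial.mem_coeffs_iff.1 ha
    rw [MvPolynomial.coeff_C_mul]
    have hdF : d ∈ F.support := by
      rw [MvPolynomial.mem_support_iff] at hd ⊢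
      rw [MvPolynomial.coeff_C_mul] at hd
      exact right_ne_zero_of_mul hd
    classical
    rw [ht, ← Finset.mul_prod_erase _ _ hdF]
    refine ⟨n d * (∏ x ∈ F.support.erase d, e x : v.asIdeal.primeCompl), ?_⟩
    rw [map_mul, ← he d, Submonoid.coe_mul, map_mul]
    ring

variable {N : ℕ}

theorem exists_primitive {v : HeightOneSpectrum (𝓞 K)} {z : Fin N → v.adicCompletion K}
    (hz : z ≠ 0) : ∃ (a : Fin N → v.adicCompletionIntegers K) (t : v.adicCompletion K),
      t ≠ 0 ∧ Valued.v t = supVal Valued.v z ∧ (∃ i, IsUnit (a i)) ∧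
      z = t • fun i => (a i : v.adicCompletion K) := by
  have : Nonempty (Fin N) := by
    by_contra h
    rw [not_nonempty_iff] at h
    exact hz (Subsingleton.elim _ _)
  obtain ⟨i, hi⟩ := exists_eq_supVal Valued.v z
  have h0 : z i ≠ 0 := by
    intro h
    rw [h, map_zero] at hi
    exact hz ((supVal_eq_zero_iff _).1 hi.symm)
  have hv0 : Valued.v (z i) ≠ 0 := (Valuation.ne_zero_iff _).2 h0
  refine ⟨fun j => ⟨z j / z i, ?_⟩, z i, h0, hi, ⟨i, ?_⟩, ?_⟩
  · rw [HeightOneSpectrum.mem_adicCompletionIntegers, map_div₀]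
    exact div_le_one_of_le₀ (hi ▸ le_supVal _ z j) zero_le
  · rw [HeightOneSpectrum.adicCompletionIntegers.isUnit_iff_valued_eq_one]
    simp [div_self h0]
  · ext j
    simp only [Pi.smul_apply, smul_eq_mul]
    field_simp

theorem supVal_eq_one_of_isUnit {v : HeightOneSpectrum (𝓞 K)}
    {a : Fin N → v.adicCompletionIntegers K} (ha : ∃ i, IsUnit (a i)) :
    supVal Valued.v (fun i => (a i : v.adicCompletion K)) = 1 := by
  obtain ⟨i, hi⟩ := ha
  apply le_antisymm
  · rw [supVal_le_iff]
    exact fun j => (a j).2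
  · rw [HeightOneSpectrum.adicCompletionIntegers.isUnit_iff_valued_eq_one] at hi
    rw [← hi]
    exact le_supVal Valued.v (fun i => (a i : v.adicCompletion K)) i

theorem aeval_smul_of_isHomogeneous {K L : Type*} [Field K] [Field L] [Algebra K L] {σ : Type*}
    {F : MvPolynomial σ K} {d : ℕ} (hF : F.IsHomogeneous d) (t : L) (z : σ → L) :
    MvPolynomial.aeval (t • z) F = t ^ d * MvPolynomial.aeval z F := by
  simp only [MvPolynomial.aeval_def, MvPolynomial.eval₂_eq, Finset.mul_sum]
  refine Finset.sum_congr rfl fun e he => ?_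
  have hd : ∑ i ∈ e.support, e i = d := by
    have := hF (MvPolynomial.mem_support_iff.1 he)
    rw [← this, Finsupp.weight_apply, Finsupp.sum]
    simp
  simp only [Pi.smul_apply, smul_eq_mul, mul_pow, Finset.prod_mul_distrib,
    Finset.prod_pow_eq_pow_sum, hd]
  ring

/-- In primitive coordinates, n_v ≥ k says that every element of the closure ideal takes a value in
the k-th power of the maximal ideal. One direction tests this on an integral multiple of F of
content one. Conversely an element of the closure ideal is F·H, and Gauss's lemma gives
content(F)·content(H) ≤ 1, so the value of F controls all others. -/
theorem natCast_le_intersectionMultiplicity_iff (S : Finset (Place K)) {F : MvPolynomial (Fin N) K}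
    {d : ℕ} (hd : F.IsHomogeneous d) (hF : F ≠ 0) {v : HeightOneSpectrum (𝓞 K)}
    (hv : (Sum.inl v : Place K) ∉ S) {z : Fin N → v.adicCompletion K} (hz : z ≠ 0) (k : ℕ) :
    (k : ℕ∞) ≤ intersectionMultiplicity S F v (Projectivization.mk _ z hz) ↔
      Valued.v (MvPolynomial.aeval z F) ≤
        exp (-(k : ℤ)) * content (v.valuation K) F * supVal Valued.v z ^ d := by
  rw [intersectionMultiplicity, ← pow_dvd_iff_le_emultiplicity, Ideal.dvd_iff_le,
    intersectionIdeal, Ideal.span_le]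
  have hval := valued_algebraMap v
  constructor
  · intro h
    obtain ⟨a, t, ht, htv, ha, rfl⟩ := exists_primitive hz
    have ha0 : (fun i => (a i : v.adicCompletion K)) ≠ 0 := by
      intro h0
      rw [h0, smul_zero] at hz
      exact hz rfl
    obtain ⟨c, hc, G, hG⟩ := exists_scaling v hF
    set g : MvPolynomial (Fin N) (SInteger S) := MvPolynomial.map (algebraMap (𝓞 K) _) G with hg
    have hgF : MvPolynomial.map (algebraMap (SInteger S) K) g = MvPolynomial.C c * F := by
      rw [hg, MvPolynomial.map_map, ← hG, ← IsScalarTower.algebraMap_eq]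
    have hgc : g ∈ closureIdeal S F := by
      rw [closureIdeal, Ideal.mem_comap, hgF, Ideal.mem_span_singleton]
      exact dvd_mul_left _ _
    have hcF : content (v.valuation K) (MvPolynomial.C c * F) = 1 := by rw [content_C_mul, hc]
    have hx : Valued.v (MvPolynomial.aeval (fun i => (a i : v.adicCompletion K))
        (MvPolynomial.C c * F)) ≤ 1 := by
      rw [← hcF]
      exact map_aeval_le_of_supVal_le_one _ _ hval _ (supVal_eq_one_of_isUnit ha).le _
    have := h (a := ⟨_, hx⟩) ⟨a, ha0, ha, ?_, g, hgc, ?_⟩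
    · rw [SetLike.mem_coe, mem_maximalIdeal_pow_iff] at this
      rw [aeval_smul_of_isHomogeneous hd, supVal_smul, supVal_eq_one_of_isUnit ha, mul_one,
        map_mul, map_pow, mul_comm]
      refine mul_le_mul' ?_ le_rfl
      replace this : Valued.v (MvPolynomial.aeval (fun i => (a i : v.adicCompletion K))
        (MvPolynomial.C c * F)) ≤ exp (-(k : ℤ)) := this
      rw [map_mul, MvPolynomial.aeval_C, map_mul, hval] at this
      calc _ = (v.valuation K c * Valued.v (MvPolynomial.aeval
              (fun i => (a i : v.adicCompletion K)) F)) * content (v.valuation K) F := by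
            rw [mul_right_comm, hc, one_mul]
        _ ≤ _ := mul_le_mul' this le_rfl
    · rw [Projectivization.mk_eq_mk_iff']
      exact ⟨t, rfl⟩
    · rw [hgF]
  · rintro h x ⟨a, ha0, ha, hP, g, hg, hx⟩
    rw [closureIdeal, Ideal.mem_comap, Ideal.mem_span_singleton] at hg
    obtain ⟨H, hH⟩ := hg
    rw [Projectivization.mk_eq_mk_iff'] at hP
    obtain ⟨t, rfl⟩ := hP
    have ht : t ≠ 0 := by
      rintro rfl
      exact hz (zero_smul _ _)
    have htv : Valued.v t ≠ 0 := (Valuation.ne_zero_iff _).2 ht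
    rw [aeval_smul_of_isHomogeneous hd, supVal_smul, supVal_eq_one_of_isUnit ha, mul_one,
        map_mul, map_pow, mul_comm, mul_le_mul_iff_left₀ (pow_pos (zero_lt_iff.2 htv) _)] at h
    rw [SetLike.mem_coe, mem_maximalIdeal_pow_iff, hx, hH, map_mul, map_mul]
    have h1 : content (v.valuation K) (MvPolynomial.map (algebraMap (SInteger S) K) g) ≤ 1 := by
      rw [content_le_iff]
      intro e
      rw [MvPolynomial.coeff_map]
      exact Set.integer_valuation_le_one _ _ _ hv
    rw [hH, content_mul] at h1
    have h2 := map_aeval_le_of_supVal_le_one _ _ hval _ (supVal_eq_one_of_isUnit ha).le H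
    calc _ ≤ (exp (-(k : ℤ)) * content (v.valuation K) F) * content (v.valuation K) H :=
          mul_le_mul' h h2
      _ ≤ _ := by
          rw [mul_assoc]
          exact mul_le_of_le_one_right' h1

end Multiplicity

/-! ### The topology of projective space -/

section ProjTopology

variable {L : Type u} [Field L] [TopologicalSpace L] {N : ℕ}

theorem eventually_mk_mem [T1Space L] {U : Set (ProjPoint L N)} (hU : IsOpen U)
    {z : Fin N → L} (hz : z ≠ 0) (hzU : Projectivization.mk L z hz ∈ U) :
    ∀ᶠ y in 𝓝 z, ∃ h : y ≠ 0, Projectivization.mk L y h ∈ U := by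
  have h1 : IsOpen (Projectivization.mk' L (V := Fin N → L) ⁻¹' U) := isOpen_coinduced.1 hU
  have h2 : IsOpen {y : Fin N → L | y ≠ 0} := isOpen_ne
  have h3 := h2.isOpenMap_subtype_val _ h1
  filter_upwards [h3.mem_nhds ⟨⟨z, hz⟩, hzU, rfl⟩]
  rintro y ⟨⟨y, h⟩, hy, rfl⟩
  exact ⟨h, hy⟩

/-- The projection to projective space is open: the preimage of the image of W is the union of the
rescalings of W by units. -/
theorem isOpen_setOf_exists_mk [ContinuousMul L] {W : Set (Fin N → L)} (hW : IsOpen W) :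
    IsOpen {P : ProjPoint L N | ∃ z ∈ W, ∃ h : z ≠ 0, P = Projectivization.mk L z h} := by
  refine isOpen_coinduced.2 ?_
  have h : (Projectivization.mk' L (V := Fin N → L) ⁻¹'
      {P : ProjPoint L N | ∃ z ∈ W, ∃ h : z ≠ 0, P = Projectivization.mk L z h}) =
      ⋃ t : Lˣ, (fun z : {z : Fin N → L // z ≠ 0} => t • (z : Fin N → L)) ⁻¹' W := by
    ext ⟨z, hz⟩
    simp only [Set.mem_preimage, Projectivization.mk'_eq_mk, Set.mem_iUnion]
    constructor
    · rintro ⟨y, hy, hy0, he⟩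
      obtain ⟨t, rfl⟩ := (Projectivization.mk_eq_mk_iff L _ _ _ _).1 he.symm
      exact ⟨t, hy⟩
    · rintro ⟨t, ht⟩
      refine ⟨_, ht, ?_, ?_⟩
      · rw [ne_eq, Units.smul_def, smul_eq_zero, not_or]
        exact ⟨t.ne_zero, hz⟩
      · exact ((Projectivization.mk_eq_mk_iff L _ _ _ _).2 ⟨t, rfl⟩).symm
  change IsOpen (Projectivization.mk' L (V := Fin N → L) ⁻¹' _)
  rw [h]
  refine isOpen_iUnion fun t => hW.preimage ?_
  refine continuous_pi fun i => ?_
  have : Continuous fun z : {z : Fin N → L // z ≠ 0} => (z : Fin N → L) i :=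
    (continuous_apply i).comp continuous_subtype_val
  exact continuous_const.mul this

end ProjTopology

/-! ### Openness of the Campana condition -/

section Openness

variable {K : Type u} [Field K] [NumberField K] {N : ℕ} {v : HeightOneSpectrum (𝓞 K)}

theorem eventually_valued_sub_lt (x : v.adicCompletion K) {γ : ℤᵐ⁰} (hγ : γ ≠ 0) :
    ∀ᶠ y in 𝓝 x, Valued.v (y - x) < γ := by
  obtain ⟨t, ht⟩ := HeightOneSpectrum.valuedAdicCompletion_surjective K v (γ * exp (-1 : ℤ))
  have ht0 : Valued.v t ≠ 0 := by
    rw [ht]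
    exact mul_ne_zero hγ exp_ne_zero
  have hlt : Valued.v t < γ := by
    rw [ht]
    refine mul_lt_of_lt_one_right (zero_lt_iff.2 hγ) ?_
    rw [← exp_zero, exp_lt_exp]
    omega
  have hc : Continuous fun y : v.adicCompletion K => t⁻¹ * (y - x) := by fun_prop
  have := (hc.tendsto x).eventually ((Valued.isOpen_integer (v.adicCompletion K)).mem_nhds (by
    simp))
  filter_upwards [this] with y hy
  have hy' : Valued.v (t⁻¹ * (y - x)) ≤ 1 := hy
  rw [map_mul, map_inv₀, inv_mul_le_iff₀ (zero_lt_iff.2 ht0), mul_one] at hy'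
  exact hy'.trans_lt hlt

theorem eventually_valued_le {x : v.adicCompletion K} {γ : ℤᵐ⁰} (hγ : γ ≠ 0)
    (hx : Valued.v x ≤ γ) : ∀ᶠ y in 𝓝 x, Valued.v y ≤ γ := by
  filter_upwards [eventually_valued_sub_lt x hγ] with y hy
  have := Valued.v.map_add (y - x) x
  rw [sub_add_cancel] at this
  exact this.trans (max_le hy.le hx)

theorem eventually_supVal_sub_lt (z : Fin N → v.adicCompletion K) {γ : ℤᵐ⁰} (hγ : γ ≠ 0) :
    ∀ᶠ y in 𝓝 z, supVal Valued.v (y - z) < γ := by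
  have : ∀ᶠ y in 𝓝 z, ∀ i, Valued.v (y i - z i) < γ := by
    rw [eventually_all]
    exact fun i => ((continuous_apply i).tendsto z).eventually (eventually_valued_sub_lt (z i) hγ)
  filter_upwards [this] with y hy
  rw [supVal, Finset.sup_lt_iff (bot_lt_iff_ne_bot.2 hγ)]
  exact fun i _ => hy i

theorem supVal_eq_of_sub_lt {K ι : Type*} [Field K] [Fintype ι] (w : Valuation K ℤᵐ⁰)
    {y z : ι → K} (h : supVal w (y - z) < supVal w z) : supVal w y = supVal w z := by
  have h1 := supVal_add_le w (y - z) z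
  rw [sub_add_cancel, max_eq_right h.le] at h1
  refine le_antisymm h1 (not_lt.1 fun h2 => ?_)
  have h3 := supVal_add_le w (-(y - z)) y
  have h4 : supVal w (z - y) = supVal w (y - z) := by simp [supVal, Valuation.map_sub_swap w]
  rw [neg_sub, sub_add_cancel, h4] at h3
  exact absurd (h3.trans_lt (max_lt h h2)) (lt_irrefl _)

theorem eventually_supVal_eq {z : Fin N → v.adicCompletion K} (hz : z ≠ 0) :
    ∀ᶠ y in 𝓝 z, supVal Valued.v y = supVal Valued.v z := by
  filter_upwards [eventually_supVal_sub_lt z fun h => hz ((supVal_eq_zero_iff _).1 h)] with y hy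
  exact supVal_eq_of_sub_lt _ hy

theorem continuous_aeval {K L σ : Type*} [Field K] [Field L] [Algebra K L] [TopologicalSpace L]
    [IsTopologicalRing L] (F : MvPolynomial σ K) :
    Continuous fun z : σ → L => MvPolynomial.aeval z F := by
  simp only [MvPolynomial.aeval_def, MvPolynomial.eval₂_eq_eval_map]
  exact MvPolynomial.continuous_eval _

theorem campana_admissible_iff {m : ℕ} {k : ℕ∞} :
    Kind.campana.Admissible m k ↔ ¬ ((1 : ℕ) : ℕ∞) ≤ k ∨ (m : ℕ∞) ≤ k := by
  have h1 : ¬ ((1 : ℕ) : ℕ∞) ≤ k ↔ k = 0 := by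
    rw [Nat.cast_one, Order.one_le_iff_ne_zero, not_not]
  rw [h1, Kind.Admissible]
  constructor
  · rintro (h | h | h)
    · exact Or.inl h
    · exact Or.inr (h ▸ le_top)
    · exact Or.inr h
  · rintro (h | h)
    · exact Or.inl h
    · exact Or.inr (Or.inr h)

/-- The Campana condition of weight `m` along `Z(F)` at the point with homogeneous coordinates
`z`. -/
theorem campana_admissible_multiplicity_iff (S : Finset (Place K)) {F : MvPolynomial (Fin N) K}
    {d : ℕ} (hd : F.IsHomogeneous d) (hF : F ≠ 0) (hv : (Sum.inl v : Place K) ∉ S) (m : ℕ)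
    {z : Fin N → v.adicCompletion K} (hz : z ≠ 0) :
    Kind.campana.Admissible m (intersectionMultiplicity S F v (Projectivization.mk _ z hz)) ↔
      Valued.v (MvPolynomial.aeval z F) = content (v.valuation K) F * supVal Valued.v z ^ d ∨
      Valued.v (MvPolynomial.aeval z F) ≤
        exp (-(m : ℤ)) * (content (v.valuation K) F * supVal Valued.v z ^ d) := by
  rw [campana_admissible_iff, natCast_le_intersectionMultiplicity_iff S hd hF hv,
    natCast_le_intersectionMultiplicity_iff S hd hF hv, mul_assoc, mul_assoc]
  refine or_congr_left ?_
  have hle := map_aeval_le (v.valuation K) Valued.v (valued_algebraMap v) z hd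
  set c := content (v.valuation K) F * supVal Valued.v z ^ d with hc
  have hc0 : c ≠ 0 := mul_ne_zero (content_ne_zero _ hF)
    (pow_ne_zero _ fun h => hz ((supVal_eq_zero_iff _).1 h))
  rw [← hle.ge_iff_eq, not_le, Nat.cast_one]
  generalize Valued.v (MvPolynomial.aeval z F) = x at hle ⊢
  by_cases hx : x = 0
  · subst hx
    simp [hc0]
  rw [← exp_log hx, ← exp_log hc0, ← exp_add, exp_lt_exp, exp_le_exp]
  omega

theorem form_ne_zero {K : Type u} [Field K] {N : ℕ} (D : OrbifoldDivisor K N) (α) :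
    D.form α ≠ 0 := (D.squarefree α).ne_zero

/-- The sup-norm of the coordinates is locally constant, and both forms of the condition persist
nearby: a nonzero value has locally constant absolute value, and an upper bound by a nonzero
constant is an open condition. The second case includes the points on the divisor. -/
theorem eventually_mem_localPoints (S : Finset (Place K)) (D : OrbifoldDivisor K N)
    (hv : (Sum.inl v : Place K) ∉ S) {z : Fin N → v.adicCompletion K} (hz : z ≠ 0)
    (h : Projectivization.mk _ z hz ∈ localPoints S D .campana v) :
    ∀ᶠ y in 𝓝 z, ∀ hy : y ≠ 0, Projectivization.mk _ y hy ∈ localPoints S D .campana v := by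
  have key : ∀ᶠ y in 𝓝 z, ∀ α, ∀ hy : y ≠ 0, Kind.campana.Admissible (D.weight α)
      (intersectionMultiplicity S (D.form α) v (Projectivization.mk _ y hy)) := by
    rw [eventually_all]
    intro α
    have hF := form_ne_zero D α
    have hd := D.isHomogeneous α
    have hz0 : supVal Valued.v z ≠ 0 := fun h => hz ((supVal_eq_zero_iff _).1 h)
    have hcont : Tendsto (fun y : Fin N → v.adicCompletion K => MvPolynomial.aeval y (D.form α))
      (𝓝 z) _ := (continuous_aeval (D.form α)).tendsto z
    have hα := (campana_admissible_multiplicity_iff S hd hF hv _ hz).1 (h α)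
    have hc0 : content (v.valuation K) (D.form α) * supVal Valued.v z ^ D.degree α ≠ 0 :=
      mul_ne_zero (content_ne_zero _ hF) (pow_ne_zero _ hz0)
    rcases hα with hα | hα
    · filter_upwards [eventually_supVal_eq hz, hcont.eventually
        (Valued.locally_const (hα ▸ hc0))] with y hy1 hy2 hy
      rw [campana_admissible_multiplicity_iff S hd hF hv, hy1]
      exact Or.inl (Eq.trans hy2 hα)
    · filter_upwards [eventually_supVal_eq hz, hcont.eventually
        (eventually_valued_le (mul_ne_zero exp_ne_zero hc0) hα)] with y hy1 hy2 hy
      rw [campana_admissible_multiplicity_iff S hd hF hv, hy1]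
      exact Or.inr hy2
  filter_upwards [key] with y hy h0 α
  exact hy α h0

end Openness

/-! ### The sup-norm on a quadratic algebra -/

section Quadratic

variable {K : Type*} [Field K] (w : Valuation K ℤᵐ⁰) {a b : K}

/-- The maximal value of the two coordinates of an element of a quadratic algebra. -/
def quadVal (z : QuadraticAlgebra K a b) : ℤᵐ⁰ := max (w z.re) (w z.im)

theorem map_re_le_quadVal (z : QuadraticAlgebra K a b) : w z.re ≤ quadVal w z := le_max_left _ _

theorem map_im_le_quadVal (z : QuadraticAlgebra K a b) : w z.im ≤ quadVal w z := le_max_right _ _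

theorem quadVal_eq_zero_iff {z : QuadraticAlgebra K a b} : quadVal w z = 0 ↔ z = 0 := by
  rw [quadVal, ← le_zero_iff, max_le_iff, le_zero_iff, le_zero_iff, map_eq_zero, map_eq_zero,
    QuadraticAlgebra.ext_iff]
  rfl

theorem quadVal_smul (c : K) (z : QuadraticAlgebra K a b) :
    quadVal w (c • z) = w c * quadVal w z := by
  simp [quadVal, mul_max]

theorem quadVal_one : quadVal w (1 : QuadraticAlgebra K a b) = 1 := by
  simp [quadVal, QuadraticAlgebra.re_one, QuadraticAlgebra.im_one]

theorem valuation_two_le_one : w 2 ≤ 1 := by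
  rw [← one_add_one_eq_two]
  simpa using w.map_add 1 1

theorem quadVal_mul_le (ha : w a ≤ 1) (hb : w b ≤ 1) (y z : QuadraticAlgebra K a b) :
    quadVal w (y * z) ≤ quadVal w y * quadVal w z := by
  have h1 := map_re_le_quadVal w y
  have h2 := map_im_le_quadVal w y
  have h3 := map_re_le_quadVal w z
  have h4 := map_im_le_quadVal w z
  apply max_le
  · rw [QuadraticAlgebra.re_mul]
    refine (w.map_add _ _).trans (max_le ?_ ?_)
    · rw [map_mul]; exact mul_le_mul' h1 h3
    · rw [map_mul, map_mul]
      exact mul_le_mul' ((mul_le_of_le_one_left' ha).trans h2) h4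
  · rw [QuadraticAlgebra.im_mul]
    refine (w.map_add _ _).trans (max_le ((w.map_add _ _).trans (max_le ?_ ?_)) ?_)
    · rw [map_mul]; exact mul_le_mul' h1 h4
    · rw [map_mul]; exact mul_le_mul' h2 h3
    · rw [map_mul, map_mul]
      exact mul_le_mul' ((mul_le_of_le_one_left' hb).trans h2) h4

theorem map_norm_le (ha : w a ≤ 1) (hb : w b ≤ 1) (z : QuadraticAlgebra K a b) :
    w z.norm ≤ quadVal w z ^ 2 := by
  have h1 := map_re_le_quadVal w z
  have h2 := map_im_le_quadVal w z
  rw [QuadraticAlgebra.norm_def, sq]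
  refine (w.map_sub _ _).trans (max_le ((w.map_add _ _).trans (max_le ?_ ?_)) ?_)
  · rw [map_mul]; exact mul_le_mul' h1 h1
  · rw [map_mul, map_mul]
    exact mul_le_mul' ((mul_le_of_le_one_left' hb).trans h1) h2
  · rw [map_mul, map_mul]
    exact mul_le_mul' ((mul_le_of_le_one_left' ha).trans h2) h2

theorem quadVal_star_le (hb : w b ≤ 1) (z : QuadraticAlgebra K a b) :
    quadVal w (star z) ≤ quadVal w z := by
  apply max_le
  · rw [QuadraticAlgebra.re_star]
    refine (w.map_add _ _).trans (max_le (map_re_le_quadVal w z) ?_)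
    rw [map_mul]
    exact (mul_le_of_le_one_left' hb).trans (map_im_le_quadVal w z)
  · rw [QuadraticAlgebra.im_star, Valuation.map_neg]
    exact map_im_le_quadVal w z

/-- Multiplication by an integral u does not increase the norm, and multiplication by its conjugate
undoes it up to the unit N(u). -/
theorem quadVal_mul_of_norm_eq_one (ha : w a ≤ 1) (hb : w b ≤ 1) {u : QuadraticAlgebra K a b}
    (hu : quadVal w u ≤ 1) (hn : w u.norm = 1) (z : QuadraticAlgebra K a b) :
    quadVal w (u * z) = quadVal w z := by
  apply le_antisymm ((quadVal_mul_le w ha hb u z).trans (mul_le_of_le_one_left' hu))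
  have h : star u * (u * z) = u.norm • z := by
    rw [Algebra.smul_def, QuadraticAlgebra.algebraMap_norm_eq_mul_star]
    ring
  have h1 := quadVal_mul_le w ha hb (star u) (u * z)
  rw [h, quadVal_smul, hn, one_mul] at h1
  exact h1.trans (mul_le_of_le_one_left' ((quadVal_star_le w hb u).trans hu))

theorem quadVal_pow_le (ha : w a ≤ 1) (hb : w b ≤ 1) (z : QuadraticAlgebra K a b) (k : ℕ) :
    quadVal w (z ^ k) ≤ quadVal w z ^ k := by
  induction k with
  | zero => simp [quadVal_one]
  | succ k ih =>
    rw [pow_succ, pow_succ]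
    exact (quadVal_mul_le w ha hb _ _).trans (mul_le_mul' ih le_rfl)

/-- If the second coordinate is not a unit, the first one is, and the norm is a unit, contrary to
assumption. Otherwise tr(z)² = 4N(z) + disc·im(z)² is a unit. -/
theorem map_trace_eq_one (ha : w a ≤ 1) (hb : w b ≤ 1) (hdisc : w (b ^ 2 + 4 * a) = 1)
    {z : QuadraticAlgebra K a b} (hz : quadVal w z = 1) (hn : w z.norm < 1) :
    w z.trace = 1 := by
  have hre : w z.re ≤ 1 := hz ▸ map_re_le_quadVal w z
  have him : w z.im ≤ 1 := hz ▸ map_im_le_quadVal w z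
  have h : w (z.trace ^ 2) = 1 := by
    rcases him.lt_or_eq with h | h
    · have h1 : w z.re = 1 := by
        rw [quadVal] at hz
        rcases max_choice (w z.re) (w z.im) with h' | h' <;> rw [h'] at hz
        · exact hz
        · exact absurd hz h.ne
      exfalso
      have h2 : z.norm = z.re * z.re + (b * z.re - a * z.im) * z.im := by
        rw [QuadraticAlgebra.norm_def]; ring
      have h3 : w ((b * z.re - a * z.im) * z.im) < 1 := by
        rw [map_mul]
        refine mul_lt_one_of_nonneg_of_lt_one_right ?_ zero_le h
        refine (w.map_sub _ _).trans (max_le ?_ ?_)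
        · rw [map_mul]; exact mul_le_one' hb hre
        · rw [map_mul]; exact mul_le_one' ha him
      rw [h2, w.map_add_eq_of_lt_left, map_mul, h1, one_mul] at hn
      · exact lt_irrefl _ hn
      · rw [w.map_mul z.re, h1, one_mul]
        exact h3
    · have h2 : z.trace ^ 2 = 4 * z.norm + (b ^ 2 + 4 * a) * z.im ^ 2 := by
        rw [QuadraticAlgebra.norm_def, QuadraticAlgebra.trace_def]; ring
      have h4 : w 4 ≤ 1 := by
        rw [show (4 : K) = 2 * 2 by norm_num, map_mul]
        exact mul_le_one' (valuation_two_le_one w) (valuation_two_le_one w)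
      rw [h2, w.map_add_eq_of_lt_right, map_mul, hdisc, map_pow, h, one_pow, one_mul]
      rw [map_mul, map_mul, hdisc, map_pow, h, one_pow, one_mul]
      exact mul_lt_one_of_nonneg_of_lt_one_right h4 zero_le hn
  rw [map_pow] at h
  exact (pow_eq_one_iff_of_nonneg zero_le two_ne_zero).1 h

/-- When the discriminant is a unit the sup-norm is power-multiplicative. -/
theorem quadVal_pow (ha : w a ≤ 1) (hb : w b ≤ 1) (hdisc : w (b ^ 2 + 4 * a) = 1)
    (z : QuadraticAlgebra K a b) (k : ℕ) : quadVal w (z ^ k) = quadVal w z ^ k := by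
  have key : ∀ z : QuadraticAlgebra K a b, quadVal w z = 1 → quadVal w (z ^ k) = 1 := by
    intro z hz
    have hle : ∀ k, quadVal w (z ^ k) ≤ 1 := fun k =>
      (quadVal_pow_le w ha hb z k).trans (by rw [hz, one_pow])
    have hn : w z.norm ≤ 1 := (map_norm_le w ha hb z).trans (by rw [hz, one_pow])
    rcases hn.lt_or_eq with hn | hn
    · have htr := map_trace_eq_one w ha hb hdisc hz hn
      induction k using Nat.twoStepInduction with
      | zero => simp [quadVal_one]
      | one => simpa using hz
      | more k _ ih =>
        -- The recursion given by the characteristic polynomial. With a unit trace and a nonunit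
        -- norm, z^(k+2) is congruent to tr(z)·z^(k+1), so primitivity propagates.
        have h1 : z.trace • z ^ (k + 1) = z ^ (k + 2) + z.norm • z ^ k := by
          have := QuadraticAlgebra.sq_eq_trace_smul_sub_norm z
          rw [pow_add z k 2, this, pow_succ, Algebra.smul_def, Algebra.smul_def, Algebra.smul_def]
          ring
        have h2 : quadVal w (z.trace • z ^ (k + 1)) = 1 := by
          rw [quadVal_smul, htr, ih, one_mul]
        refine le_antisymm (hle _) (not_lt.1 fun h3 => ?_)
        have h4 : quadVal w (z.norm • z ^ k) < 1 := by
          rw [quadVal_smul]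
          exact mul_lt_one_of_nonneg_of_lt_one_left zero_le hn (hle k)
        rw [quadVal, max_lt_iff] at h3 h4
        rw [h1] at h2
        have h5 : quadVal w (z ^ (k + 2) + z.norm • z ^ k) < 1 := by
          rw [quadVal, max_lt_iff]
          exact ⟨(w.map_add _ _).trans_lt (max_lt h3.1 h4.1),
            (w.map_add _ _).trans_lt (max_lt h3.2 h4.2)⟩
        exact h5.ne h2
    -- For a unit norm, 1 = |N(z^k)| ≤ |z^k|² already excludes |z^k| < 1.
    · refine le_antisymm (hle k) (not_lt.1 fun h => ?_)
      have h1 := map_norm_le w ha hb (z ^ k)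
      rw [map_pow, map_pow, hn, one_pow] at h1
      exact absurd (h1.trans_lt (pow_lt_one₀ zero_le h two_ne_zero)) (lt_irrefl _)
  by_cases hz : z = 0
  · subst hz
    rcases k with _ | k
    · simp [quadVal_one]
    · rw [zero_pow (Nat.succ_ne_zero k), (quadVal_eq_zero_iff w).2 rfl,
        zero_pow (Nat.succ_ne_zero k)]
  · have h0 : quadVal w z ≠ 0 := fun h => hz ((quadVal_eq_zero_iff w).1 h)
    obtain ⟨c, hc⟩ : ∃ c, w c = quadVal w z := by
      rcases max_choice (w z.re) (w z.im) with h | h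
      · exact ⟨_, h.symm⟩
      · exact ⟨_, h.symm⟩
    have hc0 : c ≠ 0 := by
      rintro rfl
      rw [map_zero] at hc
      exact h0 hc.symm
    have h1 : quadVal w (c⁻¹ • z) = 1 := by
      rw [quadVal_smul, map_inv₀, hc, inv_mul_cancel₀ h0]
    have h2 := key _ h1
    rw [smul_pow, quadVal_smul, map_pow, map_inv₀, hc, inv_pow] at h2
    exact (inv_mul_eq_one₀ (pow_ne_zero _ h0)).1 h2 |>.symm

/-- The point of the line through `x` and `y` with coordinates the two components of `z`. -/
def linePoint {ι : Type*} (x y : ι → K) (z : QuadraticAlgebra K a b) : ι → K :=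
  z.re • x + z.im • y

/-- A unit 2×2 minor says that x and y stay independent modulo the place; Cramer's rule then
recovers the two coordinates integrally from the point. -/
theorem supVal_linePoint {ι : Type*} [Fintype ι] {x y : ι → K} (hx : supVal w x ≤ 1)
    (hy : supVal w y ≤ 1) {i j : ι} (hij : w (x i * y j - x j * y i) = 1)
    (z : QuadraticAlgebra K a b) : supVal w (linePoint x y z) = quadVal w z := by
  apply le_antisymm
  · refine (supVal_add_le w _ _).trans (max_le_max ?_ ?_)
    · rw [supVal_smul]; exact mul_le_of_le_one_right' hx
    · rw [supVal_smul]; exact mul_le_of_le_one_right' hy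
  · have hb : ∀ (u : ι → K), supVal w u ≤ 1 → ∀ i j,
        w (linePoint x y z i * u j) ≤ supVal w (linePoint x y z) := by
      intro u hu i j
      rw [map_mul]
      exact (mul_le_of_le_one_right' ((le_supVal w u j).trans hu)).trans (le_supVal w _ i)
    apply max_le
    · have h : z.re * (x i * y j - x j * y i) =
          linePoint x y z i * y j - linePoint x y z j * y i := by
        simp only [linePoint, Pi.add_apply, Pi.smul_apply, smul_eq_mul]; ring
      rw [← mul_one (w z.re), ← hij, ← map_mul, h]
      exact (w.map_sub _ _).trans (max_le (hb y hy _ _) (hb y hy _ _))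
    · have h : z.im * (x i * y j - x j * y i) =
          linePoint x y z j * x i - linePoint x y z i * x j := by
        simp only [linePoint, Pi.add_apply, Pi.smul_apply, smul_eq_mul]; ring
      rw [← mul_one (w z.im), ← hij, ← map_mul, h]
      exact (w.map_sub _ _).trans (max_le (hb x hx _ _) (hb x hx _ _))

end Quadratic

/-! ### Linear and quadratic forms -/

section Forms

variable {K : Type*} [Field K] {σ : Type*} [Fintype σ]

open MvPolynomial in
theorem exists_eq_sum_of_isHomogeneous_one {F : MvPolynomial σ K} (hF : F.IsHomogeneous 1) :
    ∃ l : σ → K, F = ∑ i, C (l i) * X i := by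
  rw [← mem_homogeneousSubmodule, homogeneousSubmodule_one_eq_span_X,
    Submodule.mem_span_range_iff_exists_fun] at hF
  obtain ⟨l, rfl⟩ := hF
  exact ⟨l, by simp [smul_eq_C_mul]⟩

open MvPolynomial in
theorem exists_eq_sum_of_isHomogeneous_two {F : MvPolynomial σ K} (hF : F.IsHomogeneous 2) :
    ∃ M : σ → σ → K, F = ∑ i, ∑ j, C (M i j) * (X i * X j) := by
  rw [← mem_homogeneousSubmodule, ← homogeneousSubmodule_one_pow, sq] at hF
  induction hF using Submodule.mul_induction_on' with
  | mem_mul_mem p hp q hq =>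
    obtain ⟨l, rfl⟩ := exists_eq_sum_of_isHomogeneous_one hp
    obtain ⟨k, rfl⟩ := exists_eq_sum_of_isHomogeneous_one hq
    refine ⟨fun i j => l i * k j, ?_⟩
    rw [Finset.sum_mul_sum]
    refine Finset.sum_congr rfl fun i _ => Finset.sum_congr rfl fun j _ => ?_
    rw [C_mul]
    ring
  | add p _ q _ hp hq =>
    obtain ⟨M, rfl⟩ := hp
    obtain ⟨M', rfl⟩ := hq
    exact ⟨fun i j => M i j + M' i j, by simp [add_mul, Finset.sum_add_distrib]⟩

/-- The polarization of a form. -/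
noncomputable def polarForm (f : MvPolynomial σ K) (x y : σ → K) : K :=
  MvPolynomial.eval (x + y) f - MvPolynomial.eval x f - MvPolynomial.eval y f

/-- The discriminant of the restriction of a quadratic form to the line through two points. -/
noncomputable def lineDisc (f : MvPolynomial σ K) (x y : σ → K) : K :=
  polarForm f x y ^ 2 - 4 * MvPolynomial.eval x f * MvPolynomial.eval y f

theorem eval_sum_quadratic (M : σ → σ → K) (z : σ → K) :
    MvPolynomial.eval z (∑ i, ∑ j, MvPolynomial.C (M i j) * (MvPolynomial.X i * MvPolynomial.X j)) =
      ∑ i, ∑ j, M i j * (z i * z j) := by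
  simp

theorem polarForm_eq_sum (M : σ → σ → K) (x y : σ → K) :
    polarForm (∑ i, ∑ j, MvPolynomial.C (M i j) * (MvPolynomial.X i * MvPolynomial.X j)) x y =
      ∑ i, ∑ j, M i j * (x i * y j + y i * x j) := by
  simp only [polarForm, eval_sum_quadratic, ← Finset.sum_sub_distrib]
  refine Finset.sum_congr rfl fun i _ => Finset.sum_congr rfl fun j _ => ?_
  simp only [Pi.add_apply]
  ring

theorem eval_smul_add_smul {f : MvPolynomial σ K} (hf : f.IsHomogeneous 2) (x y : σ → K)
    (s t : K) : MvPolynomial.eval (s • x + t • y) f =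
      s ^ 2 * MvPolynomial.eval x f + s * t * polarForm f x y + t ^ 2 * MvPolynomial.eval y f := by
  obtain ⟨M, rfl⟩ := exists_eq_sum_of_isHomogeneous_two hf
  rw [polarForm_eq_sum]
  simp only [eval_sum_quadratic, Finset.mul_sum, ← Finset.sum_add_distrib]
  refine Finset.sum_congr rfl fun i _ => Finset.sum_congr rfl fun j _ => ?_
  simp only [Pi.add_apply, Pi.smul_apply, smul_eq_mul]
  ring

theorem eval_smul_add_smul_of_isHomogeneous_one {f : MvPolynomial σ K} (hf : f.IsHomogeneous 1)
    (x y : σ → K) (s t : K) : MvPolynomial.eval (s • x + t • y) f =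
      s * MvPolynomial.eval x f + t * MvPolynomial.eval y f := by
  obtain ⟨l, rfl⟩ := exists_eq_sum_of_isHomogeneous_one hf
  simp only [map_sum, map_mul, MvPolynomial.eval_C, MvPolynomial.eval_X, Finset.mul_sum,
    ← Finset.sum_add_distrib]
  refine Finset.sum_congr rfl fun i _ => ?_
  simp only [Pi.add_apply, Pi.smul_apply, smul_eq_mul]
  ring

theorem not_isUnit_of_isHomogeneous {K σ : Type*} [Field K] {f : MvPolynomial σ K} {d : ℕ}
    (hf : f.IsHomogeneous d)
    (hd : d ≠ 0) : ¬ IsUnit f := by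
  intro h
  have := (MvPolynomial.isUnit_iff_totalDegree_of_isReduced.1 h).2
  rw [hf.totalDegree h.ne_zero] at this
  exact hd this

open MvPolynomial in
/-- A square-free quadratic form restricts to a binary form without repeated factors on the line
through a given point off the quadric and a general second point. -/
theorem exists_eval_ne_zero_lineDisc_ne_zero [CharZero K] {f : MvPolynomial σ K}
    (hf : f.IsHomogeneous 2) (hsq : Squarefree f) {x : σ → K} (hx : eval x f ≠ 0) :
    ∃ y, eval y f ≠ 0 ∧ lineDisc f x y ≠ 0 := by
  obtain ⟨M, hM⟩ := exists_eq_sum_of_isHomogeneous_two hf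
  set l : MvPolynomial σ K := ∑ i, ∑ j, C (M i j) * (C (x i) * X j + X i * C (x j)) with hl
  have hly : ∀ y, eval y l = polarForm f x y := by
    intro y
    rw [hM, polarForm_eq_sum, hl]
    simp
  -- This polynomial is the discriminant as a function of the second point. If it vanished, f would
  -- be a constant times l².
  have hD : l ^ 2 - C (4 * eval x f) * f ≠ 0 := by
    intro h
    rw [sub_eq_zero] at h
    have h4 : 4 * eval x f ≠ 0 := mul_ne_zero (by norm_num) hx
    have h1 : f = C (4 * eval x f)⁻¹ * l ^ 2 := by
      rw [h, ← mul_assoc, ← C_mul, inv_mul_cancel₀ h4, C_1, one_mul]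
    have h2 : IsUnit l := hsq l ⟨C (4 * eval x f)⁻¹, h1.trans (by ring)⟩
    refine not_isUnit_of_isHomogeneous hf two_ne_zero (h1 ▸ ?_)
    exact ((inv_ne_zero h4).isUnit.map C).mul (h2.pow 2)
  have hne : f * (l ^ 2 - C (4 * eval x f) * f) ≠ 0 := mul_ne_zero hsq.ne_zero hD
  obtain ⟨y, hy⟩ : ∃ y, eval y (f * (l ^ 2 - C (4 * eval x f) * f)) ≠ 0 := by
    by_contra! h
    exact hne (MvPolynomial.funext fun y => by rw [h y, map_zero])
  rw [map_mul] at hy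
  refine ⟨y, left_ne_zero_of_mul hy, ?_⟩
  have := right_ne_zero_of_mul hy
  rwa [map_sub, map_pow, map_mul, eval_C, hly] at this

/-- Minus the norm of the generator of the quadratic algebra attached to the restriction of a
quadratic form to the line through two points. -/
noncomputable def lineA (f : MvPolynomial σ K) (x y : σ → K) : K :=
  -(MvPolynomial.eval y f / MvPolynomial.eval x f)

/-- The trace of the generator of the quadratic algebra attached to the restriction of a quadratic
form to the line through two points. -/
noncomputable def lineB (f : MvPolynomial σ K) (x y : σ → K) : K :=
  polarForm f x y / MvPolynomial.eval x f

theorem lineB_sq_add {K σ : Type*} [Field K] {f : MvPolynomial σ K} {x : σ → K}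
    (hx : MvPolynomial.eval x f ≠ 0) (y : σ → K) :
    lineB f x y ^ 2 + 4 * lineA f x y = lineDisc f x y / MvPolynomial.eval x f ^ 2 := by
  rw [lineA, lineB, lineDisc]
  field_simp
  ring

theorem eval_linePoint {f : MvPolynomial σ K} (hf : f.IsHomogeneous 2) {x : σ → K}
    (hx : MvPolynomial.eval x f ≠ 0) (y : σ → K)
    (z : QuadraticAlgebra K (lineA f x y) (lineB f x y)) :
    MvPolynomial.eval (linePoint x y z) f = MvPolynomial.eval x f * z.norm := by
  have hA : lineA f x y * MvPolynomial.eval x f = -MvPolynomial.eval y f := by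
    rw [lineA]
    field_simp
  have hB : lineB f x y * MvPolynomial.eval x f = polarForm f x y := by
    rw [lineB]
    field_simp
  rw [linePoint, eval_smul_add_smul hf, QuadraticAlgebra.norm_def]
  linear_combination z.im ^ 2 * hA - z.re * z.im * hB

/-- The restriction of a factor of `f` to the line through `x` and `y` is multiplicative. -/
theorem exists_monoidHom_eval_linePoint {f F : MvPolynomial σ K} (hf : f.IsHomogeneous 2)
    {x : σ → K} (hx : MvPolynomial.eval x f ≠ 0) (y : σ → K) (hdvd : F ∣ f)
    (hF : F = f ∨ F.IsHomogeneous 1) :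
    ∃ χ : QuadraticAlgebra K (lineA f x y) (lineB f x y) →* K, ∀ z,
      MvPolynomial.eval (linePoint x y z) F = MvPolynomial.eval x F * χ z := by
  rcases hF with rfl | hF
  · exact ⟨QuadraticAlgebra.norm, eval_linePoint hf hx y⟩
  · have hFx : MvPolynomial.eval x F ≠ 0 := by
      obtain ⟨G, rfl⟩ := hdvd
      rw [map_mul] at hx
      exact left_ne_zero_of_mul hx
    -- The linear factor vanishes at −lam + ω, hence so does the norm; thus lam is a root of X² = a
    -- + bX and ω ↦ lam defines the required character.
    set lam := MvPolynomial.eval y F / MvPolynomial.eval x F with hlam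
    have h1 : MvPolynomial.eval (linePoint x y
        (⟨-lam, 1⟩ : QuadraticAlgebra K (lineA f x y) (lineB f x y))) F = 0 := by
      rw [linePoint, eval_smul_add_smul_of_isHomogeneous_one hF, hlam]
      field_simp
      ring
    have h2 : MvPolynomial.eval (linePoint x y
        (⟨-lam, 1⟩ : QuadraticAlgebra K (lineA f x y) (lineB f x y))) f = 0 := by
      obtain ⟨G, rfl⟩ := hdvd
      rw [map_mul, h1, zero_mul]
    rw [eval_linePoint hf hx, mul_eq_zero, or_iff_right hx, QuadraticAlgebra.norm_def] at h2
    have h3 : lam ^ 2 = lineA f x y + lineB f x y * lam := by linear_combination h2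
    refine ⟨⟨⟨fun z => z.re + lam * z.im, ?_⟩, ?_⟩, ?_⟩
    · simp [QuadraticAlgebra.re_one, QuadraticAlgebra.im_one]
    · intro z w
      simp only [QuadraticAlgebra.re_mul, QuadraticAlgebra.im_mul]
      linear_combination (-(z.im * w.im)) * h3
    · intro z
      rw [linePoint, eval_smul_add_smul_of_isHomogeneous_one hF]
      simp only [MonoidHom.coe_mk, OneHom.coe_mk, hlam]
      field_simp

end Forms

/-! ### The components of a quadric -/

section Components

variable {K : Type u} [Field K] {N m : ℕ} {f : MvPolynomial (Fin N) K} {D : OrbifoldDivisor K N}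

theorem form_dvd (hD : D.IsHypersurface m f) (α) : D.form α ∣ f :=
  hD.1 ▸ Finset.dvd_prod_of_mem _ (Finset.mem_univ α)

/-- The positive degrees of the components add up to 2, so a component that is not linear has degree
2 and is the only one. -/
theorem form_eq_or_isHomogeneous_one (hf : f.IsHomogeneous 2) (hsq : Squarefree f)
    (hD : D.IsHypersurface m f) (α) : D.form α = f ∨ (D.form α).IsHomogeneous 1 := by
  have h1 : f.IsHomogeneous (∑ α, D.degree α) := by
    rw [← hD.1]
    exact MvPolynomial.IsHomogeneous.prod _ _ _ fun α _ => D.isHomogeneous α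
  have h2 := h1.inj_right hf hsq.ne_zero
  classical
  rw [← Finset.add_sum_erase _ _ (Finset.mem_univ α)] at h2
  have h3 := D.degree_pos α
  by_cases h4 : D.degree α = 1
  · exact Or.inr (h4 ▸ D.isHomogeneous α)
  · left
    have h5 : ∑ β ∈ Finset.univ.erase α, D.degree β = 0 := by omega
    have h6 : Finset.univ.erase α = ∅ := by
      by_contra h
      obtain ⟨β, hβ⟩ := Finset.nonempty_iff_ne_empty.2 h
      exact (D.degree_pos β).ne' (Finset.sum_eq_zero_iff.1 h5 β hβ)
    rw [← hD.1, ← Finset.mul_prod_erase _ _ (Finset.mem_univ α), h6, Finset.prod_empty, mul_one]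

theorem eval_form_ne_zero (hD : D.IsHypersurface m f) {x : Fin N → K}
    (hx : MvPolynomial.eval x f ≠ 0) (α) : MvPolynomial.eval x (D.form α) ≠ 0 := by
  obtain ⟨G, hG⟩ := form_dvd hD α
  rw [hG, map_mul] at hx
  exact left_ne_zero_of_mul hx

theorem eval_eq_prod (hD : D.IsHypersurface m f) (x : Fin N → K) :
    MvPolynomial.eval x f = ∏ α, MvPolynomial.eval x (D.form α) := by
  rw [← hD.1, map_prod]

theorem eq_one_of_prod_eq_one {ι : Type*} [Fintype ι] {g : ι → ℤᵐ⁰} (hg : ∀ i, g i ≤ 1)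
    (h : ∏ i, g i = 1) (i : ι) : g i = 1 := by
  classical
  refine le_antisymm (hg i) ?_
  rw [← h, ← Finset.mul_prod_erase _ _ (Finset.mem_univ i)]
  exact mul_le_of_le_one_right' (Finset.prod_le_one' fun j _ => hg j)

/-- On the line through `x` and `y` and at a place of good reduction the point with coordinate
`u ^ k * z ^ l`, with `u` a unit and `l ≥ m`, satisfies the Campana condition. -/
theorem campana_linePoint (w : Valuation K ℤᵐ⁰) (hf : f.IsHomogeneous 2) (hsq : Squarefree f)
    (hD : D.IsHypersurface m f) (hcont : ∀ α, content w (D.form α) = 1)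
    {x y : Fin N → K} (hfx : MvPolynomial.eval x f ≠ 0)
    (hx1 : ∀ α, w (MvPolynomial.eval x (D.form α)) = 1)
    (hx : supVal w x ≤ 1) (hy : supVal w y ≤ 1) {i j : Fin N} (hij : w (x i * y j - x j * y i) = 1)
    (ha : w (lineA f x y) ≤ 1) (hb : w (lineB f x y) ≤ 1)
    (hdisc : w (lineB f x y ^ 2 + 4 * lineA f x y) = 1)
    {u z : QuadraticAlgebra K (lineA f x y) (lineB f x y)} (hu : quadVal w u ≤ 1)
    (hun : w u.norm = 1) (hz : z ≠ 0) {k l : ℕ} (hl : m ≤ l) (α) :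
    w (MvPolynomial.eval (linePoint x y (u ^ k * z ^ l)) (D.form α)) =
        supVal w (linePoint x y (u ^ k * z ^ l)) ^ D.degree α ∨
      w (MvPolynomial.eval (linePoint x y (u ^ k * z ^ l)) (D.form α)) ≤
        exp (-(m : ℤ)) * supVal w (linePoint x y (u ^ k * z ^ l)) ^ D.degree α := by
  choose χ hχ using fun α => exists_monoidHom_eval_linePoint hf hfx y (form_dvd hD α)
    (form_eq_or_isHomogeneous_one hf hsq hD α)
  have hle : ∀ α t, w (χ α t) ≤ quadVal w t ^ D.degree α := by
    intro α t
    have h1 := map_aeval_le w w (fun _ => rfl) (linePoint x y t) (D.isHomogeneous α)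
    rw [supVal_linePoint w hx hy hij, hcont, one_mul] at h1
    rw [MvPolynomial.aeval_eq_eval] at h1
    change w (MvPolynomial.eval _ _) ≤ _ at h1
    rwa [hχ, map_mul, hx1, one_mul] at h1
  -- The values χ_α(u) are integral and their product is the norm of u, a unit; hence each is a
  -- unit.
  have hχu : ∀ α, w (χ α u) = 1 := by
    refine eq_one_of_prod_eq_one (fun α => (hle α u).trans (pow_le_one' hu _)) ?_
    rw [← map_prod, ← hun]
    congr 1
    have h1 := eval_linePoint hf hfx y u
    rw [eval_eq_prod hD, eval_eq_prod hD] at h1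
    simp only [hχ, Finset.prod_mul_distrib] at h1
    refine mul_left_cancel₀ ?_ h1
    rwa [← eval_eq_prod hD]
  have hunk : w (u ^ k).norm = 1 := by rw [map_pow, map_pow, hun, one_pow]
  rw [supVal_linePoint w hx hy hij, quadVal_mul_of_norm_eq_one w ha hb
    ((quadVal_pow_le w ha hb u k).trans (pow_le_one' hu _)) hunk, quadVal_pow w ha hb hdisc,
    hχ, map_mul, hx1, one_mul, map_mul, map_pow, map_pow, map_mul, map_pow, hχu, one_pow, one_mul,
    map_pow, ← pow_mul, mul_comm l, pow_mul]
  have hz0 : quadVal w z ^ D.degree α ≠ 0 :=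
    pow_ne_zero _ fun h => hz ((quadVal_eq_zero_iff w).1 h)
  have h1 := hle α z
  generalize quadVal w z ^ D.degree α = q at *
  generalize w (χ α z) = p at *
  -- The value group is discrete: if |χ(z)| lies strictly below its bound, the gap is at least one,
  -- so after raising to the l-th power it is at least l ≥ m. Equality persists under powers and
  -- gives multiplicity zero.
  rcases h1.lt_or_eq with h1 | h1
  · right
    by_cases hp : p = 0
    · subst hp
      rcases Nat.eq_zero_or_pos l with h0 | h0
      · subst h0
        obtain rfl : m = 0 := by omega
        simp
      · rw [zero_pow h0.ne']
        exact zero_le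
    rw [← exp_log hp, ← exp_log hz0, exp_lt_exp] at h1
    rw [← exp_log hp, ← exp_log hz0, ← exp_nsmul, ← exp_nsmul, ← exp_add, exp_le_exp]
    simp only [nsmul_eq_mul]
    have h2 : (m : ℤ) ≤ l := by exact_mod_cast hl
    nlinarith
  · left
    rw [h1]

end Components

/-! ### Approximation lemmas -/

section Auxiliary

variable {K : Type u} [Field K] [NumberField K] {N : ℕ}

theorem eventually_valuation_le_one (a : K) :
    ∀ᶠ v : HeightOneSpectrum (𝓞 K) in cofinite, v.valuation K a ≤ 1 := by
  rw [eventually_cofinite]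
  simpa [HeightOneSpectrum.Support] using HeightOneSpectrum.Support.finite (𝓞 K) a

theorem eventually_valuation_eq_one {a : K} (ha : a ≠ 0) :
    ∀ᶠ v : HeightOneSpectrum (𝓞 K) in cofinite, v.valuation K a = 1 := by
  filter_upwards [eventually_valuation_le_one a, eventually_valuation_le_one a⁻¹] with v h1 h2
  refine le_antisymm h1 ?_
  rw [map_inv₀] at h2
  exact (inv_le_one₀ (zero_lt_iff.2 ((Valuation.ne_zero_iff _).2 ha))).1 h2

theorem eventually_supVal_le_one {ι : Type*} [Fintype ι] (x : ι → K) :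
    ∀ᶠ v : HeightOneSpectrum (𝓞 K) in cofinite, supVal (v.valuation K) x ≤ 1 := by
  simp only [supVal_le_iff, eventually_all]
  exact fun i => eventually_valuation_le_one (x i)

theorem eventually_supVal_eq_one {ι : Type*} [Fintype ι] {x : ι → K} (hx : x ≠ 0) :
    ∀ᶠ v : HeightOneSpectrum (𝓞 K) in cofinite, supVal (v.valuation K) x = 1 := by
  obtain ⟨i, hi⟩ := Function.ne_iff.1 hx
  filter_upwards [eventually_supVal_le_one x, eventually_valuation_eq_one hi] with v h1 h2
  exact le_antisymm h1 (h2 ▸ le_supVal _ x i)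

theorem eventually_content_eq_one {σ : Type*} {F : MvPolynomial σ K} (hF : F ≠ 0) :
    ∀ᶠ v : HeightOneSpectrum (𝓞 K) in cofinite, content (v.valuation K) F = 1 := by
  obtain ⟨d, hd⟩ := MvPolynomial.ne_zero_iff.1 hF
  have h : ∀ᶠ v : HeightOneSpectrum (𝓞 K) in cofinite,
      ∀ e ∈ F.support, v.valuation K (F.coeff e) ≤ 1 := by
    rw [Finset.eventually_all]
    exact fun e _ => eventually_valuation_le_one _
  filter_upwards [h, eventually_valuation_eq_one hd] with v h1 h2
  exact le_antisymm (Finset.sup_le h1) (h2 ▸ le_content _ F d)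

/-- Euclid's argument: if there were finitely many primes, one plus the product of their absolute
norms would lie in none of them, hence be a unit, although its norm is a positive power of an
integer greater than 1. -/
instance infinite_heightOneSpectrum : Infinite (HeightOneSpectrum (𝓞 K)) := by
  classical
  by_contra hinf
  rw [not_infinite_iff_finite] at hinf
  have : Fintype (HeightOneSpectrum (𝓞 K)) := Fintype.ofFinite _
  set n : ℕ := ∏ v : HeightOneSpectrum (𝓞 K), Ideal.absNorm v.asIdeal with hn
  have hn0 : n ≠ 0 := Finset.prod_ne_zero_iff.2 fun v _ =>
    fun h => v.ne_bot (Ideal.absNorm_eq_zero_iff.1 h)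
  have hmem : ∀ v : HeightOneSpectrum (𝓞 K), (n : 𝓞 K) ∈ v.asIdeal := by
    intro v
    rw [hn, Nat.cast_prod, ← Finset.mul_prod_erase _ _ (Finset.mem_univ v)]
    exact Ideal.mul_mem_right _ _ (Ideal.absNorm_mem _)
  have htop : Ideal.span {((n + 1 : ℕ) : 𝓞 K)} = ⊤ := by
    by_contra h
    obtain ⟨M, hM, hle⟩ := Ideal.exists_le_maximal _ h
    have hnM : ((n + 1 : ℕ) : 𝓞 K) ∈ M := hle (Ideal.mem_span_singleton_self _)
    have hM0 : M ≠ ⊥ := by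
      rintro rfl
      rw [Ideal.mem_bot, Nat.cast_eq_zero] at hnM
      exact absurd hnM n.succ_ne_zero
    have := M.sub_mem hnM (hmem ⟨M, hM.isPrime, hM0⟩)
    rw [Nat.cast_add, add_sub_cancel_left, Nat.cast_one] at this
    exact hM.ne_top ((Ideal.eq_top_iff_one _).2 this)
  have h1 := congrArg Ideal.absNorm htop
  rw [Ideal.absNorm_top, Ideal.absNorm_span_natCast] at h1
  have h2 : 0 < Module.finrank ℤ (𝓞 K) := by
    rw [RingOfIntegers.rank]
    exact Module.finrank_pos
  rcases pow_eq_one_iff.1 h1 with h | h <;> omega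

theorem exists_finset_of_eventually {P : HeightOneSpectrum (𝓞 K) → Prop}
    (h : ∀ᶠ v in cofinite, P v) :
    ∃ T : Finset (Place K), (∀ v, (Sum.inl v : Place K) ∈ T ↔ ¬ P v) ∧
      ∀ w, (Sum.inr w : Place K) ∉ T := by
  rw [eventually_cofinite] at h
  exact ⟨h.toFinset.map ⟨Sum.inl, Sum.inl_injective⟩, by simp⟩

theorem exists_inl_notMem (T : Finset (Place K)) :
    ∃ v : HeightOneSpectrum (𝓞 K), (Sum.inl v : Place K) ∉ T := by
  by_contra! h
  have : Finite (HeightOneSpectrum (𝓞 K)) :=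
    Finite.of_injective (fun v => (⟨Sum.inl v, h v⟩ : T)) fun v w hvw => by simpa using hvw
  exact not_finite (HeightOneSpectrum (𝓞 K))

/-- The image in `K_v^N` of a vector over `K`. -/
noncomputable abbrev Place.mapVec (v : Place K) (x : Fin N → K) : Fin N → v.Completion :=
  fun i => algebraMap K v.Completion (x i)

theorem aeval_mapVec (v : Place K) (x : Fin N → K) (F : MvPolynomial (Fin N) K) :
    MvPolynomial.aeval (v.mapVec x) F = algebraMap K v.Completion (MvPolynomial.eval x F) := by
  have := MvPolynomial.aeval_algebraMap_apply v.Completion x F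
  rwa [MvPolynomial.aeval_eq_eval] at this

theorem Place.mapVec_ne_zero (v : Place K) {x : Fin N → K} (hx : x ≠ 0) : v.mapVec x ≠ 0 := by
  intro h
  apply hx
  ext i
  exact (algebraMap K v.Completion).injective ((congrFun h i).trans (map_zero _).symm)

/-- Weak approximation for open conditions around points over the completions: density of K in each
completion moves the centre of each neighbourhood into K. -/
theorem exists_of_eventually_nhds (T : Finset (Place K)) (z : (v : Place K) → Fin N → v.Completion)
    (Q : (v : Place K) → (Fin N → v.Completion) → Prop)
    (hQ : ∀ v ∈ T, ∀ᶠ y in 𝓝 (z v), Q v y) : ∃ x : Fin N → K, ∀ v ∈ T, Q v (v.mapVec x) := by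
  have h : ∀ v : Place K, ∃ y : Fin N → K, v ∈ T → {x | Q v (v.mapVec x)} ∈ v.nhdsVec y := by
    intro v
    by_cases hv : v ∈ T
    · obtain ⟨U, hU, hUo, hz⟩ := eventually_nhds_iff.1 (hQ v hv)
      obtain ⟨y, hy⟩ := (v.denseRange_vec N).exists_mem_open hUo ⟨_, hz⟩
      exact ⟨y, fun _ => ⟨U, hUo.mem_nhds hy, fun x hx => hU _ hx⟩⟩
    · exact ⟨0, fun h => absurd h hv⟩
  choose y hy using h
  exact exists_mem_of_mem_nhdsVec T y _ hy

/-- Convergence of the coordinates of an element of a quadratic algebra at a place. -/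
def QuadTendsto {X : Type*} (v : Place K) {a b : K} (l : Filter X) (g : X → QuadraticAlgebra K a b)
    (e : QuadraticAlgebra K a b) : Prop :=
  Tendsto (fun t => algebraMap K v.Completion (g t).re) l (𝓝 (algebraMap K v.Completion e.re)) ∧
  Tendsto (fun t => algebraMap K v.Completion (g t).im) l (𝓝 (algebraMap K v.Completion e.im))

/-! ### Continuity of the arithmetic of a quadratic algebra at a place -/

section QuadTendsto

variable {X : Type*} {v : Place K} {a b : K} {l : Filter X} {g h : X → QuadraticAlgebra K a b}
  {d e : QuadraticAlgebra K a b}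

theorem eventually_quadVal_le_one (e : QuadraticAlgebra K a b) :
    ∀ᶠ v : HeightOneSpectrum (𝓞 K) in cofinite, quadVal (v.valuation K) e ≤ 1 := by
  filter_upwards [eventually_valuation_le_one e.re, eventually_valuation_le_one e.im] with v h1 h2
  exact max_le h1 h2

theorem QuadTendsto.mul (hg : QuadTendsto v l g d) (hh : QuadTendsto v l h e) :
    QuadTendsto v l (fun t => g t * h t) (d * e) := by
  constructor
  · simp only [QuadraticAlgebra.re_mul, map_add, map_mul]
    exact (hg.1.mul hh.1).add ((tendsto_const_nhds.mul hg.2).mul hh.2)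
  · simp only [QuadraticAlgebra.im_mul, map_add, map_mul]
    exact ((hg.1.mul hh.2).add (hg.2.mul hh.1)).add ((tendsto_const_nhds.mul hg.2).mul hh.2)

theorem QuadTendsto.pow (hg : QuadTendsto v l g d) (k : ℕ) :
    QuadTendsto v l (fun t => g t ^ k) (d ^ k) := by
  induction k with
  | zero => simpa using ⟨tendsto_const_nhds, tendsto_const_nhds⟩
  | succ k ih => simpa only [pow_succ] using ih.mul hg

theorem QuadTendsto.norm (hg : QuadTendsto v l g d) :
    Tendsto (fun t => algebraMap K v.Completion (g t).norm) l
      (𝓝 (algebraMap K v.Completion d.norm)) := by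
  simp only [QuadraticAlgebra.norm_def, map_add, map_sub, map_mul]
  exact ((hg.1.mul hg.1).add ((tendsto_const_nhds.mul hg.1).mul hg.2)).sub
    ((tendsto_const_nhds.mul hg.2).mul hg.2)

theorem QuadTendsto.eventually_norm_ne_zero (hg : QuadTendsto v l g d) (hd : d.norm ≠ 0) :
    ∀ᶠ t in l, (g t).norm ≠ 0 := by
  have h0 : algebraMap K v.Completion d.norm ≠ 0 := by
    rwa [ne_eq, map_eq_zero_iff _ (algebraMap K v.Completion).injective]
  filter_upwards [hg.norm.eventually_ne h0] with t ht h
  rw [h, map_zero] at ht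
  exact ht rfl

theorem QuadTendsto.linePoint (hg : QuadTendsto v l g d) (x y : Fin N → K) :
    Tendsto (fun t => v.mapVec (linePoint x y (g t))) l (𝓝 (v.mapVec (linePoint x y d))) := by
  rw [tendsto_pi_nhds]
  intro i
  simp only [Place.mapVec, SemiIntegral.linePoint, Pi.add_apply, Pi.smul_apply, smul_eq_mul,
    map_add, map_mul]
  exact (hg.1.mul tendsto_const_nhds).add (hg.2.mul tendsto_const_nhds)

/-- The family `1 + c (e - 1)` interpolating between `1` and `e`. -/
def interp (e : QuadraticAlgebra K a b) (c : K) : QuadraticAlgebra K a b := 1 + c • (e - 1)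

theorem quadTendsto_interp (e : QuadraticAlgebra K a b) (c : K) (X : Type*) (l : Filter X)
    (s : X → K) (hs : Tendsto s l (v.nhds c)) :
    QuadTendsto v l (fun t => interp e (s t)) (interp e c) := by
  have h : Tendsto (fun t => algebraMap K v.Completion (s t)) l
      (𝓝 (algebraMap K v.Completion c)) := tendsto_comap.comp hs
  constructor
  · simp only [interp, QuadraticAlgebra.re_add, QuadraticAlgebra.re_smul, smul_eq_mul, map_add,
      map_mul]
    exact tendsto_const_nhds.add (h.mul tendsto_const_nhds)
  · simp only [interp, QuadraticAlgebra.im_add, QuadraticAlgebra.im_smul, smul_eq_mul, map_add,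
      map_mul]
    exact tendsto_const_nhds.add (h.mul tendsto_const_nhds)

theorem interp_zero {K : Type*} [Field K] {a b : K} (e : QuadraticAlgebra K a b) :
    interp e 0 = 1 := by simp [interp]

theorem interp_one {K : Type*} [Field K] {a b : K} (e : QuadraticAlgebra K a b) :
    interp e 1 = e := by simp [interp]

end QuadTendsto

end Auxiliary

/-! ### Approximation by Campana points -/

section Campana

variable {K : Type u} [Field K] [NumberField K] {N m : ℕ} {f : MvPolynomial (Fin N) K}
  {D : OrbifoldDivisor K N}

/-- At every finite place there is a point at which each component has multiplicity zero. -/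
theorem exists_unit_value (hf : f.IsHomogeneous 2) (hsq : Squarefree f)
    (hD : D.IsHypersurface m f) (v : HeightOneSpectrum (𝓞 K)) :
    ∃ y : Fin N → K, y ≠ 0 ∧ ∀ α, v.valuation K (MvPolynomial.eval y (D.form α)) =
      content (v.valuation K) (D.form α) * supVal (v.valuation K) y ^ D.degree α := by
  set w := v.valuation K with hw
  obtain ⟨c, hc, -⟩ := exists_scaling v hsq.ne_zero
  have hc0 : w c ≠ 0 := left_ne_zero_of_mul (hc ▸ one_ne_zero)
  have hcont : content w (MvPolynomial.C c * f) = 1 := by rw [content_C_mul, hc]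
  obtain ⟨G, hG⟩ := exists_map_of_content_le_one w hcont.le
  rw [← hG, content_eq_one_of_map] at hcont
  have hGh : G.IsHomogeneous 2 := by
    refine MvPolynomial.IsHomogeneous.of_map (f := algebraMap w.valuationSubring K)
      Subtype.val_injective ?_
    rw [hG]
    exact hf.C_mul c
  -- A nonzero form of degree at most q cannot vanish on all vectors over a field with q elements.
  -- Degree 2 is therefore harmless even for residue field 𝔽₂.
  obtain ⟨r, hr⟩ : ∃ r, MvPolynomial.eval r
      (MvPolynomial.map (IsLocalRing.residue w.valuationSubring) G) ≠ 0 := by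
    by_contra! h
    refine hcont ((hGh.map _).eq_zero_of_forall_eval_eq_zero_of_le_card h ?_)
    exact_mod_cast Cardinal.two_le_iff.2 (exists_pair_ne _)
  choose y hy using fun i => IsLocalRing.residue_surjective (r i)
  have hy1 : MvPolynomial.eval r (MvPolynomial.map (IsLocalRing.residue w.valuationSubring) G) =
      IsLocalRing.residue w.valuationSubring (MvPolynomial.eval y G) := by
    rw [show r = fun i => IsLocalRing.residue w.valuationSubring (y i) from
      funext fun i => (hy i).symm, MvPolynomial.eval_map, MvPolynomial.eval₂_comp]
    rfl
  have hy2 : w ((MvPolynomial.eval y G : w.valuationSubring) : K) = 1 := by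
    rw [hy1, ne_eq, IsLocalRing.residue_eq_zero_iff, Valuation.mem_maximalIdeal_iff, not_lt] at hr
    exact le_antisymm (MvPolynomial.eval y G).2 hr
  set z : Fin N → K := fun i => (y i : K) with hz
  have hzs : supVal w z ≤ 1 := (supVal_le_iff w).2 fun i => (y i).2
  have hfz : w (MvPolynomial.eval z f) = content w f := by
    have h1 : MvPolynomial.eval z (MvPolynomial.C c * f) =
        ((MvPolynomial.eval y G : w.valuationSubring) : K) := by
      rw [← hG, MvPolynomial.eval_map]
      exact (MvPolynomial.eval₂_comp (algebraMap w.valuationSubring K) y G).symm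
    have h2 : w c * w (MvPolynomial.eval z f) = w c * content w f := by
      have h3 := congrArg w h1
      rw [map_mul (MvPolynomial.eval z), MvPolynomial.eval_C, map_mul, hy2] at h3
      exact h3.trans hc.symm
    exact mul_left_cancel₀ hc0 h2
  have hcf : content w f ≠ 0 := content_ne_zero w hsq.ne_zero
  have hle : ∀ {F : MvPolynomial (Fin N) K} {d : ℕ}, F.IsHomogeneous d →
      w (MvPolynomial.eval z F) ≤ content w F * supVal w z ^ d := by
    intro F d hF
    have h := map_aeval_le w w (fun _ => rfl) z hF
    rwa [MvPolynomial.aeval_eq_eval] at h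
  have hs : supVal w z = 1 := by
    refine le_antisymm hzs (not_lt.1 fun h => ?_)
    have h1 := hle hf
    rw [hfz] at h1
    refine absurd (h1.trans_lt ?_) (lt_irrefl _)
    exact mul_lt_of_lt_one_right (zero_lt_iff.2 hcf) (pow_lt_one₀ zero_le h two_ne_zero)
  refine ⟨z, ?_, fun α => ?_⟩
  · intro h
    rw [(supVal_eq_zero_iff w).2 h] at hs
    exact zero_ne_one hs
  have hcα : ∀ α, content w (D.form α) ≠ 0 := fun α => content_ne_zero w (form_ne_zero D α)
  -- The normalized values are at most 1, and by Gauss's lemma their product is the normalized value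
  -- of f, which is 1.
  have h1 : ∀ α, w (MvPolynomial.eval z (D.form α)) / content w (D.form α) = 1 := by
    apply eq_one_of_prod_eq_one
    · intro β
      have := hle (D.isHomogeneous β)
      rw [hs, one_pow, mul_one] at this
      exact div_le_one_of_le₀ this zero_le
    · rw [Finset.prod_div_distrib, ← map_prod, ← eval_eq_prod hD, ← content_prod, hD.1, hfz,
        div_self hcf]
  rw [hs, one_pow, mul_one]
  exact (div_eq_one_iff_eq (hcα α)).1 (h1 α)

/-- On proportional vectors the binary form is a square of a linear form up to a constant, so its
discriminant vanishes. -/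
theorem exists_minor_ne_zero (hf : f.IsHomogeneous 2) {x y : Fin N → K}
    (hd : lineDisc f x y ≠ 0) : ∃ i j, x i * y j - x j * y i ≠ 0 := by
  by_contra! h
  apply hd
  by_cases hx : x = 0
  · have h0 : MvPolynomial.eval x f = 0 := by
      have := eval_smul_add_smul hf x y 0 0
      simp only [zero_smul, add_zero] at this
      rw [hx, this]
      ring
    rw [lineDisc, polarForm, h0, hx, zero_add]
    ring
  · obtain ⟨i, hi⟩ := Function.ne_iff.1 hx
    rw [Pi.zero_apply] at hi
    set t := y i / x i with ht
    have hy : y = t • x + (0 : K) • x := by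
      ext j
      simp only [Pi.add_apply, Pi.smul_apply, smul_eq_mul, zero_mul, add_zero, ht]
      field_simp
      linear_combination h i j
    have h1 : MvPolynomial.eval y f = t ^ 2 * MvPolynomial.eval x f := by
      rw [hy, eval_smul_add_smul hf]
      ring
    have h2 : MvPolynomial.eval (x + y) f = (1 + t) ^ 2 * MvPolynomial.eval x f := by
      have : x + y = (1 + t) • x + (0 : K) • x := by
        rw [hy, zero_smul, add_zero, add_zero, add_smul, one_smul]
      rw [this, eval_smul_add_smul hf]
      ring
    rw [lineDisc, polarForm, h2, h1]
    ring

/-- The places at which the line through `x` and `y` has good reduction. -/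
theorem eventually_good_line {x y : Fin N → K} (hfx : MvPolynomial.eval x f ≠ 0)
    (hd : lineDisc f x y ≠ 0) {i j : Fin N} (hij : x i * y j - x j * y i ≠ 0) :
    ∀ᶠ v : HeightOneSpectrum (𝓞 K) in cofinite, supVal (v.valuation K) y ≤ 1 ∧
      v.valuation K (x i * y j - x j * y i) = 1 ∧ v.valuation K (lineA f x y) ≤ 1 ∧
      v.valuation K (lineB f x y) ≤ 1 ∧
      v.valuation K (lineB f x y ^ 2 + 4 * lineA f x y) = 1 := by
  have hdisc : lineB f x y ^ 2 + 4 * lineA f x y ≠ 0 := by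
    rw [lineB_sq_add hfx]
    exact div_ne_zero hd (pow_ne_zero _ hfx)
  filter_upwards [eventually_supVal_le_one y, eventually_valuation_eq_one hij,
    eventually_valuation_le_one (lineA f x y), eventually_valuation_le_one (lineB f x y),
    eventually_valuation_eq_one hdisc] with v h1 h2 h3 h4 h5
  exact ⟨h1, h2, h3, h4, h5⟩

/-- For c in the maximal ideal and e − 1 integral, 1 + c(e − 1) is congruent to 1, and so is its
norm. -/
theorem interp_unit {v : HeightOneSpectrum (𝓞 K)} {a b : K} (ha : v.valuation K a ≤ 1)
    (hb : v.valuation K b ≤ 1) {e : QuadraticAlgebra K a b}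
    (he : quadVal (v.valuation K) (e - 1) ≤ 1) {c : K} (hc : v.valuation K c < 1) :
    quadVal (v.valuation K) (interp e c) ≤ 1 ∧ v.valuation K (interp e c).norm = 1 := by
  set w := v.valuation K with hw
  set d := c • (e - 1) with hd
  have hdv : quadVal w d < 1 := by
    rw [hd, quadVal_smul]
    exact mul_lt_one_of_nonneg_of_lt_one_left zero_le hc he
  have hre : w d.re < 1 := (map_re_le_quadVal w d).trans_lt hdv
  have him : w d.im < 1 := (map_im_le_quadVal w d).trans_lt hdv
  have hi : interp e c = 1 + d := rfl
  constructor
  · rw [hi, quadVal, QuadraticAlgebra.re_add, QuadraticAlgebra.im_add, QuadraticAlgebra.re_one,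
      QuadraticAlgebra.im_one, zero_add]
    exact max_le ((w.map_add _ _).trans (max_le (map_one w).le hre.le)) him.le
  · have h1 : (interp e c).norm = 1 + ((2 + d.re + b * d.im) * d.re + (b - a * d.im) * d.im) := by
      rw [hi, QuadraticAlgebra.norm_def, QuadraticAlgebra.re_add, QuadraticAlgebra.im_add,
        QuadraticAlgebra.re_one, QuadraticAlgebra.im_one]
      ring
    have h2 : w ((2 + d.re + b * d.im) * d.re + (b - a * d.im) * d.im) < 1 := by
      refine (w.map_add _ _).trans_lt (max_lt ?_ ?_)
      · rw [map_mul]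
        refine mul_lt_one_of_nonneg_of_lt_one_right ?_ zero_le hre
        refine (w.map_add _ _).trans (max_le ((w.map_add _ _).trans
          (max_le (valuation_two_le_one w) hre.le)) ?_)
        rw [map_mul]
        exact mul_le_one' hb him.le
      · rw [map_mul]
        refine mul_lt_one_of_nonneg_of_lt_one_right ?_ zero_le him
        refine (w.map_sub _ _).trans (max_le hb ?_)
        rw [map_mul]
        exact mul_le_one' ha him.le
    rw [h1, w.map_add_eq_of_lt_left, map_one]
    rwa [map_one]

theorem setOf_valuation_lt_one_mem_nhds (v : HeightOneSpectrum (𝓞 K)) :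
    ∀ᶠ c in Place.nhds (Sum.inl v : Place K) 0, v.valuation K c < 1 := by
  have h : Tendsto (algebraMap K (v.adicCompletion K)) (Place.nhds (Sum.inl v : Place K) 0)
      (𝓝 (algebraMap K (v.adicCompletion K) 0)) := tendsto_comap
  filter_upwards [h.eventually (eventually_valued_sub_lt _ one_ne_zero)] with c hc
  rwa [map_zero, sub_zero, valued_algebraMap] at hc

/-- Simultaneous approximation by points satisfying the Campana condition. The predicate `Q`
collects the conditions at the places in `T` and, at the other finite places, is implied by the
Campana condition. -/
theorem exists_campana_approximation (hf : f.IsHomogeneous 2) (hsq : Squarefree f)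
    (hD : D.IsHypersurface m f) (T : Finset (Place K))
    (Q : (v : Place K) → (Fin N → v.Completion) → Prop)
    (hQ : ∀ v y, Q v y → ∀ᶠ z in 𝓝 y, Q v z) (hT : ∀ v ∈ T, ∃ y, Q v y)
    (hcont : ∀ v : HeightOneSpectrum (𝓞 K), (Sum.inl v : Place K) ∉ T →
      ∀ α, content (v.valuation K) (D.form α) = 1)
    (hgood : ∀ v : HeightOneSpectrum (𝓞 K), (Sum.inl v : Place K) ∉ T →
      ∀ p : Fin N → K, p ≠ 0 →
        (∀ α, v.valuation K (MvPolynomial.eval p (D.form α)) =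
            supVal (v.valuation K) p ^ D.degree α ∨
          v.valuation K (MvPolynomial.eval p (D.form α)) ≤
            exp (-(m : ℤ)) * supVal (v.valuation K) p ^ D.degree α) →
        Q (.inl v) (Place.mapVec (.inl v) p)) :
    ∃ p : Fin N → K, p ≠ 0 ∧ (∀ v ∈ T, Q v (v.mapVec p)) ∧
      ∀ v : HeightOneSpectrum (𝓞 K), Q (.inl v) (Place.mapVec (.inl v) p) := by
  classical
  have eval_zero : MvPolynomial.eval (0 : Fin N → K) f = 0 := by
    have := eval_smul_add_smul hf 0 0 0 0
    simpa using this
  obtain ⟨x, hxT, hfx⟩ : ∃ x : Fin N → K, (∀ v ∈ T, Q v (v.mapVec x)) ∧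
      MvPolynomial.eval x f ≠ 0 := by
    -- The condition f(x) ≠ 0 is imposed at an auxiliary place outside T, because the local points
    -- at T may be on the quadric.
    obtain ⟨v₁, hv₁⟩ := exists_inl_notMem T
    obtain ⟨y₁, hy₁⟩ : ∃ y₁, MvPolynomial.eval y₁ f ≠ 0 := by
      by_contra! h
      exact hsq.ne_zero (MvPolynomial.funext fun y => by rw [h y, map_zero])
    have hz : ∀ v : Place K, ∃ z : Fin N → v.Completion,
        (v ∈ T → Q v z) ∧ (v ∉ T → MvPolynomial.aeval z f ≠ 0) := by
      intro v
      by_cases hv : v ∈ T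
      · obtain ⟨z, hz⟩ := hT v hv
        exact ⟨z, fun _ => hz, fun h => absurd hv h⟩
      · refine ⟨v.mapVec y₁, fun h => absurd h hv, fun _ => ?_⟩
        rw [aeval_mapVec]
        exact (map_ne_zero_iff _ (algebraMap K v.Completion).injective).2 hy₁
    choose z hz₁ hz₂ using hz
    obtain ⟨x, hx⟩ := exists_of_eventually_nhds (insert (Sum.inl v₁) T) z
      (fun v y => (v ∈ T → Q v y) ∧ (v ∉ T → MvPolynomial.aeval y f ≠ 0)) (by
        intro v _
        by_cases hv : v ∈ T
        · filter_upwards [hQ v _ (hz₁ v hv)] with y hy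
          exact ⟨fun _ => hy, fun h => absurd hv h⟩
        · filter_upwards [((continuous_aeval f).tendsto (z v)).eventually_ne (hz₂ v hv)] with y hy
          exact ⟨fun h => absurd h hv, fun _ => hy⟩)
    refine ⟨x, fun v hv => (hx v (Finset.mem_insert_of_mem hv)).1 hv, ?_⟩
    have := (hx _ (Finset.mem_insert_self _ _)).2 hv₁
    rw [aeval_mapVec] at this
    exact (map_ne_zero_iff _ (algebraMap K _).injective).1 this
  have hx0 : x ≠ 0 := by
    rintro rfl
    exact hfx eval_zero
  -- B consists of the finite places outside T at which x is not primitive or some component takes a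
  -- nonunit value. These are to be repaired by y.
  obtain ⟨B, hB, hB'⟩ := exists_finset_of_eventually (K := K)
    (P := fun v => (Sum.inl v : Place K) ∈ T ∨ (supVal (v.valuation K) x = 1 ∧
      ∀ α, v.valuation K (MvPolynomial.eval x (D.form α)) = 1)) (by
    filter_upwards [eventually_supVal_eq_one hx0, eventually_all.2 fun α =>
      eventually_valuation_eq_one (eval_form_ne_zero hD hfx α)] with v h1 h2
    exact Or.inr ⟨h1, h2⟩)
  have hxgood : ∀ v, (Sum.inl v : Place K) ∉ T → (Sum.inl v : Place K) ∉ B →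
      supVal (v.valuation K) x = 1 ∧
        ∀ α, v.valuation K (MvPolynomial.eval x (D.form α)) = 1 := by
    intro v hvT hvB
    rw [hB, not_not] at hvB
    exact hvB.resolve_left hvT
  have hxQ : ∀ v ∉ B, (∃ v₀ : HeightOneSpectrum (𝓞 K), v = Sum.inl v₀) ∨ v ∈ T →
      Q v (v.mapVec x) := by
    rintro v hvB hv
    by_cases hvT : v ∈ T
    · exact hxT v hvT
    · obtain ⟨v, rfl⟩ := hv.resolve_right hvT
      obtain ⟨h1, h2⟩ := hxgood v hvT hvB
      refine hgood v hvT x hx0 fun α => Or.inl ?_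
      rw [h1, h2, one_pow]
  obtain ⟨y, hyB, hfy, hdisc⟩ : ∃ y : Fin N → K, (∀ v ∈ B, Q v (v.mapVec y)) ∧
      MvPolynomial.eval y f ≠ 0 ∧ lineDisc f x y ≠ 0 := by
    obtain ⟨v₂, hv₂⟩ := exists_inl_notMem B
    obtain ⟨y₀, hfy₀, hdisc₀⟩ := exists_eval_ne_zero_lineDisc_ne_zero hf hsq hfx
    -- The discriminant of the line through x and z, as a continuous function of z over the
    -- completion; its nonvanishing is imposed at the auxiliary place v₂.
    let δ : (v : Place K) → (Fin N → v.Completion) → v.Completion := fun v z =>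
      (MvPolynomial.aeval (v.mapVec x + z) f - MvPolynomial.aeval (v.mapVec x) f -
        MvPolynomial.aeval z f) ^ 2 -
        4 * MvPolynomial.aeval (v.mapVec x) f * MvPolynomial.aeval z f
    have hδ : ∀ v y, δ v (v.mapVec y) = algebraMap K v.Completion (lineDisc f x y) := by
      intro v y
      have hadd : v.mapVec x + v.mapVec y = v.mapVec (x + y) := by
        ext i
        exact (map_add _ _ _).symm
      simp only [δ, hadd, aeval_mapVec, lineDisc, polarForm, map_sub, map_mul, map_pow, map_ofNat]
    have hδc : ∀ v, Continuous (δ v) := by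
      intro v
      have h1 := continuous_aeval (L := v.Completion) f
      have h2 : Continuous fun z : Fin N → v.Completion =>
          MvPolynomial.aeval (v.mapVec x + z) f := h1.comp (continuous_const.add continuous_id)
      exact (((h2.sub continuous_const).sub h1).pow 2).sub (continuous_const.mul h1)
    have hz : ∀ v : Place K, ∃ z : Fin N → v.Completion, (v ∈ B → Q v z) ∧
        (v ∉ B → MvPolynomial.aeval z f ≠ 0 ∧ δ v z ≠ 0) := by
      intro v
      by_cases hv : v ∈ B
      · rcases v with v | v
        · obtain ⟨z, hz0, hz⟩ := exists_unit_value hf hsq hD v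
          have hvT : (Sum.inl v : Place K) ∉ T := fun h => (hB v).1 hv (Or.inl h)
          refine ⟨Place.mapVec (Sum.inl v) z, fun _ => ?_, fun h => absurd hv h⟩
          refine hgood v hvT z hz0 fun α => Or.inl ?_
          rw [hz, hcont v hvT, one_mul]
        · exact absurd hv (hB' v)
      · refine ⟨v.mapVec y₀, fun h => absurd h hv, fun _ => ⟨?_, ?_⟩⟩
        · rw [aeval_mapVec]
          exact (map_ne_zero_iff _ (algebraMap K v.Completion).injective).2 hfy₀
        · rw [hδ]
          exact (map_ne_zero_iff _ (algebraMap K v.Completion).injective).2 hdisc₀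
    choose z hz₁ hz₂ using hz
    obtain ⟨y, hy⟩ := exists_of_eventually_nhds (insert (Sum.inl v₂) B) z
      (fun v y => (v ∈ B → Q v y) ∧ (v ∉ B → MvPolynomial.aeval y f ≠ 0 ∧ δ v y ≠ 0)) (by
        intro v _
        by_cases hv : v ∈ B
        · filter_upwards [hQ v _ (hz₁ v hv)] with y hy
          exact ⟨fun _ => hy, fun h => absurd hv h⟩
        · filter_upwards [((continuous_aeval f).tendsto (z v)).eventually_ne (hz₂ v hv).1,
            ((hδc v).tendsto (z v)).eventually_ne (hz₂ v hv).2] with y hy hy'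
          exact ⟨fun h => absurd h hv, fun _ => ⟨hy, hy'⟩⟩)
    refine ⟨y, fun v hv => (hy v (Finset.mem_insert_of_mem hv)).1 hv, ?_⟩
    have := (hy _ (Finset.mem_insert_self _ _)).2 hv₂
    rw [aeval_mapVec, hδ] at this
    exact ⟨(map_ne_zero_iff _ (algebraMap K _).injective).1 this.1,
      (map_ne_zero_iff _ (algebraMap K _).injective).1 this.2⟩
  obtain ⟨i, j, hij⟩ := exists_minor_ne_zero hf hdisc
  -- In the coordinates of the line, 1 is the point x and ω is the point y. As f(y) ≠ 0, ω has the
  -- inverse θ, its conjugate divided by its norm.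
  set ω : QuadraticAlgebra K (lineA f x y) (lineB f x y) := ⟨0, 1⟩ with hω
  have hωn : ω.norm ≠ 0 := by
    rw [QuadraticAlgebra.norm_def, hω, lineA]
    simpa using ⟨hfy, hfx⟩
  set θ := ω.norm⁻¹ • star ω with hθ
  have hθω : θ * ω = 1 := by
    rw [hθ, smul_mul_assoc, mul_comm, ← QuadraticAlgebra.algebraMap_norm_eq_mul_star,
      Algebra.smul_def, ← map_mul, inv_mul_cancel₀ hωn, map_one]
  have hθn : θ.norm ≠ 0 := by
    intro h
    have := congrArg QuadraticAlgebra.norm hθω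
    rw [map_mul, h, zero_mul, map_one] at this
    exact zero_ne_one this
  -- Outside B₁ the line has good reduction, and ω − 1 is integral, so that 1 + d(ω − 1) becomes a
  -- unit as soon as d is in the maximal ideal.
  obtain ⟨B₁, hB₁, hB₁'⟩ := exists_finset_of_eventually (K := K)
    ((eventually_good_line hfx hdisc hij).and
      ((eventually_quadVal_le_one (θ - 1)).and (eventually_quadVal_le_one (ω - 1))))
  -- The extra place makes T₂ nonempty, so that the nonvanishing of norms can be obtained as a local
  -- condition.
  obtain ⟨v₃, hv₃⟩ := exists_inl_notMem (T ∪ B)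
  rw [Finset.mem_union, not_or] at hv₃
  set T₂ := insert (Sum.inl v₃) (T ∪ B ∪ B₁) with hT₂
  -- The targets for c and d: parameter 1 gives the point y, needed on B, and parameter 0 gives x,
  -- which is already good elsewhere.
  set t : Place K → K := fun v => if v ∈ B then 1 else 0 with ht
  have hnorm : ∀ {e : QuadraticAlgebra K (lineA f x y) (lineB f x y)}, e.norm ≠ 0 →
      ∀ v : Place K, ∀ᶠ c in v.nhds (t v), (interp e c).norm ≠ 0 := by
    intro e he v
    refine QuadTendsto.eventually_norm_ne_zero
      (quadTendsto_interp e (t v) K (v.nhds (t v)) id tendsto_id) ?_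
    by_cases hv : v ∈ B
    · simpa [ht, hv, interp_one] using he
    · simp [ht, hv, interp_zero]
  have hlim : ∀ v ∈ T₂, ∀ᶠ c in (v.nhds (t v)) ×ˢ (v.nhds (t v)),
      Q v (v.mapVec (linePoint x y (interp θ c.1 ^ m * interp ω c.2 ^ (m + 1)))) := by
    intro v hv
    have hlim := (((quadTendsto_interp θ (t v) _ _ _ tendsto_fst).pow m).mul
      ((quadTendsto_interp ω (t v) _ _ _ tendsto_snd).pow (m + 1))).linePoint (v := v)
      (l := (v.nhds (t v)) ×ˢ (v.nhds (t v))) x y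
    refine hlim.eventually (hQ v _ ?_)
    by_cases hvB : v ∈ B
    · have h1 : linePoint x y (interp θ (t v) ^ m * interp ω (t v) ^ (m + 1)) = y := by
        simp only [ht, hvB, if_true, interp_one]
        rw [pow_succ, ← mul_assoc, ← mul_pow, hθω, one_pow, one_mul, linePoint, hω]
        simp
      rw [h1]
      exact hyB v hvB
    · have h1 : linePoint x y (interp θ (t v) ^ m * interp ω (t v) ^ (m + 1)) = x := by
        simp only [ht, hvB, if_false, interp_zero, one_pow, one_mul, linePoint,
          QuadraticAlgebra.re_one, QuadraticAlgebra.im_one]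
        simp
      rw [h1]
      refine hxQ v hvB ?_
      rcases v with v | v
      · exact Or.inl ⟨v, rfl⟩
      · right
        simp only [hT₂, Finset.mem_insert, Finset.mem_union, reduceCtorEq, false_or] at hv
        exact (hv.resolve_right (hB₁' v)).resolve_right (hB' v)
  -- A product neighbourhood decouples the two parameters: c can be fixed before the conditions on
  -- d, which depend on c, are known.
  have hchoose : ∀ v : Place K, ∃ p₁ p₂ : K → Prop, v ∈ T₂ →
      (∀ᶠ c in v.nhds (t v), p₁ c) ∧ (∀ᶠ c in v.nhds (t v), p₂ c) ∧
      ∀ c, p₁ c → ∀ d, p₂ d →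
        Q v (v.mapVec (linePoint x y (interp θ c ^ m * interp ω d ^ (m + 1)))) := by
    intro v
    by_cases hv : v ∈ T₂
    · obtain ⟨p₁, h1, p₂, h2, h3⟩ := eventually_prod_iff.1 (hlim v hv)
      exact ⟨p₁, p₂, fun _ => ⟨h1, h2, fun c hc d hd => h3 hc hd⟩⟩
    · exact ⟨fun _ => True, fun _ => True, fun h => absurd h hv⟩
  choose p₁ p₂ hp using hchoose
  obtain ⟨c, hc⟩ := exists_mem_of_mem_nhds T₂ t
    (fun v => {c | p₁ v c ∧ (interp θ c).norm ≠ 0})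
    (fun v hv => (hp v hv).1.and (hnorm hθn v))
  have hcn : (interp θ c).norm ≠ 0 := (hc _ (Finset.mem_insert_self _ _)).2
  -- C collects the places outside T₂ where the first factor, with c now fixed, is not known to be
  -- an integral unit.
  obtain ⟨C, hC, hC'⟩ := exists_finset_of_eventually (K := K)
    (P := fun v => (Sum.inl v : Place K) ∈ T₂ ∨ (quadVal (v.valuation K) (interp θ c) ≤ 1 ∧
      v.valuation K (interp θ c).norm = 1)) (by
    filter_upwards [eventually_quadVal_le_one (interp θ c), eventually_valuation_eq_one hcn]
      with v h1 h2
    exact Or.inr ⟨h1, h2⟩)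
  have hCT : ∀ v ∈ C, v ∉ T₂ := by
    rintro (v | v) hv h
    · exact (hC v).1 hv (Or.inl h)
    · exact hC' v hv
  have hCB : ∀ v ∈ C, t v = 0 := by
    intro v hv
    have h1 := hCT v hv
    have : v ∉ B := fun h => h1 (by simp [hT₂, h])
    simp [ht, this]
  -- On C the target is 0 because C misses T₂ ⊇ B; asking d to lie in the maximal ideal there makes
  -- the second factor a unit.
  obtain ⟨d, hd⟩ := exists_mem_of_mem_nhds (T₂ ∪ C) t
    (fun v => {d | (v ∈ T₂ → p₂ v d ∧ (interp ω d).norm ≠ 0) ∧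
      (v ∈ C → ∀ v₀ : HeightOneSpectrum (𝓞 K), v = Sum.inl v₀ → v₀.valuation K d < 1)}) (by
    intro v hv
    by_cases hvT : v ∈ T₂
    · filter_upwards [(hp v hvT).2.1, hnorm hωn v] with d h1 h2
      exact ⟨fun _ => ⟨h1, h2⟩, fun h => absurd hvT (hCT v h)⟩
    · have hvC : v ∈ C := (Finset.mem_union.1 hv).resolve_left hvT
      rw [hCB v hvC]
      rcases v with v | v
      · filter_upwards [setOf_valuation_lt_one_mem_nhds v] with d hd
        refine ⟨fun h => absurd h hvT, fun _ v₀ h => ?_⟩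
        rw [Sum.inl_injective h.symm]
        exact hd
      · exact absurd hvC (hC' v))
  have hdn : (interp ω d).norm ≠ 0 :=
    ((hd _ (Finset.mem_union_left _ (Finset.mem_insert_self _ _))).1
      (Finset.mem_insert_self _ _)).2
  have ne_zero_of_norm : ∀ {e : QuadraticAlgebra K (lineA f x y) (lineB f x y)},
      e.norm ≠ 0 → e ≠ 0 := by
    rintro e he rfl
    exact he QuadraticAlgebra.norm_zero
  have hQT₂ : ∀ v ∈ T₂,
      Q v (v.mapVec (linePoint x y (interp θ c ^ m * interp ω d ^ (m + 1)))) := fun v hv =>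
    (hp v hv).2.2 c (hc v hv).1 d ((hd v (Finset.mem_union_left _ hv)).1 hv).1
  have hp0 : linePoint x y (interp θ c ^ m * interp ω d ^ (m + 1)) ≠ 0 := by
    intro h
    have h1 := eval_linePoint hf hfx y (interp θ c ^ m * interp ω d ^ (m + 1))
    rw [h, eval_zero, map_mul, map_pow, map_pow] at h1
    exact mul_ne_zero hfx (mul_ne_zero (pow_ne_zero _ hcn) (pow_ne_zero _ hdn)) h1.symm
  refine ⟨_, hp0, fun v hv => hQT₂ v (by simp [hT₂, hv]), fun v => ?_⟩
  by_cases hv : (Sum.inl v : Place K) ∈ T₂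
  · exact hQT₂ _ hv
  · have hv' := hv
    simp only [hT₂, Finset.mem_insert, Finset.mem_union, not_or] at hv'
    obtain ⟨-, ⟨hvT, hvB⟩, hvB₁⟩ := hv'
    rw [hB₁, not_not] at hvB₁
    obtain ⟨⟨hy1, hmin, ha, hb, hdu⟩, -, hω1⟩ := hvB₁
    obtain ⟨hx1, hx2⟩ := hxgood v hvT hvB
    refine hgood v hvT _ hp0 fun α => ?_
    -- On C the second factor is the unit and the first supplies an m-th power; off C the first is
    -- the unit and the second supplies an (m + 1)-th power.
    by_cases hvC : (Sum.inl v : Place K) ∈ C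
    · have hdv := (hd _ (Finset.mem_union_right _ hvC)).2 hvC v rfl
      obtain ⟨h1, h2⟩ := interp_unit ha hb hω1 hdv
      rw [mul_comm]
      exact campana_linePoint _ hf hsq hD (hcont v hvT) hfx hx2 hx1.le hy1 hmin ha hb hdu h1 h2
        (ne_zero_of_norm hcn) le_rfl α
    · rw [hC, not_not] at hvC
      obtain ⟨h1, h2⟩ := hvC.resolve_left hv
      exact campana_linePoint _ hf hsq hD (hcont v hvT) hfx hx2 hx1.le hy1 hmin ha hb hdu h1 h2
        (ne_zero_of_norm hdn) m.le_succ α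

end Campana

/-! ### Weak approximation and existence of Campana points -/

section CampanaWeakApproximation

variable {K : Type u} [Field K] [NumberField K] {N m : ℕ} {f : MvPolynomial (Fin N) K}
  {D : OrbifoldDivisor K N}

/-- The local condition at all places, with no condition at those in `S`. -/
def localCondition (S : Finset (Place K)) (D : OrbifoldDivisor K N) (k : Kind) :
    (v : Place K) → Set (ProjPoint v.Completion N)
  | .inl v => {P | (Sum.inl v : Place K) ∉ S → P ∈ localPoints S D k v}
  | .inr _ => Set.univ

theorem eventually_mem_localCondition (S : Finset (Place K)) (D : OrbifoldDivisor K N)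
    {v : Place K} {z : Fin N → v.Completion} (hz : z ≠ 0)
    (h : Projectivization.mk v.Completion z hz ∈ localCondition S D .campana v) :
    ∀ᶠ y in 𝓝 z, ∀ hy : y ≠ 0,
      Projectivization.mk v.Completion y hy ∈ localCondition S D .campana v := by
  rcases v with v | v
  · by_cases hv : (Sum.inl v : Place K) ∈ S
    · exact Eventually.of_forall fun y hy h => absurd hv h
    · filter_upwards [eventually_mem_localPoints S D hv hz (h hv)] with y hy hy0 _
      exact hy hy0
  · exact Eventually.of_forall fun y hy => Set.mem_univ _

theorem mk_mapVec_mem_localPoints_campana (S : Finset (Place K)) (hD : D.IsHypersurface m f)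
    {v : HeightOneSpectrum (𝓞 K)} (hv : (Sum.inl v : Place K) ∉ S) {p : Fin N → K} (hp : p ≠ 0)
    (h : ∀ α, v.valuation K (MvPolynomial.eval p (D.form α)) =
          content (v.valuation K) (D.form α) * supVal (v.valuation K) p ^ D.degree α ∨
        v.valuation K (MvPolynomial.eval p (D.form α)) ≤ exp (-(m : ℤ)) *
          (content (v.valuation K) (D.form α) * supVal (v.valuation K) p ^ D.degree α)) :
    Projectivization.mk (v.adicCompletion K) (Place.mapVec (.inl v) p)
      (Place.mapVec_ne_zero (.inl v) hp) ∈ localPoints S D .campana v := by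
  intro α
  rw [hD.2 α]
  refine (campana_admissible_multiplicity_iff S (D.isHomogeneous α) (form_ne_zero D α) hv m
    (Place.mapVec_ne_zero (.inl v) hp)).2 ?_
  have h1 : Valued.v (MvPolynomial.aeval (Place.mapVec (.inl v) p) (D.form α)) =
      v.valuation K (MvPolynomial.eval p (D.form α)) := by
    rw [aeval_mapVec]
    exact valued_algebraMap v _
  have h2 : supVal Valued.v (Place.mapVec (.inl v) p) = supVal (v.valuation K) p :=
    supVal_algebraMap _ _ (valued_algebraMap v) p
  exact h1 ▸ h2 ▸ h α

/-- Since the Campana condition is open, only semi-integrality at each place is needed; being strict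
or non-strict plays no role. -/
theorem mem_closure_of_mem_locallySemiIntegral (S : Finset (Place K)) (hf : f.IsHomogeneous 2)
    (hsq : Squarefree f) (hD : D.IsHypersurface m f) {x : LocalProduct K N ∅}
    (hx : x ∈ locallySemiIntegral S ∅ D .campana) :
    x ∈ closure (diagonal ∅ '' globalPoints S D .campana) := by
  classical
  rw [mem_closure_iff]
  intro o ho hxo
  obtain ⟨I, u, hu, huo⟩ := isOpen_pi_iff.1 ho x hxo
  obtain ⟨A, hA, -⟩ := exists_finset_of_eventually (K := K)
    (eventually_all.2 fun α => eventually_content_eq_one (form_ne_zero D α))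
  let ι : (v : Place K) → {v : Place K // v ∉ (∅ : Finset (Place K))} := fun v =>
    ⟨v, Finset.notMem_empty v⟩
  let U : (v : Place K) → Set (ProjPoint v.Completion N) := fun v =>
    if ι v ∈ I then u (ι v) else Set.univ
  have hU : ∀ v, IsOpen (U v) ∧ x (ι v) ∈ U v := by
    intro v
    by_cases hv : ι v ∈ I
    · simpa only [U, if_pos hv] using hu _ hv
    · simp only [U, if_neg hv]
      exact ⟨isOpen_univ, Set.mem_univ _⟩
  obtain ⟨p, hp0, hpT, hpfin⟩ := exists_campana_approximation hf hsq hD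
    -- Besides S, the exceptional places are those with a prescribed neighbourhood and those where
    -- some component does not have content one.
    (S ∪ I.map (Function.Embedding.subtype _) ∪ A)
    (fun v y => ∃ h : y ≠ 0, Projectivization.mk v.Completion y h ∈ U v ∧
      Projectivization.mk v.Completion y h ∈ localCondition S D .campana v)
    (by
      rintro v y ⟨hy, h1, h2⟩
      filter_upwards [eventually_mk_mem (hU v).1 hy h1, eventually_mem_localCondition S D hy h2]
        with z ⟨hz0, hz⟩ hz'
      exact ⟨hz0, hz, hz' hz0⟩)
    (by
      intro v _
      refine ⟨(x (ι v)).rep, (x (ι v)).rep_nonzero, ?_⟩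
      rw [Projectivization.mk_rep]
      refine ⟨(hU v).2, ?_⟩
      rcases v with v | v
      · exact hx v _
      · exact Set.mem_univ _)
    (by
      intro v hv
      simp only [Finset.mem_union, not_or, hA, not_not] at hv
      exact hv.2)
    (by
      intro v hv p hp h
      simp only [Finset.mem_union, not_or, hA, not_not] at hv
      refine ⟨Place.mapVec_ne_zero _ hp, ?_, fun hvS => ?_⟩
      · have : ι (Sum.inl v) ∉ I := fun h => hv.1.2 (Finset.mem_map_of_mem _ h)
        simp only [U, if_neg this]
        exact Set.mem_univ _
      · refine mk_mapVec_mem_localPoints_campana S hD hvS hp fun α => ?_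
        rw [hv.2 α, one_mul]
        exact h α)
  refine ⟨diagonal ∅ (Projectivization.mk K p hp0), huo ?_, _, ?_, rfl⟩
  · rintro ⟨v, hv0⟩ hv
    obtain ⟨_, h, -⟩ := hpT v (by
      simp only [Finset.mem_union]
      exact Or.inl (Or.inr (Finset.mem_map_of_mem (Function.Embedding.subtype _) hv)))
    have hv' : ι v ∈ I := hv
    simp only [U, if_pos hv'] at h
    exact h
  · intro v hv
    obtain ⟨_, -, h⟩ := hpfin v
    exact h hv

theorem weakApproximation_campana (S : Finset (Place K)) (hf : f.IsHomogeneous 2)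
    (hsq : Squarefree f) (hD : D.IsHypersurface m f) : WeakApproximation S D .campana := by
  rintro x (hx | hx) <;> exact mem_closure_of_mem_locallySemiIntegral S hf hsq hD hx.1

/-- A locally semi-integral family exists, with multiplicity zero at every finite place outside S.
It lies in the closure of the global points, which is therefore nonempty. -/
theorem nonempty_globalPoints_campana (S : Finset (Place K)) (hf : f.IsHomogeneous 2)
    (hsq : Squarefree f) (hD : D.IsHypersurface m f) : (globalPoints S D .campana).Nonempty := by
  choose y hy0 hy using exists_unit_value hf hsq hD
  obtain ⟨v₁, -⟩ := exists_inl_notMem (∅ : Finset (Place K))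
  let x : LocalProduct K N ∅ := fun v => match v.1 with
    | .inl v => baseChange K (v.adicCompletion K) (Projectivization.mk K (y v) (hy0 v))
    | .inr v => baseChange K v.Completion (Projectivization.mk K (y v₁) (hy0 v₁))
  have hx : x ∈ locallySemiIntegral S ∅ D .campana := fun v _ hv =>
    mk_mapVec_mem_localPoints_campana S hD hv (hy0 v) fun α => Or.inl (hy v α)
  exact (closure_nonempty_iff.1
    ⟨x, mem_closure_of_mem_locallySemiIntegral S hf hsq hD hx⟩).of_image

end CampanaWeakApproximation

/-! ### Numbers with even valuations -/

section Selmer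

/-- Every nonzero element is the product of a square and a squarefree element. -/
theorem exists_sq_mul_squarefree {M : Type*} [CommMonoidWithZero M]
    [UniqueFactorizationMonoid M] {a : M} (ha : a ≠ 0) :
    ∃ b r : M, Squarefree r ∧ a = b ^ 2 * r := by
  induction a using WellFounded.induction (α := M) wellFounded_dvdNotUnit with
  | _ a ih =>
    by_cases h : Squarefree a
    · exact ⟨1, a, h, by rw [one_pow, one_mul]⟩
    · simp only [Squarefree, not_forall] at h
      obtain ⟨x, ⟨c, rfl⟩, hx⟩ := h
      have hc : c ≠ 0 := right_ne_zero_of_mul ha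
      obtain ⟨b, r, hr, hbr⟩ := ih c ⟨hc, x * x, fun h => hx (isUnit_of_mul_isUnit_left h),
        mul_comm _ _⟩ hc
      exact ⟨x * b, r, hr, by rw [hbr, mul_pow, sq x, mul_assoc (x * x)]⟩

variable {K : Type u} [Field K] [NumberField K]

/-- A prime dividing the squarefree part R divides it exactly once, so it would occur in (a) = J²R
with odd exponent. -/
theorem not_dvd_of_sq_eq_valuation {v : HeightOneSpectrum (𝓞 K)} {a : 𝓞 K} (ha : a ≠ 0)
    {J R : Ideal (𝓞 K)} (hR : Squarefree R) (h : Ideal.span {a} = J ^ 2 * R) {γ : ℤᵐ⁰}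
    (hγ : v.intValuation a = γ ^ 2) : ¬ v.asIdeal ∣ R := by
  intro hv
  have ha' : Ideal.span {a} ≠ 0 := by simpa using ha
  have hR0 : R ≠ 0 := right_ne_zero_of_mul (h ▸ ha')
  have hJ0 : J ≠ 0 := by
    rintro rfl
    rw [zero_pow two_ne_zero, zero_mul] at h
    exact ha' h
  have hfin : FiniteMultiplicity v.asIdeal J :=
    FiniteMultiplicity.of_prime_left v.prime hJ0
  have h1 : emultiplicity v.asIdeal R = 1 := by
    refine le_antisymm ?_ ?_
    · exact ((squarefree_iff_emultiplicity_le_one R).1 hR _).resolve_right v.prime.not_isUnit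
    · exact_mod_cast le_emultiplicity_of_pow_dvd (k := 1) (by rwa [pow_one])
  have h2 : emultiplicity v.asIdeal (Ideal.span {a}) =
      ((2 * multiplicity v.asIdeal J + 1 : ℕ) : ℕ∞) := by
    rw [h, emultiplicity_mul v.prime, emultiplicity_pow v.prime, h1,
      hfin.emultiplicity_eq_multiplicity]
    push_cast
    rfl
  have h3 : v.intValuation a = exp (-((2 * multiplicity v.asIdeal J + 1 : ℕ) : ℤ)) :=
    le_antisymm (v.intValuation_le_exp_iff_le_emultiplicity.2 h2.ge)
      (v.exp_le_intValuation_iff_emultiplicity_le.2 h2.le)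
  have hγ0 : γ ≠ 0 := by
    rintro rfl
    rw [zero_pow two_ne_zero, h3] at hγ
    exact exp_ne_zero hγ
  rw [h3, ← exp_log hγ0, ← exp_nsmul, exp_inj, nsmul_eq_mul] at hγ
  push_cast at hγ
  omega

/-- A squarefree ideal is the product of the set of its prime factors, here a subset of a finite
set. -/
theorem finite_setOf_squarefree {R : Type*} [CommRing R] [IsDedekindDomain R]
    {s : Set (HeightOneSpectrum R)} (hs : s.Finite) :
    {I : Ideal R | Squarefree I ∧ ∀ v : HeightOneSpectrum R, v.asIdeal ∣ I → v ∈ s}.Finite := by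
  classical
  set P : Finset (Ideal R) := hs.toFinset.image HeightOneSpectrum.asIdeal
  refine (P.powerset.image fun t => t.prod id).finite_toSet.subset ?_
  rintro I ⟨hI, hIs⟩
  have hI0 : I ≠ 0 := hI.ne_zero
  have hnd := (UniqueFactorizationMonoid.squarefree_iff_nodup_normalizedFactors hI0).1 hI
  simp only [Finset.coe_image, Set.mem_image, Finset.mem_coe, Finset.mem_powerset]
  refine ⟨⟨_, hnd⟩, fun p hp => ?_, ?_⟩
  · have hp' : p ∈ UniqueFactorizationMonoid.normalizedFactors I := hp
    have hpp := UniqueFactorizationMonoid.prime_of_normalized_factor p hp'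
    let v : HeightOneSpectrum R := ⟨p, Ideal.isPrime_of_prime hpp, hpp.ne_zero⟩
    exact Finset.mem_image.2 ⟨v, hs.mem_toFinset.2
      (hIs v (UniqueFactorizationMonoid.dvd_of_mem_normalizedFactors hp')), rfl⟩
  · change (Multiset.map id _).prod = I
    rw [Multiset.map_id]
    exact associated_iff_eq.1 (UniqueFactorizationMonoid.prod_normalizedFactors hI0)

/-- A finitely generated commutative group is finite modulo squares. -/
theorem exists_finset_units_mod_squares (G : Type*) [CommGroup G] [Group.FG G] :
    ∃ E : Finset G, ∀ u : G, ∃ ε ∈ E, ∃ t : G, u = ε * t ^ 2 := by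
  classical
  -- The quotient is finitely generated and killed by 2, hence finite.
  have hfin : Finite (G ⧸ (powMonoidHom 2 : G →* G).range) := by
    refine CommGroup.finite_of_fg_isMulTorsion (G := G ⧸ (powMonoidHom 2 : G →* G).range) ?_
    intro g
    obtain ⟨u, rfl⟩ := QuotientGroup.mk_surjective g
    refine isOfFinOrder_iff_pow_eq_one.2 ⟨2, two_pos, ?_⟩
    rw [← QuotientGroup.mk_pow]
    exact (QuotientGroup.eq_one_iff _).2 ⟨u, rfl⟩
  cases nonempty_fintype (G ⧸ (powMonoidHom 2 : G →* G).range)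
  refine ⟨Finset.univ.image Quotient.out, fun u => ⟨
    Quotient.out (QuotientGroup.mk u : G ⧸ (powMonoidHom 2 : G →* G).range),
    Finset.mem_image_of_mem _ (Finset.mem_univ _), ?_⟩⟩
  obtain ⟨⟨g, hg⟩, ht⟩ := QuotientGroup.mk_out_eq_mul (powMonoidHom 2 : G →* G).range u
  obtain ⟨t, ht'⟩ := MonoidHom.mem_range.1 hg
  refine ⟨t⁻¹, ?_⟩
  rw [ht]
  change u = u * g * t⁻¹ ^ 2
  rw [← ht', powMonoidHom_apply, inv_pow, mul_inv_cancel_right]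

/-- The elements all of whose valuations outside a finite set are even form finitely many classes
modulo squares. -/
theorem exists_finset_even_valuation {s : Set (HeightOneSpectrum (𝓞 K))} (hs : s.Finite) :
    ∃ E : Finset K, (∀ ε ∈ E, ε ≠ 0) ∧ ∀ a : K, a ≠ 0 →
      (∀ v ∉ s, ∃ γ : ℤᵐ⁰, v.valuation K a = γ ^ 2) → ∃ ε ∈ E, ∃ t : K, t ≠ 0 ∧ a = ε * t ^ 2 := by
  classical
  have : Group.FG (𝓞 K)ˣ := Group.fg_iff_monoid_fg.2 inferInstance
  obtain ⟨U, hU⟩ := exists_finset_units_mod_squares (𝓞 K)ˣ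
  let A : Set (𝓞 K) := {a | a ≠ 0 ∧ ∀ v ∉ s, ∃ γ : ℤᵐ⁰, v.intValuation a = γ ^ 2}
  have hJR : ∀ a : A, ∃ (J R : Ideal (𝓞 K)) (_ : J ≠ 0),
      R ∈ {I : Ideal (𝓞 K) | Squarefree I ∧ ∀ v : HeightOneSpectrum (𝓞 K), v.asIdeal ∣ I → v ∈ s} ∧
        Ideal.span {a.1} = J ^ 2 * R := by
    rintro ⟨a, ha, hav⟩
    have ha' : Ideal.span {a} ≠ 0 := by simpa using ha
    obtain ⟨J, R, hR, h⟩ := exists_sq_mul_squarefree ha'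
    refine ⟨J, R, ?_, ⟨hR, fun v hv => ?_⟩, h⟩
    · rintro rfl
      rw [zero_pow two_ne_zero, zero_mul] at h
      exact ha' h
    · by_contra hvs
      obtain ⟨γ, hγ⟩ := hav v hvs
      exact not_dvd_of_sq_eq_valuation ha hR h hγ hv
  choose J R hJ hR hJR using hJR
  -- The invariant of a with (a) = J²R is the pair (R, class of J). It takes finitely many values
  -- and determines a up to units and squares.
  let φ : A → {I : Ideal (𝓞 K) | Squarefree I ∧
      ∀ v : HeightOneSpectrum (𝓞 K), v.asIdeal ∣ I → v ∈ s} × ClassGroup (𝓞 K) :=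
    fun a => (⟨R a, hR a⟩, ClassGroup.mk0 ⟨J a, mem_nonZeroDivisors_of_ne_zero (hJ a)⟩)
  have hkey : ∀ a b : A, φ a = φ b → ∃ (u : (𝓞 K)ˣ) (x y : 𝓞 K), x ≠ 0 ∧ y ≠ 0 ∧
      a.1 * x ^ 2 = u * b.1 * y ^ 2 := by
    intro a b hab
    simp only [φ, Prod.mk.injEq, Subtype.mk.injEq] at hab
    obtain ⟨h1, h2⟩ := hab
    obtain ⟨x, y, hx, hy, hxy⟩ := ClassGroup.mk0_eq_mk0_iff.1 h2
    have h3 : Ideal.span {a.1 * x ^ 2} = Ideal.span {b.1 * y ^ 2} := by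
      rw [← Ideal.span_singleton_mul_span_singleton, ← Ideal.span_singleton_mul_span_singleton,
        ← Ideal.span_singleton_pow, ← Ideal.span_singleton_pow, hJR, hJR, h1, mul_right_comm,
        ← mul_pow, mul_right_comm, ← mul_pow, mul_comm (J a), mul_comm (J b)]
      exact congrArg (fun I => I ^ 2 * R b) hxy
    obtain ⟨u, hu⟩ := Ideal.span_singleton_eq_span_singleton.1 h3.symm
    exact ⟨u, x, y, hx, hy, by rw [← hu]; ring⟩
  have : Finite {I : Ideal (𝓞 K) | Squarefree I ∧
      ∀ v : HeightOneSpectrum (𝓞 K), v.asIdeal ∣ I → v ∈ s} := finite_setOf_squarefree hs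
  obtain ⟨B, hBA⟩ : ∃ B : Finset A, ∀ a, ∃ b ∈ B, φ a = φ b := by
    cases nonempty_fintype (Set.range φ)
    choose g hg using fun c : Set.range φ => c.2
    exact ⟨Finset.univ.image g, fun a => ⟨_, Finset.mem_image_of_mem _ (Finset.mem_univ
      ⟨φ a, a, rfl⟩), (hg ⟨φ a, a, rfl⟩).symm⟩⟩
  refine ⟨(U ×ˢ B).image fun p => ((p.1 : 𝓞 K) : K) * ((p.2.1 : 𝓞 K) : K), ?_, ?_⟩
  · simp only [Finset.mem_image, forall_exists_index, and_imp]
    rintro _ ⟨u, b⟩ - rfl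
    exact mul_ne_zero (by simp) (by simpa using b.2.1)
  · intro a ha hav
    obtain ⟨x, y, hy, rfl⟩ := IsFractionRing.div_surjective (A := 𝓞 K) a
    have hy0 : y ≠ 0 := nonZeroDivisors.ne_zero hy
    have hyK : (algebraMap (𝓞 K) K y) ≠ 0 := by simpa using hy0
    have hx0 : x ≠ 0 := by
      rintro rfl
      simp at ha
    -- The fraction x/y is replaced by the integer xy, which differs from it by the square y².
    obtain ⟨b, hb, hab⟩ := hBA ⟨x * y, mul_ne_zero hx0 hy0, fun v hv => by
      obtain ⟨γ, hγ⟩ := hav v hv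
      refine ⟨γ * v.valuation K (algebraMap (𝓞 K) K y), ?_⟩
      rw [← v.valuation_of_algebraMap (K := K), mul_pow, ← hγ, ← map_pow, ← map_mul]
      congr 1
      change algebraMap (𝓞 K) K (x * y) = _
      rw [map_mul]
      field_simp⟩
    obtain ⟨u, p, q, hp, hq, h⟩ := hkey _ _ hab
    obtain ⟨ε, hε, t, rfl⟩ := hU u
    have hpK : (algebraMap (𝓞 K) K p) ≠ 0 := by simpa using hp
    refine ⟨_, Finset.mem_image_of_mem _ (Finset.mk_mem_product hε hb),
      algebraMap (𝓞 K) K (t * q) / algebraMap (𝓞 K) K (p * y), ?_, ?_⟩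
    · refine div_ne_zero ?_ ?_ <;> simp [hp, hq, hy0]
    · have h' := congrArg (algebraMap (𝓞 K) K) h
      simp only [map_mul, map_pow, Units.val_mul, Units.val_pow_eq_pow_val] at h' ⊢
      field_simp
      linear_combination h'

end Selmer

/-! ### Binary quadratic forms over residue fields -/

section Residue

open Polynomial in
/-- A nondegenerate binary quadratic form over a finite field of odd characteristic represents all
elements. -/
theorem exists_eq_binary_form {k : Type*} [Field k] [Finite k] (h2 : (2 : k) ≠ 0) {a b c : k}
    (ha : a ≠ 0) (hdisc : b ^ 2 - 4 * a * c ≠ 0) (u : k) :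
    ∃ s t : k, a * s ^ 2 + b * s * t + c * t ^ 2 = u := by
  cases nonempty_fintype k
  have hchar : ringChar k ≠ 2 := by
    intro h
    have := ringChar.Nat.cast_ringChar (R := k)
    rw [h] at this
    exact h2 (by exact_mod_cast this)
  have h4 : 4 * a ≠ 0 := by
    have : (4 : k) = 2 * 2 := by norm_num
    rw [this]
    exact mul_ne_zero (mul_ne_zero h2 h2) ha
  -- Completing the square gives the diagonal form a·s² − disc/(4a)·t², to which the counting
  -- argument for sums of two quadratic polynomials applies.
  have hc : -(b ^ 2 - 4 * a * c) / (4 * a) ≠ 0 := div_ne_zero (neg_ne_zero.2 hdisc) h4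
  obtain ⟨s, t, hst⟩ := FiniteField.exists_root_sum_quadratic
    (f := C a * X ^ 2 + C 0 * X + C 0)
    (g := C (-(b ^ 2 - 4 * a * c) / (4 * a)) * X ^ 2 + C 0 * X + C (-u))
    (degree_quadratic ha) (degree_quadratic hc) (FiniteField.odd_card_of_char_ne_two hchar)
  refine ⟨s - b / (2 * a) * t, t, ?_⟩
  simp only [eval_add, eval_mul, eval_C, eval_pow, eval_X, zero_mul, add_zero] at hst
  have h3 : a * (s - b / (2 * a) * t) ^ 2 + b * (s - b / (2 * a) * t) * t + c * t ^ 2 =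
      a * s ^ 2 + -(b ^ 2 - 4 * a * c) / (4 * a) * t ^ 2 := by
    have h5 : (2 * a) ≠ 0 := mul_ne_zero h2 ha
    have h6 : (4 * a) = 2 * (2 * a) := by ring
    rw [h6]
    field_simp
    ring
  rw [h3]
  linear_combination hst

theorem residue_eq_zero_iff {K : Type*} [Field K] {w : Valuation K ℤᵐ⁰} (x : w.valuationSubring) :
    IsLocalRing.residue w.valuationSubring x = 0 ↔ w (x : K) < 1 := by
  rw [IsLocalRing.residue_eq_zero_iff, Valuation.mem_maximalIdeal_iff]

variable {K : Type u} [Field K] [NumberField K] (v : HeightOneSpectrum (𝓞 K))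

instance finite_residueField :
    Finite (IsLocalRing.ResidueField (v.valuation K).valuationSubring) := by
  let g : 𝓞 K →+* (v.valuation K).valuationSubring :=
    (algebraMap (𝓞 K) K).codRestrict _ fun r => v.valuation_le_one r
  have hfin : Finite (𝓞 K ⧸ v.asIdeal) := v.asIdeal.finiteQuotientOfFreeOfNeBot v.ne_bot
  refine Finite.of_surjective (Ideal.Quotient.lift v.asIdeal
    ((IsLocalRing.residue _).comp g) fun r hr => ?_) fun z => ?_
  · exact (residue_eq_zero_iff _).2 ((v.valuation_lt_one_iff_mem (K := K) r).2 hr)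
  · obtain ⟨x, rfl⟩ := IsLocalRing.residue_surjective z
    obtain ⟨r, hr⟩ := v.exists_valuation_sub_lt_of_integer x.2 1
    refine ⟨Ideal.Quotient.mk _ r, ?_⟩
    rw [Ideal.Quotient.lift_mk, RingHom.comp_apply, ← sub_eq_zero, ← map_sub, residue_eq_zero_iff]
    exact hr

/-- A binary quadratic form which is nondegenerate modulo `v` takes a value that is a unit and is
not congruent to `ε` times a square. -/
theorem exists_binary_form_nonsquare (h2 : v.valuation K 2 = 1) {A B C ε : K}
    (hA : v.valuation K A = 1) (hB : v.valuation K B ≤ 1) (hC : v.valuation K C ≤ 1)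
    (hdisc : v.valuation K (B ^ 2 - 4 * A * C) = 1) (hε : v.valuation K ε = 1) :
    ∃ s t : K, v.valuation K s ≤ 1 ∧ v.valuation K t ≤ 1 ∧
      v.valuation K (A * s ^ 2 + B * s * t + C * t ^ 2) = 1 ∧
      ∀ r : K, ¬ v.valuation K (A * s ^ 2 + B * s * t + C * t ^ 2 - ε * r ^ 2) < 1 := by
  set w := v.valuation K
  let O := w.valuationSubring
  let A' : O := ⟨A, hA.le⟩
  let B' : O := ⟨B, hB⟩
  let C' : O := ⟨C, hC⟩
  let ε' : O := ⟨ε, hε.le⟩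
  have hne : ∀ x : O, w (x : K) = 1 → IsLocalRing.residue O x ≠ 0 := fun x hx h => by
    rw [residue_eq_zero_iff, hx] at h
    exact lt_irrefl _ h
  have h2' : (2 : IsLocalRing.ResidueField O) ≠ 0 := by
    have := hne 2 h2
    rwa [map_ofNat] at this
  have hchar : ringChar (IsLocalRing.ResidueField O) ≠ 2 := by
    intro h
    have := ringChar.Nat.cast_ringChar (R := IsLocalRing.ResidueField O)
    rw [h] at this
    exact h2' (by exact_mod_cast this)
  obtain ⟨η, hη⟩ := FiniteField.exists_nonsquare hchar
  have hη0 : η ≠ 0 := by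
    rintro rfl
    exact hη (IsSquare.zero)
  have hε0 := hne ε' hε
  -- The form represents ε times a nonsquare η of the residue field; a congruence with ε·r² would
  -- make η a square.
  obtain ⟨s', t', hst⟩ := exists_eq_binary_form h2' (hne A' hA)
    (b := IsLocalRing.residue O B') (c := IsLocalRing.residue O C') (by
      have := hne (B' ^ 2 - 4 * A' * C') hdisc
      simpa only [map_sub, map_pow, map_mul, map_ofNat] using this)
    (IsLocalRing.residue O ε' * η)
  obtain ⟨s, rfl⟩ := IsLocalRing.residue_surjective s'
  obtain ⟨t, rfl⟩ := IsLocalRing.residue_surjective t'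
  simp only [← map_mul, ← map_add, ← map_pow] at hst
  have h1 : w ((A' * s ^ 2 + B' * s * t + C' * t ^ 2 : O) : K) = 1 := by
    refine le_antisymm (A' * s ^ 2 + B' * s * t + C' * t ^ 2 : O).2 (not_lt.1 fun h => ?_)
    rw [← residue_eq_zero_iff, hst] at h
    exact mul_ne_zero hε0 hη0 h
  refine ⟨s, t, s.2, t.2, h1, fun r hr => ?_⟩
  change w (((A' * s ^ 2 + B' * s * t + C' * t ^ 2 : O) : K) - ε * r ^ 2) < 1 at hr
  -- The congruence forces ε·r² to be a unit, so r reduces to an element of the residue field.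
  have hr1 : w r ≤ 1 := by
    have h3 : w (ε * r ^ 2) = 1 := by
      rw [← h1]
      refine Valuation.map_eq_of_sub_lt _ ?_
      rwa [h1, Valuation.map_sub_swap]
    rw [map_mul, hε, one_mul, map_pow] at h3
    exact ((pow_eq_one_iff_of_nonneg zero_le two_ne_zero).1 h3).le
  let r' : O := ⟨r, hr1⟩
  have h4 : IsLocalRing.residue O (A' * s ^ 2 + B' * s * t + C' * t ^ 2 - ε' * r' ^ 2) = 0 :=
    (residue_eq_zero_iff _).2 hr
  rw [map_sub, hst, map_mul, ← mul_sub, mul_eq_zero, or_iff_right hε0, sub_eq_zero, map_pow] at h4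
  exact hη ⟨_, h4.trans (sq _)⟩

end Residue

/-! ### Darmon points -/

section Darmon

variable {K : Type u} [Field K] [NumberField K] {N m : ℕ} {f : MvPolynomial (Fin N) K}
  {D : OrbifoldDivisor K N} {v : HeightOneSpectrum (𝓞 K)}

theorem intersectionMultiplicity_eq_natCast_iff (S : Finset (Place K))
    {F : MvPolynomial (Fin N) K} {d : ℕ} (hd : F.IsHomogeneous d) (hF : F ≠ 0)
    (hv : (Sum.inl v : Place K) ∉ S) {z : Fin N → v.adicCompletion K} (hz : z ≠ 0) (n : ℕ) :
    intersectionMultiplicity S F v (Projectivization.mk _ z hz) = n ↔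
      Valued.v (MvPolynomial.aeval z F) =
        exp (-(n : ℤ)) * (content (v.valuation K) F * supVal Valued.v z ^ d) := by
  have h1 : intersectionMultiplicity S F v (Projectivization.mk _ z hz) = n ↔
      (n : ℕ∞) ≤ intersectionMultiplicity S F v (Projectivization.mk _ z hz) ∧
      ¬ ((n + 1 : ℕ) : ℕ∞) ≤ intersectionMultiplicity S F v (Projectivization.mk _ z hz) := by
    generalize intersectionMultiplicity S F v (Projectivization.mk _ z hz) = k
    induction k with
    | top => simp
    | coe k =>
      norm_cast
      omega
  rw [h1, natCast_le_intersectionMultiplicity_iff S hd hF hv,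
    natCast_le_intersectionMultiplicity_iff S hd hF hv, mul_assoc, mul_assoc]
  have hc0 : content (v.valuation K) F * supVal Valued.v z ^ d ≠ 0 :=
    mul_ne_zero (content_ne_zero _ hF) (pow_ne_zero _ fun h => hz ((supVal_eq_zero_iff _).1 h))
  generalize content (v.valuation K) F * supVal Valued.v z ^ d = c at hc0
  generalize Valued.v (MvPolynomial.aeval z F) = x
  by_cases hx : x = 0
  · subst hx
    simp [hc0]
  rw [← exp_log hx, ← exp_log hc0, ← exp_add, ← exp_add, exp_le_exp, exp_le_exp, exp_inj]
  push_cast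
  omega

theorem intersectionMultiplicity_ne_top (S : Finset (Place K))
    {F : MvPolynomial (Fin N) K} {d : ℕ} (hd : F.IsHomogeneous d)
    (hv : (Sum.inl v : Place K) ∉ S) {z : Fin N → v.adicCompletion K} (hz : z ≠ 0)
    (hFz : MvPolynomial.aeval z F ≠ 0) :
    intersectionMultiplicity S F v (Projectivization.mk _ z hz) ≠ ⊤ := by
  have hF : F ≠ 0 := by
    rintro rfl
    exact hFz (map_zero _)
  intro h
  have hc0 : content (v.valuation K) F * supVal Valued.v z ^ d ≠ 0 :=
    mul_ne_zero (content_ne_zero _ hF) (pow_ne_zero _ fun h => hz ((supVal_eq_zero_iff _).1 h))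
  have hx : Valued.v (MvPolynomial.aeval z F) ≠ 0 := (Valuation.ne_zero_iff _).2 hFz
  have h1 := fun k : ℕ => (natCast_le_intersectionMultiplicity_iff S hd hF hv hz k).1 (h ▸ le_top)
  simp only [mul_assoc] at h1
  revert h1 hc0 hx
  generalize content (v.valuation K) F * supVal Valued.v z ^ d = c
  generalize Valued.v (MvPolynomial.aeval z F) = x
  intro hc0 hx h1
  -- One more than the actual gap between the bound and the value, so that the inequality fails.
  have h2 := h1 (log c - log x + 1).toNat
  rw [← exp_log hx, ← exp_log hc0, ← exp_add, exp_le_exp, log_exp, log_exp] at h2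
  omega

/-- For even `m` the quadratic form takes values of even valuation at the Darmon points. -/
theorem exists_valuation_eq_sq_of_mem_globalPoints_darmon (S : Finset (Place K)) (hm : Even m)
    (hf : f.IsHomogeneous 2) (hsq : Squarefree f) (hD : D.IsHypersurface m f) {p : Fin N → K}
    (hp : p ≠ 0) (h : Projectivization.mk K p hp ∈ globalPoints S D .darmon)
    (hfp : MvPolynomial.eval p f ≠ 0) (hv : (Sum.inl v : Place K) ∉ S)
    (hcont : ∀ α, content (v.valuation K) (D.form α) = 1) :
    ∃ γ : ℤᵐ⁰, v.valuation K (MvPolynomial.eval p f) = γ ^ 2 := by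
  obtain ⟨l, rfl⟩ := hm
  have hp' := Place.mapVec_ne_zero (.inl v) hp
  have key : ∀ α, ∃ j : ℕ, v.valuation K (MvPolynomial.eval p (D.form α)) =
      exp (-(l * j : ℤ)) ^ 2 * supVal (v.valuation K) p ^ D.degree α := by
    intro α
    have hα := eval_form_ne_zero hD hfp α
    have h1 : MvPolynomial.aeval (Place.mapVec (.inl v) p) (D.form α) =
        algebraMap K (v.adicCompletion K) (MvPolynomial.eval p (D.form α)) := aeval_mapVec _ _ _
    have h0 : MvPolynomial.aeval (Place.mapVec (.inl v) p) (D.form α) ≠ 0 := by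
      rw [h1]
      exact (map_ne_zero_iff _ (algebraMap K _).injective).2 hα
    have h2 := h v hv α
    rw [hD.2 α] at h2
    obtain ⟨j, hj⟩ := h2.resolve_left
      (intersectionMultiplicity_ne_top S (D.isHomogeneous α) hv hp' h0)
    have h3 := (intersectionMultiplicity_eq_natCast_iff S (D.isHomogeneous α) (form_ne_zero D α)
      hv hp' _).1 hj
    have h4 : supVal Valued.v (Place.mapVec (.inl v) p) = supVal (v.valuation K) p :=
      supVal_algebraMap _ _ (valued_algebraMap v) p
    refine ⟨j, ?_⟩
    have h5 := valued_algebraMap v (MvPolynomial.eval p (D.form α))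
    rw [← h5, ← h1, ← exp_nsmul]
    refine h3.trans ?_
    rw [h4, hcont α, one_mul]
    congr 2
    push_cast
    rw [nsmul_eq_mul]
    push_cast
    ring
  choose j hj using key
  -- The component values are even powers times powers of the sup-norm, whose exponents add up to 2;
  -- hence the product is a square even when the components are linear.
  have hdeg : ∑ α, D.degree α = 2 := by
    have h1 : f.IsHomogeneous (∑ α, D.degree α) := by
      rw [← hD.1]
      exact MvPolynomial.IsHomogeneous.prod _ _ _ fun α _ => D.isHomogeneous α
    exact h1.inj_right hf hsq.ne_zero
  refine ⟨(∏ α, exp (-(l * j α : ℤ))) * supVal (v.valuation K) p, ?_⟩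
  rw [eval_eq_prod hD, map_prod, mul_pow, ← Finset.prod_pow]
  simp only [hj]
  rw [Finset.prod_mul_distrib, Finset.prod_pow_eq_pow_sum, hdeg]

end Darmon

/-! ### Failure of weak weak approximation for Darmon points -/

section DarmonObstruction

theorem onHypersurface_mk {K L : Type u} {N : ℕ} [Field K] [Field L] [Algebra K L]
    {F : MvPolynomial (Fin N) K} {d : ℕ} (hF : F.IsHomogeneous d) {z : Fin N → L} (hz : z ≠ 0) :
    OnHypersurface F (Projectivization.mk L z hz) ↔ MvPolynomial.aeval z F = 0 := by
  obtain ⟨a, ha⟩ := Projectivization.exists_smul_eq_mk_rep L z hz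
  rw [OnHypersurface, ← ha, Units.smul_def, aeval_smul_of_isHomogeneous hF, mul_eq_zero,
    or_iff_right (pow_ne_zero _ a.ne_zero)]

variable {K : Type u} [Field K] [NumberField K] {N m : ℕ} {f : MvPolynomial (Fin N) K}
  {D : OrbifoldDivisor K N}

theorem intersectionMultiplicity_mapVec_eq_zero (S : Finset (Place K))
    {v : HeightOneSpectrum (𝓞 K)} (hv : (Sum.inl v : Place K) ∉ S) {p : Fin N → K} (hp : p ≠ 0)
    {α} (h : v.valuation K (MvPolynomial.eval p (D.form α)) =
      content (v.valuation K) (D.form α) * supVal (v.valuation K) p ^ D.degree α) :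
    intersectionMultiplicity S (D.form α) v
      (Projectivization.mk (v.adicCompletion K) (Place.mapVec (.inl v) p)
        (Place.mapVec_ne_zero (.inl v) hp)) = 0 := by
  rw [← Nat.cast_zero]
  refine (intersectionMultiplicity_eq_natCast_iff S (D.isHomogeneous α) (form_ne_zero D α) hv
    (Place.mapVec_ne_zero (.inl v) hp) 0).2 ?_
  have h1 : Valued.v (MvPolynomial.aeval (Place.mapVec (.inl v) p) (D.form α)) =
      v.valuation K (MvPolynomial.eval p (D.form α)) := by
    rw [aeval_mapVec]
    exact valued_algebraMap v _
  have h2 : supVal Valued.v (Place.mapVec (.inl v) p) = supVal (v.valuation K) p :=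
    supVal_algebraMap _ _ (valued_algebraMap v) p
  rw [h2, Nat.cast_zero, neg_zero, exp_zero, one_mul]
  exact h1.trans h

/-- A family of `K`-points gives a strict adelic Darmon point if it misses the divisor and has
multiplicity zero at all finite places. -/
theorem mem_strictAdelicPoints_darmon (S T : Finset (Place K)) (p : Place K → Fin N → K)
    (hp : ∀ v, p v ≠ 0) (hfp : ∀ v α, MvPolynomial.eval (p v) (D.form α) ≠ 0)
    (h : ∀ (v : HeightOneSpectrum (𝓞 K)) α,
      v.valuation K (MvPolynomial.eval (p (.inl v)) (D.form α)) =
        content (v.valuation K) (D.form α) * supVal (v.valuation K) (p (.inl v)) ^ D.degree α) :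
    (fun v => Projectivization.mk _ (v.1.mapVec (p v.1)) (v.1.mapVec_ne_zero (hp v.1)) :
      LocalProduct K N T) ∈ strictAdelicPoints S T D .darmon := by
  have h0 : ∀ (v : HeightOneSpectrum (𝓞 K)), (Sum.inl v : Place K) ∉ S → ∀ α,
      intersectionMultiplicity S (D.form α) v
        (Projectivization.mk (v.adicCompletion K) (Place.mapVec (.inl v) (p (.inl v)))
          (Place.mapVec_ne_zero (.inl v) (hp (.inl v)))) = 0 := fun v hv α =>
    intersectionMultiplicity_mapVec_eq_zero S hv (hp _) (h v α)
  refine ⟨fun v _ hv α => Or.inr ⟨0, ?_⟩, fun v α => ?_, ?_⟩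
  · rw [mul_zero, Nat.cast_zero]
    exact h0 v hv α
  · rw [onHypersurface_mk (D.isHomogeneous α), aeval_mapVec]
    exact (map_ne_zero_iff _ (algebraMap K v.1.Completion).injective).2 (hfp v.1 α)
  · convert Set.finite_empty
    refine Set.eq_empty_of_forall_notMem ?_
    rintro v ⟨hv, _, hv'⟩
    exact hv' (h0 v hv)

/-- At almost all places, and for each unit `ε`, there is a point of multiplicity zero at which the
quadratic form is not congruent to `ε` times a square. -/
theorem eventually_exists_nonsquare_value (hf : f.IsHomogeneous 2) (hsq : Squarefree f)
    {ε : K} (hε : ε ≠ 0) : ∀ᶠ v : HeightOneSpectrum (𝓞 K) in cofinite,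
      ∃ x : Fin N → K, supVal (v.valuation K) x ≤ 1 ∧ v.valuation K (MvPolynomial.eval x f) = 1 ∧
        ∀ r : K, ¬ v.valuation K (MvPolynomial.eval x f - ε * r ^ 2) < 1 := by
  obtain ⟨x, hx⟩ : ∃ x, MvPolynomial.eval x f ≠ 0 := by
    by_contra! h
    exact hsq.ne_zero (MvPolynomial.funext fun y => by rw [h y, map_zero])
  obtain ⟨y, -, hxy⟩ := exists_eval_ne_zero_lineDisc_ne_zero hf hsq hx
  filter_upwards [eventually_supVal_le_one x, eventually_supVal_le_one y,
    eventually_valuation_eq_one hx, eventually_valuation_le_one (polarForm f x y),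
    eventually_valuation_le_one (MvPolynomial.eval y f), eventually_valuation_eq_one hxy,
    eventually_valuation_eq_one hε, eventually_valuation_eq_one (two_ne_zero (α := K))]
    with v h1 h2 h3 h4 h5 h6 h7 h8
  obtain ⟨s, t, hs, ht, hst, h⟩ := exists_binary_form_nonsquare v h8 h3 h4 h5 h6 h7
  have heval : MvPolynomial.eval (s • x + t • y) f = MvPolynomial.eval x f * s ^ 2 +
      polarForm f x y * s * t + MvPolynomial.eval y f * t ^ 2 := by
    rw [eval_smul_add_smul hf]
    ring
  refine ⟨s • x + t • y, ?_, heval ▸ hst, heval ▸ h⟩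
  refine (supVal_add_le _ _ _).trans (max_le ?_ ?_) <;> rw [supVal_smul]
  · exact mul_le_one' hs h1
  · exact mul_le_one' ht h2

/-- If f takes a unit value at an integral vector, each component does so too, and the vector must
be primitive. -/
theorem valuation_form_eq_of_valuation_eq_one (hD : D.IsHypersurface m f)
    {v : HeightOneSpectrum (𝓞 K)} (hcont : ∀ α, content (v.valuation K) (D.form α) = 1)
    {x : Fin N → K} (hx : supVal (v.valuation K) x ≤ 1)
    (hfx : v.valuation K (MvPolynomial.eval x f) = 1) (α) :
    v.valuation K (MvPolynomial.eval x (D.form α)) =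
      content (v.valuation K) (D.form α) * supVal (v.valuation K) x ^ D.degree α := by
  have hle : ∀ β, v.valuation K (MvPolynomial.eval x (D.form β)) ≤
      supVal (v.valuation K) x ^ D.degree β := by
    intro β
    have h := map_aeval_le (v.valuation K) (v.valuation K) (fun _ => rfl) x (D.isHomogeneous β)
    rwa [MvPolynomial.aeval_eq_eval, hcont, one_mul] at h
  rw [eval_eq_prod hD, map_prod] at hfx
  have h1 := eq_one_of_prod_eq_one (fun β => (hle β).trans (pow_le_one₀ zero_le hx)) hfx α
  rw [h1, hcont, one_mul]
  exact le_antisymm (h1 ▸ hle α) (pow_le_one₀ zero_le hx)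

theorem isOpen_setOf_valued_sub_lt_one {v : HeightOneSpectrum (𝓞 K)} (a : v.adicCompletion K) :
    IsOpen {c : v.adicCompletion K | Valued.v (c - a) < 1} := by
  rw [isOpen_iff_eventually]
  intro c hc
  filter_upwards [eventually_valued_sub_lt c one_ne_zero] with c' hc'
  rw [Set.mem_ofPred_eq] at hc
  have := Valuation.map_add_lt Valued.v hc' hc
  rwa [sub_add_sub_cancel] at this

/-- A point `x` as in `eventually_exists_nonsquare_value` has a neighbourhood which contains no
`K`-points at which the form takes a value in `ε * K ^ 2`. -/
theorem exists_isOpen_forall_ne_mul_sq (hf : f.IsHomogeneous 2) {v : HeightOneSpectrum (𝓞 K)}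
    {ε : K} (hε : v.valuation K ε = 1) {x : Fin N → K} (hx0 : x ≠ 0)
    (hfx : v.valuation K (MvPolynomial.eval x f) = 1)
    (hns : ∀ r : K, ¬ v.valuation K (MvPolynomial.eval x f - ε * r ^ 2) < 1) :
    ∃ W : Set (ProjPoint (v.adicCompletion K) N), IsOpen W ∧
      Projectivization.mk (v.adicCompletion K) (Place.mapVec (.inl v) x)
        (Place.mapVec_ne_zero (.inl v) hx0) ∈ W ∧
      ∀ (p : Fin N → K) (hp : p ≠ 0), Projectivization.mk (v.adicCompletion K)
        (Place.mapVec (.inl v) p) (Place.mapVec_ne_zero (.inl v) hp) ∈ W →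
        ∀ r : K, MvPolynomial.eval p f ≠ ε * r ^ 2 := by
  let L := v.adicCompletion K
  -- The required open set consists of the points with some coordinate vector in V. Rescaling such a
  -- vector changes f by a square, which does not affect the class modulo squares.
  let V : Set (Fin N → L) := {z | Valued.v (MvPolynomial.aeval z f -
    algebraMap K L (MvPolynomial.eval x f)) < 1}
  have hV : IsOpen V :=
    (isOpen_setOf_valued_sub_lt_one (algebraMap K L _)).preimage (continuous_aeval (L := L) f)
  refine ⟨_, isOpen_setOf_exists_mk (L := L) hV, ⟨Place.mapVec (.inl v) x, ?_, _, rfl⟩, ?_⟩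
  · rw [Set.mem_ofPred_eq]
    have h1 : MvPolynomial.aeval (Place.mapVec (.inl v) x) f =
        algebraMap K L (MvPolynomial.eval x f) := aeval_mapVec (.inl v) x f
    rw [h1, sub_self, map_zero]
    exact one_pos
  · rintro p hp ⟨z, hz, hz0, hpz⟩ r hr
    obtain ⟨c, hc⟩ := (Projectivization.mk_eq_mk_iff' L _ _ _ _).1 hpz.symm
    have h1 : MvPolynomial.aeval (Place.mapVec (.inl v) p) f =
        algebraMap K L (MvPolynomial.eval p f) := aeval_mapVec (.inl v) p f
    have h2 : MvPolynomial.aeval z f = c ^ 2 * algebraMap K L (ε * r ^ 2) := by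
      rw [← hr, ← h1]
      exact (congrArg (fun y => MvPolynomial.aeval y f) hc.symm).trans
        (aeval_smul_of_isHomogeneous hf c _)
    -- The scalar c lives in the completion whereas `hns` concerns elements of K; a congruent
    -- element of K takes the place of c·r.
    obtain ⟨s, hs⟩ : ∃ s : K, Valued.v (algebraMap K L s - c * algebraMap K L r) < 1 :=
      (Place.denseRange_algebraMap (.inl v)).exists_mem_open
        (isOpen_setOf_valued_sub_lt_one (c * algebraMap K L r)) ⟨c * algebraMap K L r, by
          rw [Set.mem_ofPred_eq, sub_self, map_zero]
          exact one_pos⟩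
    set u : L := c * algebraMap K L r with hu
    have hεL : Valued.v (algebraMap K L ε) = 1 := (valued_algebraMap v ε).trans hε
    have h3 : Valued.v (algebraMap K L ε * u ^ 2 - algebraMap K L (MvPolynomial.eval x f)) < 1 := by
      have : algebraMap K L ε * u ^ 2 = MvPolynomial.aeval z f := by
        rw [h2, hu, map_mul, map_pow]
        ring
      rw [this]
      exact hz
    have hxL : Valued.v (algebraMap K L (MvPolynomial.eval x f)) = 1 :=
      (valued_algebraMap v _).trans hfx
    have h4 : Valued.v u = 1 := by
      have := Valuation.map_eq_of_sub_lt Valued.v (hxL.symm ▸ h3)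
      rw [hxL, map_mul, hεL, one_mul, map_pow] at this
      exact (pow_eq_one_iff_of_nonneg zero_le two_ne_zero).1 this
    have h5 : Valued.v (algebraMap K L s) = 1 := by
      rw [← h4]
      exact Valuation.map_eq_of_sub_lt Valued.v (h4.symm ▸ hs)
    refine hns s ?_
    have h6 : Valued.v (algebraMap K L ε * (u ^ 2 - algebraMap K L s ^ 2)) < 1 := by
      rw [map_mul, hεL, one_mul, sq_sub_sq, map_mul, Valuation.map_sub_swap]
      refine mul_lt_one_of_nonneg_of_lt_one_right ?_ zero_le hs
      exact (Valuation.map_add _ _ _).trans (max_le h4.le h5.le)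
    have h7 := Valuation.map_sub_lt Valued.v h6 h3
    rw [← valued_algebraMap v]
    convert h7 using 2
    rw [map_sub, map_mul, map_pow]
    ring

/-- Each of the finitely many classes ε is blocked at a place of its own outside T, by a local point
near which f takes no value in ε·K². A nearby Darmon point would have to belong to one of these
classes. -/
theorem not_weakWeakApproximation_darmon (S : Finset (Place K)) (hm : Even m)
    (hf : f.IsHomogeneous 2) (hsq : Squarefree f) (hD : D.IsHypersurface m f) :
    ¬ WeakWeakApproximation S D .darmon := by
  classical
  rintro ⟨T, hT⟩
  have eval_zero : MvPolynomial.eval (0 : Fin N → K) f = 0 := by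
    have := eval_smul_add_smul hf 0 0 0 0
    simpa using this
  obtain ⟨A, hA, -⟩ := exists_finset_of_eventually (K := K)
    (eventually_all.2 fun α => eventually_content_eq_one (form_ne_zero D α))
  obtain ⟨E, hE0, hE⟩ := exists_finset_even_valuation (K := K)
    (s := {v | (Sum.inl v : Place K) ∈ S ∪ A})
    ((S ∪ A).finite_toSet.preimage Sum.inl_injective.injOn)
  obtain ⟨B, hB, -⟩ := exists_finset_of_eventually (K := K)
    (P := fun v => ∀ ε ∈ E, v.valuation K ε = 1 ∧ ∃ x : Fin N → K,
      supVal (v.valuation K) x ≤ 1 ∧ v.valuation K (MvPolynomial.eval x f) = 1 ∧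
        ∀ r : K, ¬ v.valuation K (MvPolynomial.eval x f - ε * r ^ 2) < 1) (by
    rw [Finset.eventually_all]
    exact fun ε hε => (eventually_valuation_eq_one (hE0 ε hε)).and
      (eventually_exists_nonsquare_value hf hsq (hE0 ε hε)))
  have hinf : {v : HeightOneSpectrum (𝓞 K) | (Sum.inl v : Place K) ∉ S ∪ A ∪ T ∪ B}.Infinite := by
    have := ((S ∪ A ∪ T ∪ B).finite_toSet.preimage
      (Sum.inl_injective (α := HeightOneSpectrum (𝓞 K))).injOn).infinite_compl
    exact this
  -- Distinct classes get distinct places, so that the obstructing local points can be prescribed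
  -- independently.
  obtain ⟨g⟩ : Nonempty (E ↪ {v : HeightOneSpectrum (𝓞 K) |
      (Sum.inl v : Place K) ∉ S ∪ A ∪ T ∪ B}) := by
    have := hinf.to_subtype
    exact ⟨E.equivFin.toEmbedding.trans (Fin.valEmbedding.trans (Infinite.natEmbedding _))⟩
  have hgS : ∀ ε, (Sum.inl (g ε).1 : Place K) ∉ S := fun ε h => (g ε).2 (by simp [h])
  have hgA : ∀ ε, (Sum.inl (g ε).1 : Place K) ∉ A := fun ε h => (g ε).2 (by simp [h])
  have hgT : ∀ ε, (Sum.inl (g ε).1 : Place K) ∉ T := fun ε h => (g ε).2 (by simp [h])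
  have hgB : ∀ ε, (Sum.inl (g ε).1 : Place K) ∉ B := fun ε h => (g ε).2 (by simp [h])
  have hx : ∀ ε : E, (g ε).1.valuation K ε = 1 ∧ ∃ x : Fin N → K,
      supVal ((g ε).1.valuation K) x ≤ 1 ∧ (g ε).1.valuation K (MvPolynomial.eval x f) = 1 ∧
        ∀ r : K, ¬ (g ε).1.valuation K (MvPolynomial.eval x f - ε * r ^ 2) < 1 := by
    intro ε
    have := hgB ε
    rw [hB, not_not] at this
    exact this ε ε.2
  choose hεg x hxs hfx hns using hx
  have hx0 : ∀ ε, x ε ≠ 0 := by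
    intro ε h
    have := hfx ε
    rw [h, eval_zero, map_zero] at this
    exact zero_ne_one this
  obtain ⟨x₁, hx₁⟩ : ∃ x, MvPolynomial.eval x f ≠ 0 := by
    by_contra! h
    exact hsq.ne_zero (MvPolynomial.funext fun y => by rw [h y, map_zero])
  -- The adelic point: the obstructing vector at each selected place, a vector of multiplicity zero
  -- at the other finite places, and an arbitrary one off the quadric at the archimedean places.
  have hpt : ∀ v : Place K, ∃ p : Fin N → K, p ≠ 0 ∧
      (∀ α, MvPolynomial.eval p (D.form α) ≠ 0) ∧
      (∀ ε, v = Sum.inl (g ε).1 → p = x ε) ∧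
      ∀ v₀ : HeightOneSpectrum (𝓞 K), v = Sum.inl v₀ → ∀ α,
        v₀.valuation K (MvPolynomial.eval p (D.form α)) =
          content (v₀.valuation K) (D.form α) * supVal (v₀.valuation K) p ^ D.degree α := by
    rintro (v | v)
    · by_cases hv : ∃ ε, v = (g ε).1
      · obtain ⟨ε, rfl⟩ := hv
        have hfx0 : MvPolynomial.eval (x ε) f ≠ 0 := by
          intro h
          have := hfx ε
          rw [h, map_zero] at this
          exact zero_ne_one this
        refine ⟨x ε, hx0 ε, eval_form_ne_zero hD hfx0, fun ε' h => ?_, fun v₀ h α => ?_⟩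
        · rw [g.injective (Subtype.ext (Sum.inl_injective h))]
        · rw [← Sum.inl_injective h]
          refine valuation_form_eq_of_valuation_eq_one hD ?_ (hxs ε) (hfx ε) α
          have := hgA ε
          rwa [hA, not_not] at this
      · obtain ⟨p, hp0, hp⟩ := exists_unit_value hf hsq hD v
        refine ⟨p, hp0, fun α h => ?_, fun ε h => absurd ⟨ε, Sum.inl_injective h⟩ hv,
          fun v₀ h α => ?_⟩
        · have := hp α
          rw [h, map_zero] at this
          exact mul_ne_zero (content_ne_zero _ (form_ne_zero D α))
            (pow_ne_zero _ fun h => hp0 ((supVal_eq_zero_iff _).1 h)) this.symm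
        · rw [← Sum.inl_injective h]
          exact hp α
    · refine ⟨x₁, ?_, eval_form_ne_zero hD hx₁, fun ε h => by simp at h, fun v₀ h => by simp at h⟩
      rintro rfl
      exact hx₁ eval_zero
  choose p hp0 hpα hpε hpv using hpt
  have hW := fun ε => exists_isOpen_forall_ne_mul_sq hf (hεg ε) (hx0 ε) (hfx ε) (hns ε)
  choose W hWo hxW hW using hW
  have hmem := hT (Or.inl (mem_strictAdelicPoints_darmon S T p hp0 hpα fun v => hpv _ v rfl))
  obtain ⟨_, hPW, P, hP, rfl⟩ := mem_closure_iff.1 hmem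
    (⋂ ε : E, (fun y : LocalProduct K N T => y ⟨Sum.inl (g ε).1, hgT ε⟩) ⁻¹' W ε)
    (isOpen_iInter_of_finite fun ε => (hWo ε).preimage
      (continuous_apply (⟨Sum.inl (g ε).1, hgT ε⟩ : {v : Place K // v ∉ T}))) (by
      rw [Set.mem_iInter]
      intro ε
      have h1 := hpε _ ε rfl
      have h2 := hxW ε
      simp only [Set.mem_preimage]
      convert h2)
  rw [Set.mem_iInter] at hPW
  induction P using Projectivization.ind with
  | h q hq =>
    have key : ∀ (ε : E) (r : K), MvPolynomial.eval q f ≠ ε * r ^ 2 := fun ε =>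
      hW ε q hq (hPW ε)
    -- A point on the quadric is excluded by 0 = ε·0². Some ε exists because the class of 1 is
    -- represented.
    by_cases hfq : MvPolynomial.eval q f = 0
    · obtain ⟨ε, hε, -⟩ := hE 1 one_ne_zero fun v _ => ⟨1, by simp⟩
      exact key ⟨ε, hε⟩ 0 (by simp [hfq])
    · obtain ⟨ε, hε, t, -, ht⟩ := hE _ hfq fun v hv => by
        simp only [Set.mem_ofPred_eq, Finset.mem_union, not_or, hA, not_not] at hv
        exact exists_valuation_eq_sq_of_mem_globalPoints_darmon S hm hf hsq hD hq hP hfq hv.1 hv.2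
      exact key ⟨ε, hε⟩ t ht

end DarmonObstruction

/-! ### Double covers of projective space and thin sets -/

section DoubleCover

/-- An element of norm zero satisfies re² = g·im². If im ≠ 0, integral closedness gives im ∣ re, and
g would be a square. So the multiplicative norm has trivial kernel. -/
theorem isDomain_quadraticAlgebra {R : Type*} [CommRing R] [IsDomain R]
    [UniqueFactorizationMonoid R] {g : R} (hg : ¬ IsSquare g) :
    IsDomain (QuadraticAlgebra R g 0) := by
  have hnorm : ∀ z : QuadraticAlgebra R g 0, z.norm = 0 → z = 0 := by
    intro z hz
    have h1 : z.re ^ 2 = g * z.im ^ 2 := by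
      rw [QuadraticAlgebra.norm_def] at hz
      linear_combination hz
    have him : z.im = 0 := by
      by_contra him
      have h2 : z.im ^ 2 ∣ z.re ^ 2 := ⟨g, by rw [h1, mul_comm]⟩
      obtain ⟨k, hk⟩ := (IsIntegrallyClosed.pow_dvd_pow_iff two_ne_zero).1 h2
      refine hg ⟨k, ?_⟩
      have h3 : z.im ^ 2 * g = z.im ^ 2 * (k * k) := by
        rw [hk] at h1
        linear_combination -h1
      exact mul_left_cancel₀ (pow_ne_zero 2 him) h3
    rw [him, zero_pow two_ne_zero, mul_zero] at h1
    exact QuadraticAlgebra.ext (pow_eq_zero_iff two_ne_zero |>.1 h1) him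
  have : NoZeroDivisors (QuadraticAlgebra R g 0) := ⟨fun {a b} hab => by
    have h1 : a.norm * b.norm = 0 := by rw [← map_mul, hab, QuadraticAlgebra.norm_zero]
    exact (mul_eq_zero.1 h1).imp (hnorm a) (hnorm b)⟩
  exact NoZeroDivisors.to_isDomain _

/-- A ring homomorphism on the ring of coefficients and a square root of the image of `g` define a
homomorphism on the quadratic algebra. -/
def quadraticEval {K R A : Type*} [CommRing K] [CommRing R] [CommRing A] [Algebra K R]
    [Algebra K A] {g : R} (φ : R →ₐ[K] A) (r : A) (hr : φ g = r ^ 2) :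
    QuadraticAlgebra R g 0 →ₐ[K] A where
  toFun z := φ z.re + φ z.im * r
  map_one' := by
    rw [QuadraticAlgebra.re_one, QuadraticAlgebra.im_one, map_one, map_zero, zero_mul, add_zero]
  map_zero' := by
    rw [QuadraticAlgebra.re_zero, QuadraticAlgebra.im_zero, map_zero, zero_mul, add_zero]
  map_mul' z w := by
    simp only [QuadraticAlgebra.re_mul, QuadraticAlgebra.im_mul, map_add, map_mul, map_zero, hr]
    ring
  map_add' z w := by
    simp only [QuadraticAlgebra.re_add, QuadraticAlgebra.im_add, map_add]
    ring
  commutes' c := by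
    have h : (algebraMap K (QuadraticAlgebra R g 0) c) = ⟨algebraMap K R c, 0⟩ := rfl
    rw [h, map_zero, zero_mul, add_zero, AlgHom.commutes]

/-! ### The algebra R[√g] -/

section QuadraticAlgebra

variable {R : Type*} [CommRing R] {g : R}

theorem algebraMap_quadraticAlgebra (a : R) :
    algebraMap R (QuadraticAlgebra R g 0) a = ⟨a, 0⟩ :=
  rfl

theorem root_sq : (⟨0, 1⟩ : QuadraticAlgebra R g 0) ^ 2 = algebraMap R _ g := by
  rw [sq, algebraMap_quadraticAlgebra]
  refine QuadraticAlgebra.ext ?_ ?_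
  · rw [QuadraticAlgebra.re_mul]
    simp
  · rw [QuadraticAlgebra.im_mul]
    simp

theorem eq_algebraMap_add_mul_root (b : QuadraticAlgebra R g 0) :
    b = algebraMap R _ b.re + algebraMap R _ b.im * ⟨0, 1⟩ := by
  rw [algebraMap_quadraticAlgebra, algebraMap_quadraticAlgebra]
  refine QuadraticAlgebra.ext ?_ ?_
  · rw [QuadraticAlgebra.re_add, QuadraticAlgebra.re_mul]
    simp
  · rw [QuadraticAlgebra.im_add, QuadraticAlgebra.im_mul]
    simp

theorem star_algebraMap_quadraticAlgebra (a : R) :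
    star (algebraMap R (QuadraticAlgebra R g 0) a) = algebraMap R _ a := by
  rw [algebraMap_quadraticAlgebra]
  exact QuadraticAlgebra.ext (by simp) (by simp)

end QuadraticAlgebra

variable {K : Type u} [Field K] {n : ℕ}

/-- The homogeneous coordinates `[1 : x_1 : ⋯ : x_n]` of the generic point of projective space. -/
noncomputable def genericPoint (K : Type u) [Field K] (n : ℕ) :
    Fin (n + 1) → MvPolynomial (Fin n) K :=
  Fin.cons 1 MvPolynomial.X

theorem eval_aeval_genericPoint (y : Fin n → K) (F : MvPolynomial (Fin (n + 1)) K) :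
    MvPolynomial.eval y (MvPolynomial.aeval (genericPoint K n) F) =
      MvPolynomial.eval (Fin.cons 1 y) F := by
  have h : (fun i => MvPolynomial.eval y (genericPoint K n i)) = Fin.cons 1 y := by
    ext i
    induction i using Fin.cases <;> simp [genericPoint]
  rw [← h]
  exact (MvPolynomial.eval₂_comp_left (MvPolynomial.eval y) _ _ F).trans (by
    rw [MvPolynomial.eval, MvPolynomial.coe_eval₂Hom]
    congr 1
    ext
    simp)

theorem exists_smul_cons_one {x : Fin (n + 1) → K} (hx : x 0 ≠ 0) :
    x = x 0 • (Fin.cons 1 fun i => x i.succ / x 0 : Fin (n + 1) → K) := by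
  ext i
  induction i using Fin.cases with
  | zero => simp
  | succ i => simp [mul_div_cancel₀ _ hx]

/-- Dehomogenization is injective on forms: G vanishes wherever x₀ ≠ 0, so G·X₀ vanishes everywhere.
This is the dominance of the double cover. -/
theorem eq_zero_of_aeval_genericPoint_eq_zero [CharZero K] {d : ℕ}
    {G : MvPolynomial (Fin (n + 1)) K} (hG : G.IsHomogeneous d)
    (h : MvPolynomial.aeval (genericPoint K n) G = 0) : G = 0 := by
  have h1 : G * MvPolynomial.X 0 = 0 := by
    refine MvPolynomial.funext fun x => ?_
    rw [map_mul, map_zero, MvPolynomial.eval_X]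
    by_cases hx : x 0 = 0
    · rw [hx, mul_zero]
    · have h2 := eval_aeval_genericPoint (fun i => x i.succ / x 0) G
      rw [h, map_zero] at h2
      have h3 := aeval_smul_of_isHomogeneous hG (x 0)
        (Fin.cons 1 fun i => x i.succ / x 0 : Fin (n + 1) → K)
      rw [← exists_smul_cons_one hx, MvPolynomial.aeval_eq_eval, MvPolynomial.aeval_eq_eval, ← h2,
        mul_zero] at h3
      rw [h3, zero_mul]
  exact (mul_eq_zero.1 h1).resolve_right (MvPolynomial.X_ne_zero 0)

/-- The points at which a polynomial which is not a square takes square values form a thin set. -/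
theorem isThinOfTypeII_of_isSquare_eval [CharZero K] {g : MvPolynomial (Fin n) K}
    (hg : ¬ IsSquare g) {A : Set (ProjPoint K (n + 1))}
    (hA : ∀ P ∈ A, ∃ (y : Fin n → K) (r : K) (hy : (Fin.cons 1 y : Fin (n + 1) → K) ≠ 0),
      MvPolynomial.eval y g = r ^ 2 ∧ P = Projectivization.mk K _ hy) : IsThinOfTypeII A := by
  let R := MvPolynomial (Fin n) K
  let B := QuadraticAlgebra R g 0
  have hdom : IsDomain B := isDomain_quadraticAlgebra hg
  let h : Fin (n + 1) → B := fun i => algebraMap R B (genericPoint K n i)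
  have hh0 : h 0 = 1 := map_one _
  refine ⟨B, inferInstance, hdom, inferInstance, h, ?_, ?_, ?_, ?_, ?_⟩
  · exact Algebra.FiniteType.trans (S := R) inferInstance inferInstance
  · exact (Ideal.eq_top_iff_one _).2 (Ideal.subset_span ⟨0, hh0⟩)
  · intro d G hG hGh
    refine eq_zero_of_aeval_genericPoint_eq_zero hG ?_
    have h1 : MvPolynomial.aeval h G =
        algebraMap R B (MvPolynomial.aeval (genericPoint K n) G) :=
      MvPolynomial.aeval_algebraMap_apply B (genericPoint K n) G
    rw [hGh] at h1
    exact QuadraticAlgebra.algebraMap_injective (h1.symm.trans (map_zero _).symm)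
  · let M := FractionRing B
    set F₀ := IntermediateField.adjoin K {z : M | ∃ i j, z = algebraMap B M (h i) /
      algebraMap B M (h j)} with hF₀
    let t : M := algebraMap B M ⟨0, 1⟩
    have hR : ∀ a : R, algebraMap B M (algebraMap R B a) ∈ F₀ := by
      intro a
      induction a using MvPolynomial.induction_on with
      | C c => exact F₀.algebraMap_mem c
      | add p q hp hq =>
        rw [map_add, map_add]
        exact F₀.add_mem hp hq
      | mul_X p i hp =>
        rw [map_mul, map_mul]
        refine F₀.mul_mem hp (IntermediateField.subset_adjoin _ _ ⟨i.succ, 0, ?_⟩)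
        rw [hh0, map_one, div_one]
        rfl
    have ht : t ^ 2 = algebraMap B M (algebraMap R B g) := by
      rw [← map_pow, root_sq]
    have htop : IntermediateField.adjoin F₀ {t} = ⊤ := by
      have hB : ∀ b : B, algebraMap B M b ∈ IntermediateField.adjoin F₀ {t} := by
        intro b
        rw [eq_algebraMap_add_mul_root b, map_add, map_mul]
        refine add_mem ?_ (mul_mem ?_ (IntermediateField.mem_adjoin_simple_self F₀ t))
        · exact (IntermediateField.adjoin F₀ {t}).algebraMap_mem ⟨_, hR b.re⟩
        · exact (IntermediateField.adjoin F₀ {t}).algebraMap_mem ⟨_, hR b.im⟩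
      refine eq_top_iff.2 fun z _ => ?_
      obtain ⟨a, b, -, rfl⟩ := IsFractionRing.div_surjective (A := B) z
      exact div_mem (hB a) (hB b)
    have hint : IsIntegral F₀ t := by
      refine IsIntegral.of_pow two_pos ?_
      rw [ht]
      exact isIntegral_algebraMap (x := (⟨_, hR g⟩ : F₀))
    -- Finiteness has to be proved first, because `finrank` is 0 for an infinite extension.
    have hfin : FiniteDimensional F₀ M := by
      have h1 := IntermediateField.adjoin.finiteDimensional hint
      rw [htop] at h1
      exact Module.Finite.equiv (IntermediateField.topEquiv (F := F₀) (E := M)).toLinearEquiv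
    have hpos : 0 < Module.finrank F₀ M := Module.finrank_pos
    -- Conjugation fixes the subfield generated by the coordinates but sends √g to −√g.
    have hne : Module.finrank F₀ M ≠ 1 := by
      intro h1
      rw [IntermediateField.finrank_eq_one_iff_eq_top] at h1
      let σ : M ≃+* M := IsFractionRing.ringEquivOfRingEquiv (starRingAut (R := B))
      have hσ : ∀ b : B, σ (algebraMap B M b) = algebraMap B M (star b) := fun b =>
        IsFractionRing.ringEquivOfRingEquiv_algebraMap _ b
      have hσR : ∀ a : R, σ (algebraMap B M (algebraMap R B a)) =
          algebraMap B M (algebraMap R B a) := by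
        intro a
        rw [hσ, star_algebraMap_quadraticAlgebra]
      have hfix : ∀ z ∈ F₀, σ z = z := by
        intro z hz
        induction hz using IntermediateField.adjoin_induction with
        | mem z hz =>
          obtain ⟨i, j, rfl⟩ := hz
          rw [map_div₀, hσR, hσR]
        | algebraMap c => exact hσR (MvPolynomial.C c)
        | add x y _ _ hx hy => rw [map_add, hx, hy]
        | inv x _ hx => rw [map_inv₀, hx]
        | mul x y _ _ hx hy => rw [map_mul, hx, hy]
      have h2 : algebraMap B M (star ⟨0, 1⟩) = algebraMap B M ⟨0, 1⟩ := by
        rw [← hσ]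
        exact hfix _ (h1 ▸ IntermediateField.mem_top)
      have h3 := congrArg QuadraticAlgebra.im (IsFractionRing.injective B M h2)
      rw [QuadraticAlgebra.im_star] at h3
      exact one_ne_zero (self_eq_neg.1 h3.symm)
    change 2 ≤ Module.finrank F₀ M
    omega
  · intro P hP
    obtain ⟨y, r, hy, hr, rfl⟩ := hA P hP
    have hp : (fun i => quadraticEval (MvPolynomial.aeval y) r
        (by rw [MvPolynomial.aeval_eq_eval]; exact hr) (h i)) =
        (Fin.cons 1 y : Fin (n + 1) → K) := by
      ext i
      change MvPolynomial.aeval y (genericPoint K n i) + MvPolynomial.aeval y 0 * r = _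
      rw [map_zero, zero_mul, add_zero]
      induction i using Fin.cases <;> simp [genericPoint]
    refine ⟨_, hp ▸ hy, ?_⟩
    congr 1
    exact hp.symm

end DoubleCover

/-! ### Thinness of the set of Darmon points -/

section DarmonThin

/-- Replacing y by y − cx is a unipotent change of basis of the plane spanned by x and y. -/
theorem lineDisc_sub_smul {K σ : Type*} [Field K] [Fintype σ] {f : MvPolynomial σ K}
    (hf : f.IsHomogeneous 2) (x y : σ → K) (c : K) :
    lineDisc f x (y - c • x) = lineDisc f x y := by
  have h1 : MvPolynomial.eval (y - c • x) f = c ^ 2 * MvPolynomial.eval x f -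
      c * polarForm f x y + MvPolynomial.eval y f := by
    have h := eval_smul_add_smul hf x y (-c) 1
    rw [show (-c) • x + (1 : K) • y = y - c • x by module] at h
    rw [h]
    ring
  have h2 : MvPolynomial.eval (x + (y - c • x)) f = (1 - c) ^ 2 * MvPolynomial.eval x f +
      (1 - c) * polarForm f x y + MvPolynomial.eval y f := by
    have h := eval_smul_add_smul hf x y (1 - c) 1
    rw [show (1 - c) • x + (1 : K) • y = x + (y - c • x) by module] at h
    rw [h]
    ring
  rw [lineDisc, polarForm, h1, h2, lineDisc]
  ring

open Polynomial in
/-- If a quadratic polynomial in one variable is a constant multiple of a square, then its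
discriminant vanishes. -/
theorem disc_eq_zero_of_eq_mul_sq {K : Type*} [Field K] [CharZero K] {a b c ε : K} {p : K[X]}
    (h : C a + C b * X + C c * X ^ 2 = C ε * p ^ 2) : b ^ 2 - 4 * a * c = 0 := by
  by_contra hd
  have h1 := congrArg derivative h
  simp only [derivative_add, derivative_mul, derivative_C, derivative_X, derivative_pow,
    zero_mul, zero_add, mul_one, Nat.add_one_sub_one, pow_one,
    Nat.cast_ofNat] at h1
  -- With q = a + bX + cX², the discriminant is q'² − 4cq, and q = ε·p² makes it divisible by p². If
  -- it is nonzero, p is constant, so b = c = 0.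
  have h2 : C (b ^ 2 - 4 * a * c) =
      p * (p * (4 * C ε * (C ε * derivative p ^ 2 - C c))) := by
    have h3 : C b + C c * (C 2 * X) = C ε * (C 2 * p * derivative p) := by
      rw [h1]
    have h4 : (C 2 : K[X]) = 2 := rfl
    rw [h4] at h3
    simp only [map_sub, map_mul, map_pow]
    have h5 : (C 4 : K[X]) = 4 := rfl
    rw [h5]
    linear_combination (C b + C c * (2 * X) + C ε * (2 * p * derivative p)) * h3 - 4 * C c * h
  have hp : IsUnit p := isUnit_of_mul_isUnit_left (h2 ▸ isUnit_C.2 (isUnit_iff_ne_zero.2 hd))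
  obtain ⟨u, -, rfl⟩ := Polynomial.isUnit_iff.1 hp
  have hb := congrArg (coeff · 1) h
  have hc := congrArg (coeff · 2) h
  simp only [← C_pow, ← C_mul, coeff_add, coeff_C, coeff_C_mul, coeff_X, coeff_X_pow] at hb hc
  norm_num at hb hc
  exact hd (by rw [hb, hc]; ring)

/-- If f(1, y) were ε times a square, so would its restriction to every affine line be, and all
these restrictions would have discriminant zero. A general line through a point off the quadric
contradicts this. -/
theorem not_isSquare_aeval_genericPoint {K : Type u} [Field K] [CharZero K] {n : ℕ}
    {f : MvPolynomial (Fin (n + 1)) K} (hf : f.IsHomogeneous 2) (hsq : Squarefree f) {ε : K}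
    (hε : ε ≠ 0) :
    ¬ IsSquare (MvPolynomial.C ε⁻¹ * MvPolynomial.aeval (genericPoint K n) f) := by
  rintro ⟨k, hk⟩
  have hk' : ∀ y, MvPolynomial.eval (Fin.cons 1 y) f = ε * MvPolynomial.eval y k ^ 2 := by
    intro y
    have h := congrArg (MvPolynomial.eval y) hk
    rw [map_mul, MvPolynomial.eval_C, eval_aeval_genericPoint, map_mul] at h
    rw [sq, ← h, mul_inv_cancel_left₀ hε]
  obtain ⟨z, hz⟩ : ∃ z, MvPolynomial.eval z (f * MvPolynomial.X 0) ≠ 0 := by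
    by_contra! h
    exact mul_ne_zero hsq.ne_zero (MvPolynomial.X_ne_zero 0)
      (MvPolynomial.funext fun y => by rw [h y, map_zero])
  rw [map_mul, MvPolynomial.eval_X, mul_ne_zero_iff] at hz
  obtain ⟨hfz, hz0⟩ := hz
  set a : Fin n → K := fun i => z i.succ / z 0
  have hfa : MvPolynomial.eval (Fin.cons 1 a) f ≠ 0 := by
    intro h
    refine hfz ?_
    rw [exists_smul_cons_one hz0, ← MvPolynomial.aeval_eq_eval, aeval_smul_of_isHomogeneous hf,
      MvPolynomial.aeval_eq_eval, h, mul_zero]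
  obtain ⟨y, -, hy⟩ := exists_eval_ne_zero_lineDisc_ne_zero hf hsq hfa
  -- Moves the second point to the hyperplane x₀ = 0 without changing the discriminant, so that the
  -- line becomes the affine line a + s·b.
  rw [← lineDisc_sub_smul hf _ y (y 0)] at hy
  set b : Fin n → K := fun i => (y - y 0 • (Fin.cons 1 a : Fin (n + 1) → K)) i.succ with hb
  have hyb : y - y 0 • (Fin.cons 1 a : Fin (n + 1) → K) = Fin.cons 0 b := by
    ext i
    induction i using Fin.cases with
    | zero => simp
    | succ i => simp [hb]
  rw [hyb] at hy
  set p : Polynomial K := MvPolynomial.aeval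
    (fun i => Polynomial.C (a i) + Polynomial.C (b i) * Polynomial.X) k with hp
  have hpe : ∀ s, p.eval s = MvPolynomial.eval (a + s • b) k := by
    intro s
    rw [hp, ← Polynomial.coe_aeval_eq_eval, ← AlgHom.comp_apply,
      MvPolynomial.comp_aeval, MvPolynomial.aeval_eq_eval]
    congr 2
    ext i
    rw [map_add, map_mul, Polynomial.aeval_C, Polynomial.aeval_C, Polynomial.aeval_X,
      Pi.add_apply, Pi.smul_apply, smul_eq_mul, mul_comm s]
    rfl
  have h1 : Polynomial.C (MvPolynomial.eval (Fin.cons 1 a) f) +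
      Polynomial.C (polarForm f (Fin.cons 1 a) (Fin.cons 0 b)) * Polynomial.X +
      Polynomial.C (MvPolynomial.eval (Fin.cons 0 b) f) * Polynomial.X ^ 2 =
      Polynomial.C ε * p ^ 2 := by
    refine Polynomial.funext fun s => ?_
    simp only [Polynomial.eval_add, Polynomial.eval_mul, Polynomial.eval_C, Polynomial.eval_X,
      Polynomial.eval_pow, hpe]
    rw [← hk' (a + s • b)]
    have h := eval_smul_add_smul hf (Fin.cons 1 a) (Fin.cons 0 b) 1 s
    have h2 : (1 : K) • (Fin.cons 1 a : Fin (n + 1) → K) + s • (Fin.cons 0 b : Fin (n + 1) → K) =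
        Fin.cons 1 (a + s • b) := by
      ext i
      induction i using Fin.cases <;> simp
    rw [h2] at h
    rw [h]
    ring
  exact hy (disc_eq_zero_of_eq_mul_sq h1)

variable {K : Type u} [Field K] [NumberField K] {n m : ℕ} {f : MvPolynomial (Fin (n + 1)) K}
  {D : OrbifoldDivisor K (n + 1)}

/-- Darmon points lie on the hyperplane x₀ = 0, on the quadric, or on the image of one of the double
covers f(1, y) = ε·r² of the affine chart, one for each of the finitely many classes ε. -/
theorem isThin_globalPoints_darmon (S : Finset (Place K)) (hm : Even m)
    (hf : f.IsHomogeneous 2) (hsq : Squarefree f) (hD : D.IsHypersurface m f) :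
    IsThin (globalPoints S D .darmon) := by
  classical
  obtain ⟨A, hA, -⟩ := exists_finset_of_eventually (K := K)
    (eventually_all.2 fun α => eventually_content_eq_one (form_ne_zero D α))
  obtain ⟨E, hE0, hE⟩ := exists_finset_even_valuation (K := K)
    (s := {v | (Sum.inl v : Place K) ∈ S ∪ A})
    ((S ∪ A).finite_toSet.preimage Sum.inl_injective.injOn)
  let g : K → MvPolynomial (Fin n) K := fun ε =>
    MvPolynomial.C ε⁻¹ * MvPolynomial.aeval (genericPoint K n) f
  let Y : K → Set (ProjPoint K (n + 1)) := fun ε => {P | ∃ (y : Fin n → K) (r : K)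
    (hy : (Fin.cons 1 y : Fin (n + 1) → K) ≠ 0),
      MvPolynomial.eval y (g ε) = r ^ 2 ∧ P = Projectivization.mk K _ hy}
  refine ⟨{{P | OnHypersurface (MvPolynomial.X 0 : MvPolynomial (Fin (n + 1)) K) P},
    {P | OnHypersurface f P}} ∪ Y '' E, (Set.toFinite _).union (E.finite_toSet.image _), ?_, ?_⟩
  · intro P hP
    induction P using Projectivization.ind with
    | h q hq =>
      by_cases hq0 : q 0 = 0
      · refine Set.mem_sUnion.2 ⟨_, Or.inl (Or.inl rfl), ?_⟩
        refine (onHypersurface_mk (MvPolynomial.isHomogeneous_X K 0) hq).2 ?_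
        rw [MvPolynomial.aeval_X, hq0]
      by_cases hfq : MvPolynomial.eval q f = 0
      · refine Set.mem_sUnion.2 ⟨_, Or.inl (Or.inr rfl), ?_⟩
        refine (onHypersurface_mk hf hq).2 ?_
        rwa [MvPolynomial.aeval_eq_eval]
      obtain ⟨ε, hε, t, -, ht⟩ := hE _ hfq fun v hv => by
        simp only [Set.mem_ofPred_eq, Finset.mem_union, not_or, hA, not_not] at hv
        exact exists_valuation_eq_sq_of_mem_globalPoints_darmon S hm hf hsq hD hq hP hfq hv.1 hv.2
      refine Set.mem_sUnion.2 ⟨_, Or.inr (Set.mem_image_of_mem Y hε), ?_⟩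
      have hy : (Fin.cons 1 fun i => q i.succ / q 0 : Fin (n + 1) → K) ≠ 0 := fun h => by
        have := congrFun h 0
        simp at this
      -- Normalizing the first coordinate to 1 divides f by x₀², hence the square root t by x₀.
      refine ⟨_, t / q 0, hy, ?_, ?_⟩
      · have h := aeval_smul_of_isHomogeneous hf (q 0)
          (Fin.cons 1 fun i => q i.succ / q 0 : Fin (n + 1) → K)
        rw [← exists_smul_cons_one hq0, MvPolynomial.aeval_eq_eval, MvPolynomial.aeval_eq_eval,
          ht] at h
        rw [map_mul, MvPolynomial.eval_C, eval_aeval_genericPoint]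
        have := hE0 ε hε
        field_simp
        linear_combination -h
      · exact (Projectivization.mk_eq_mk_iff' K _ _ _ _).2 ⟨q 0, (exists_smul_cons_one hq0).symm⟩
  · rintro Z ((rfl | rfl) | ⟨ε, hε, rfl⟩)
    · exact Or.inl ⟨1, _, MvPolynomial.isHomogeneous_X K 0, MvPolynomial.X_ne_zero 0,
        fun P hP => hP⟩
    · exact Or.inl ⟨2, f, hf, hsq.ne_zero, fun P hP => hP⟩
    · exact Or.inr (isThinOfTypeII_of_isSquare_eval
        (not_isSquare_aeval_genericPoint hf hsq (hE0 ε hε)) fun P hP => hP)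

end DarmonThin

end SemiIntegral

theorem theorem1p2 (K : Type u) [Field K] [NumberField K]
    (S : Finset (SemiIntegral.Place K))
    (hS : ∀ w : NumberField.InfinitePlace K, (Sum.inr w : SemiIntegral.Place K) ∈ S)
    (n m : ℕ) (hm : 2 ≤ m)
    (f : MvPolynomial (Fin (n + 2)) K) (hf : f.IsHomogeneous 2) (hsq : Squarefree f)
    (D : SemiIntegral.OrbifoldDivisor K (n + 2)) (hD : D.IsHypersurface m f) :
    (SemiIntegral.WeakApproximation S D .campana ∧
      (SemiIntegral.globalPoints S D .campana).Nonempty) ∧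
    (Even m →
      ¬ SemiIntegral.WeakWeakApproximation S D .darmon ∧
        SemiIntegral.IsThin (SemiIntegral.globalPoints S D .darmon)) :=
  ⟨⟨SemiIntegral.weakApproximation_campana S hf hsq hD,
    SemiIntegral.nonempty_globalPoints_campana S hf hsq hD⟩,
    fun h => ⟨SemiIntegral.not_weakWeakApproximation_darmon S h hf hsq hD,
      SemiIntegral.isThin_globalPoints_darmon S h hf hsq hD⟩⟩
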